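/- Notation. For $0<q<1$ let $(a;q)_n=\prod_{k=0}^{n-1}(1-aq^k)$, $(a;q)_\infty=\prod_{k\ge0}(1-aq^k)$, $(a_1,a_2;q)_\infty=(a_1;q)_\infty(a_2;q)_\infty$, $\theta_q(x)=\sum_{n\in\mathbb Z}q^{n(n-1)/2}x^n$ and ${}_2\varphi_1(a,b;c;q,y)=\sum_{n\ge0}\frac{(a;q)_n(b;q)_n}{(c;q)_n(q;q)_n}y^n$. Let $(a)_n=a(a+1)\cdots(a+n-1)$, ${}_1F_1(a;c;y)=\sum_{n\ge0}\frac{(a)_n}{(c)_n\,n!}y^n$, and let ${}_2F_0(a,b;-;z)=\sum_{n\ge0}\frac{(a)_n(b)_n}{n!}z^n$ (a formal power series). Powers of $-z$ are principal values, $z\in\mathbb C\setminus[0,\infty)$, and $1/\Gamma$ is $0$ at the poles of $\Gamma$. Let $${}_2f_1(a,b;q,x)=\frac{(abx;q)_\infty}{\theta_q(-qx)}\,{}_2\varphi_1\!\left(\frac qa,\frac qb;0;q,abx\right)$$ for $|abx|<1$, extended to other $x$ by analytic continuation of the numerator $(abx;q)_\infty\,{}_2\varphi_1(q/a,q/b;0;q,abx)$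 to an entire function of $x$; and let $$R(a,b;q,x)=T(a,b;q,x)+T(b,a;q,x),\qquad T(a,b;q,x)=\frac{(q/a;q)_\infty}{(b/a,q;q)_\infty}\frac{\theta_q(-aqx)}{\theta_q(-qx)}\,{}_2\varphi_1\!\left(a,0;\frac{aq}b;q,\frac q{abx}\right)$$ be the right-hand side of the connection formula for ${}_2f_1$. Theorem. Let $\alpha,\beta\in\mathbb C$ with $\alpha-\beta\notin\mathbb Z$. Put $a=q^\alpha$, $b=q^\beta$, $x=z/(1-q)$, $w=(q;q)_\infty(1-q)^{1-\alpha-\beta}$, and $$F(z)=\frac{\Gamma(\beta-\alpha)}{\Gamma(1-\alpha)}(-z)^{-\alpha}{}_1F_1\!\left(\alpha;\alpha+1-\beta;\frac1z\right)+\frac{\Gamma(\alpha-\beta)}{\Gamma(1-\beta)}(-z)^{-\beta}{}_1F_1\!\left(\beta;\beta+1-\alpha;\frac1z\right).$$ 1. For every $z\in\mathbb C\setminus[0,\infty)$, $\lim_{q\to1-0}w\,R(a,b;q,x)=F(z)$. 2. The entire continuation that defines ${}_2f_1$ exists for every $0<q<1$, and for every $z\in\mathbb C\setminus[0,\infty)$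 also $\lim_{q\to1-0}w\,{}_2f_1(a,b;q,x)=F(z)$. 3. The left-hand side $w\,\frac{(abx;q)_\infty}{\theta_q(-qx)}\,{}_2\varphi_1(q/a,q/b;0;q,abx)$ tends formally to $e^{1/z}(-z)^{1-\alpha-\beta}{}_2F_0(1-\alpha,1-\beta;-;z)$ as $q\to1-0$: for every $z\in\mathbb C\setminus[0,\infty)$, $w\,\frac{(abx;q)_\infty}{\theta_q(-qx)}\to e^{1/z}(-z)^{1-\alpha-\beta}$, and for every $n$ the coefficient of $z^n$ in the power series ${}_2\varphi_1\bigl(q/a,q/b;0;q,\tfrac{ab}{1-q}z\bigr)$ tends to the coefficient of $z^n$ in ${}_2F_0(1-\alpha,1-\beta;-;z)$. 4. The resulting formula $$e^{1/z}(-z)^{1-\alpha-\beta}{}_2F_0(1-\alpha,1-\beta;-;z)\sim F(z)$$ holds as an asymptotic formula: for every $\delta>0$, $e^{-1/z}(-z)^{\alpha+\beta-1}F(z)$ has the Poincaré asymptotic expansion ${}_2F_0(1-\alpha,1-\beta;-;z)$ as $z\to0$ in $|\arg(-z)|\le\pi-\delta$. 5. It is a connection formula for the degenerate confluent equation $z^2u''+\{1+(\alpha+\beta+1)z\}u'+\alpha\beta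 u=0$: the expression $e^{1/z}(-z)^{1-\alpha-\beta}{}_2F_0(1-\alpha,1-\beta;-;z)$ is a formal solution of it, and $(-z)^{-\alpha}{}_1F_1(\alpha;\alpha+1-\beta;1/z)$ and $(-z)^{-\beta}{}_1F_1(\beta;\beta+1-\alpha;1/z)$ are holomorphic solutions of it on $\mathbb C\setminus[0,\infty)$. -/

import Mathlib

open Filter Topology Asymptotics

namespace QConfluent

noncomputable section

/-! ### Basic hypergeometric objects -/

/-- The finite shifted factorial `(a;q)_n = (1 - a)(1 - a q) ⋯ (1 - a q^(n-1))`. -/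
def qPoch (a q : ℂ) (n : ℕ) : ℂ := ∏ k ∈ Finset.range n, (1 - a * q ^ k)

/-- The infinite shifted factorial `(a;q)_∞`, for `|q| < 1`. -/
def qPochInf (a q : ℂ) : ℂ := ∏' k : ℕ, (1 - a * q ^ k)

/-- Jacobi's theta function `θ_q(x) = ∑_{n ∈ ℤ} q^{n(n-1)/2} x^n` (`n(n-1)` is even, so the
division in the exponent is exact). -/
def theta (q x : ℂ) : ℂ := ∑' n : ℤ, q ^ (n * (n - 1) / 2) * x ^ n

/-- The coefficient of `y^n` in `₂φ₁(a, b; c; q, y)`. -/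
def phiCoeff (a b c q : ℂ) (n : ℕ) : ℂ :=
  qPoch a q n * qPoch b q n / (qPoch c q n * qPoch q q n)

/-- The basic hypergeometric series `₂φ₁(a, b; c; q, y)` as a formal power series in `y`. -/
def phiFormal (a b c q : ℂ) : PowerSeries ℂ := PowerSeries.mk (phiCoeff a b c q)

/-- The sum `₂φ₁(a, b; c; q, y)` of the basic hypergeometric series, where it converges. -/
def phi (a b c q y : ℂ) : ℂ := ∑' n : ℕ, phiCoeff a b c q n * y ^ n

/-! ### The two sides of the connection formula -/

/-- The elementary factor `(abx;q)_∞ / θ_q(-qx)`. -/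
def prefactor (a b q x : ℂ) : ℂ := qPochInf (a * b * x) q / theta q (-(q * x))

/-- `u` is the solution
`₂f₁(a, b; q, x) = (abx;q)_∞ / θ_q(-qx) · ₂φ₁(q/a, q/b; 0; q, abx)`
of the `q`-confluent hypergeometric equation. The series converges for `|abx| < 1` only; for the
other `x ≠ 0` the function is given by analytic continuation, its numerator
`(abx;q)_∞ ₂φ₁(q/a, q/b; 0; q, abx)` being an entire function of `x`. -/
def IsTwoFOne (a b q : ℂ) (u : ℂ → ℂ) : Prop :=
  ∃ f : ℂ → ℂ, Differentiable ℂ f ∧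
    (∀ x : ℂ, ‖a * b * x‖ < 1 →
      f x = qPochInf (a * b * x) q * phi (q / a) (q / b) 0 q (a * b * x)) ∧
    ∀ x : ℂ, x ≠ 0 → u x = f x / theta q (-(q * x))

/-- One of the two summands of the connection formula:
`(q/a;q)_∞ / (b/a, q; q)_∞ · θ_q(-aqx) / θ_q(-qx) · ₂φ₁(a, 0; aq/b; q, q/(abx))`. -/
def connectionTerm (a b q x : ℂ) : ℂ :=
  qPochInf (q / a) q / (qPochInf (b / a) q * qPochInf q q) *
    (theta q (-(a * q * x)) / theta q (-(q * x))) *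
    phi a 0 (a * q / b) q (q / (a * b * x))

/-- The right-hand side of the connection formula for `₂f₁(a, b; q, x)`. -/
def connectionRHS (a b q x : ℂ) : ℂ := connectionTerm a b q x + connectionTerm b a q x

/-- The base `q ∈ (0, 1)` raised to a complex exponent. -/
def qPow (q : ℝ) (α : ℂ) : ℂ := (q : ℂ) ^ α

/-- The normalising constant `w(α, β; q) = (q;q)_∞ (1 - q)^{1-α-β}`. -/
def wConst (α β : ℂ) (q : ℝ) : ℂ :=
  qPochInf (q : ℂ) (q : ℂ) * ((1 - q : ℝ) : ℂ) ^ (1 - α - β)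

/-- The variable `x = z / (1 - q)`. -/
def xVar (q : ℝ) (z : ℂ) : ℂ := z / ((1 - q : ℝ) : ℂ)

/-! ### Classical hypergeometric objects -/

/-- The rising factorial `(a)_n = a (a + 1) ⋯ (a + n - 1)`. -/
def rising (a : ℂ) (n : ℕ) : ℂ := ∏ k ∈ Finset.range n, (a + k)

/-- The confluent hypergeometric function `₁F₁(a; c; y)`. -/
def oneFOne (a c y : ℂ) : ℂ :=
  ∑' n : ℕ, rising a n / (rising c n * (n.factorial : ℂ)) * y ^ n

/-- The (in general divergent) formal power series `₂F₀(a, b; -; z)`. -/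
def twoFZero (a b : ℂ) : PowerSeries ℂ :=
  PowerSeries.mk fun n => rising a n * rising b n / (n.factorial : ℂ)

/-- The local solution `(-z)^{-α} ₁F₁(α; α + 1 - β; 1/z)` at infinity. -/
def solInfinity (α β z : ℂ) : ℂ := (-z) ^ (-α) * oneFOne α (α + 1 - β) (1 / z)

/-- `Γ(β-α)/Γ(1-α) (-z)^{-α} ₁F₁(α; α+1-β; 1/z) + Γ(α-β)/Γ(1-β) (-z)^{-β} ₁F₁(β; β+1-α; 1/z)`.
Mathlib's `Complex.Gamma` vanishes at its poles, so that `1 / Γ(1-α) = 0` when `1 - α` is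
a pole, which is the usual convention. -/
def limitRHS (α β z : ℂ) : ℂ :=
  Complex.Gamma (β - α) / Complex.Gamma (1 - α) * solInfinity α β z +
    Complex.Gamma (α - β) / Complex.Gamma (1 - β) * solInfinity β α z

/-- The elementary factor `e^{1/z} (-z)^{1-α-β}`. -/
def expFactor (α β z : ℂ) : ℂ := Complex.exp (1 / z) * (-z) ^ (1 - α - β)

/-- The plane cut along `[0, ∞)`, on which the principal powers of `-z` are holomorphic. -/
def cutPlane : Set ℂ := {z | -z ∈ Complex.slitPlane}

/-- The closed subsector `|arg(-z)| ≤ π - δ` (vertex removed) of the cut plane. -/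
def sector (δ : ℝ) : Set ℂ := {z | z ≠ 0 ∧ |Complex.arg (-z)| ≤ Real.pi - δ}

/-- `h` has the asymptotic expansion `g` in the sense of Poincaré as `z → 0` in `S`. -/
def HasAsymptoticExpansion (h : ℂ → ℂ) (S : Set ℂ) (g : PowerSeries ℂ) : Prop :=
  ∀ N : ℕ, (fun z => h z - ∑ n ∈ Finset.range N, PowerSeries.coeff n g * z ^ n)
    =O[𝓝[S] 0] fun z => z ^ N

/-! ### The degenerate confluent equation -/

/-- `v` is a holomorphic solution on the cut plane of
`z² v'' + {1 + (α + β + 1) z} v' + α β v = 0`. -/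
def IsSolution (α β : ℂ) (v : ℂ → ℂ) : Prop :=
  DifferentiableOn ℂ v cutPlane ∧
    ∀ z ∈ cutPlane,
      z ^ 2 * deriv (deriv v) z + (1 + (α + β + 1) * z) * deriv v z + α * β * v z = 0

/-- The variable `z` as a formal Laurent series. -/
def zVar : LaurentSeries ℂ := HahnSeries.single 1 1

/-- Formal differentiation of expressions `e^{1/z} (-z)^κ g(z)` with `g` a Laurent series:
the derivative is `e^{1/z} (-z)^κ (g' + (-z^{-2} + κ z^{-1}) g)`. -/
def expDeriv (κ : ℂ) (g : LaurentSeries ℂ) : LaurentSeries ℂ :=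
  LaurentSeries.hasseDeriv ℂ 1 g +
    (HahnSeries.single (-2) (-1) + HahnSeries.single (-1) κ) * g

/-- `e^{1/z} (-z)^κ g(z)` is a formal solution of
`z² u'' + {1 + (α + β + 1) z} u' + α β u = 0`. -/
def IsFormalSolution (α β κ : ℂ) (g : PowerSeries ℂ) : Prop :=
  let G : LaurentSeries ℂ := HahnSeries.ofPowerSeries ℤ ℂ g
  zVar ^ 2 * expDeriv κ (expDeriv κ G) +
    (1 + HahnSeries.C (α + β + 1) * zVar) * expDeriv κ G + HahnSeries.C (α * β) * G = 0

end

end QConfluent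

/-!
The connection formula for `₂f₁` is proved for every base `q` for which it makes sense, its
right-hand side is shown to converge as `q → 1`, and the asymptotic formula is obtained from an
estimate of the left-hand side that is uniform in `q`.

*Connection formula.* With `A = q/a`, `B = q/b`, `y = abx`, the claim concerns the numerator
`(y;q)_∞ ₂φ₁(A, B; 0; q, y)`. Multiplying out theta functions and series in `q/y` gives the Laurent
expansion of the other side on `|y| > |q|` (`hasSum_theta_mul`); up to elementary factors its
coefficients are sums of powers of the nodes `B q^n`, `A q^n`, weighted by the residues of
`(ABt;q)_∞ / ((At;q)_∞ (Bt;q)_∞)`. The coefficients of negative index vanish and that of index `0`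
is `1`: this is the limit `M → ∞` of the formula for the leading coefficient in Lagrange
interpolation at the nodes with `n ≤ M` (`sum_nodeWeight`, `connCoeff_nonpos`). As both sides obey
the same recurrence (`numerCoeff_eq`), they have the same coefficients, so the numerator is entire
and equals the other side (`entire_eq_connection`). The entire continuation for *all* parameters
comes from Heine's transformation with the first `N` terms split off (`exists_entire_heine`).

*Limits.* Along a ray off `[0, ∞)` the quotient `(q^s u;q)_∞ / (u;q)_∞` behaves like `(1 - u)^{-s}`
(`tendsto_ratio`): the logarithm of the `k`-th factor is an increment of `s log (1 - u q^k)` up to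
errors which sum to `O((1-q) log (1/(1-q)))`. The same local estimate, now at `u = q^2`, dominates
the product for the `q`-gamma function and yields Euler's product for `1/Γ` (`tendsto_invQGamma`).
By Jacobi's triple product (`theta_neg_eq`) theta quotients become such quotients times factors
`((1-q) t;q)_∞ → e^{-t}` (`tendsto_qPochInf_exp`), and `₂φ₁` tends to `₁F₁` termwise with a uniform
bound (`tendsto_phi_oneFOne`).

*Asymptotics.* Divided by its elementary factor, the left-hand side is a partial sum of order `N`
of `₂φ₁` plus Heine's remainder. The latter is `O(z^N)` on a sector with a constant independent of
`q` (`exists_norm_heine_remainder_le`), and the connection formula identifies the limit of the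
whole with the quotient to be expanded; the bound therefore passes to the limit
(`exists_norm_remainder_le`).

*Differential equation.* For `₁F₁` the equation is a change of variable in Kummer's equation, and
for `₂F₀` it is the recurrence of the coefficients.
-/

namespace QConfluent

noncomputable section

/-! ### Infinite shifted factorials and the `q`-binomial theorem -/

section Basic

variable {q : ℂ}

lemma summable_norm_mul_pow (hq : ‖q‖ < 1) (a : ℂ) : Summable fun k : ℕ => ‖-(a * q ^ k)‖ := by
  simp only [norm_neg, norm_mul, norm_pow]
  exact (summable_geometric_of_lt_one (norm_nonneg _) hq).mul_left _

lemma multipliable_qPochInf (hq : ‖q‖ < 1) (a : ℂ) : Multipliable fun k : ℕ => 1 - a * q ^ k := by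
  simpa [sub_eq_add_neg] using multipliable_one_add_of_summable (summable_norm_mul_pow hq a)

lemma tendsto_qPoch (hq : ‖q‖ < 1) (a : ℂ) :
    Tendsto (qPoch a q) atTop (𝓝 (qPochInf a q)) :=
  (multipliable_qPochInf hq a).hasProd.tendsto_prod_nat

lemma qPoch_succ (a q : ℂ) (n : ℕ) : qPoch a q (n + 1) = qPoch a q n * (1 - a * q ^ n) := by
  simp [qPoch, Finset.prod_range_succ]

lemma qPoch_zero_left (q : ℂ) (n : ℕ) : qPoch 0 q n = 1 := by simp [qPoch]

lemma qPoch_add (a q : ℂ) (m n : ℕ) : qPoch a q (m + n) = qPoch a q m * qPoch (a * q ^ m) q n := by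
  simp only [qPoch, Finset.prod_range_add, pow_add, mul_assoc]

lemma qPochInf_eq_mul (hq : ‖q‖ < 1) (a : ℂ) (n : ℕ) :
    qPochInf a q = qPoch a q n * qPochInf (a * q ^ n) q := by
  have h1 := (tendsto_qPoch hq (a * q ^ n)).const_mul (qPoch a q n)
  have h2 : Tendsto (fun m => qPoch a q (n + m)) atTop (𝓝 (qPochInf a q)) := by
    have := (tendsto_qPoch hq a).comp (tendsto_add_atTop_nat n)
    refine this.congr fun m => ?_
    simp [Function.comp, add_comm]
  refine tendsto_nhds_unique h2 (h1.congr fun m => ?_)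
  rw [qPoch_add]

lemma qPochInf_eq_one_sub_mul (hq : ‖q‖ < 1) (a : ℂ) :
    qPochInf a q = (1 - a) * qPochInf (q * a) q := by
  simpa [qPoch, mul_comm] using qPochInf_eq_mul hq a 1

lemma qPochInf_ne_zero (hq : ‖q‖ < 1) {a : ℂ} (ha : ∀ k : ℕ, a * q ^ k ≠ 1) :
    qPochInf a q ≠ 0 := by
  have := tprod_one_add_ne_zero_of_summable (f := fun k : ℕ => -(a * q ^ k))
    (fun k h => ha k (by linear_combination -h)) (summable_norm_mul_pow hq a)
  simpa [qPochInf, sub_eq_add_neg] using this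

lemma mul_pow_ne_one (hq : ‖q‖ < 1) {a : ℂ} (ha : ‖a‖ < 1) (k : ℕ) : a * q ^ k ≠ 1 := by
  intro h
  have : ‖a * q ^ k‖ < 1 := by
    rw [norm_mul, norm_pow]
    calc ‖a‖ * ‖q‖ ^ k ≤ ‖a‖ * 1 := by
          gcongr; exact pow_le_one₀ (norm_nonneg _) hq.le
      _ < 1 := by simpa using ha
  rw [h] at this
  simp at this

lemma qPoch_ne_zero {a : ℂ} (ha : ∀ k : ℕ, a * q ^ k ≠ 1) (n : ℕ) : qPoch a q n ≠ 0 :=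
  Finset.prod_ne_zero_iff.2 fun k _ => sub_ne_zero.2 (ha k).symm

lemma qPoch_self_ne_zero (hq : ‖q‖ < 1) (n : ℕ) : qPoch q q n ≠ 0 :=
  qPoch_ne_zero (mul_pow_ne_one hq hq) n

lemma one_sub_pow_succ_ne_zero (hq : ‖q‖ < 1) (n : ℕ) : 1 - q ^ (n + 1) ≠ 0 := by
  have := mul_pow_ne_one hq hq n
  rw [← pow_succ'] at this
  exact sub_ne_zero.2 this.symm

lemma exists_norm_qPoch_le (hq : ‖q‖ < 1) (a : ℂ) : ∃ K, 0 < K ∧ ∀ n, ‖qPoch a q n‖ ≤ K := by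
  obtain ⟨K, hK⟩ := (tendsto_qPoch hq a).norm.bddAbove_range
  exact ⟨max K 1, by positivity, fun n => (hK ⟨n, rfl⟩).trans (le_max_left _ _)⟩

lemma exists_norm_inv_qPoch_le (hq : ‖q‖ < 1) {a : ℂ} (ha : ∀ k : ℕ, a * q ^ k ≠ 1) :
    ∃ K, 0 < K ∧ ∀ n, ‖(qPoch a q n)⁻¹‖ ≤ K := by
  obtain ⟨K, hK⟩ := ((tendsto_qPoch hq a).inv₀ (qPochInf_ne_zero hq ha)).norm.bddAbove_range
  exact ⟨max K 1, by positivity, fun n => (hK ⟨n, rfl⟩).trans (le_max_left _ _)⟩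

lemma exists_norm_phiCoeff_le (hq : ‖q‖ < 1) (a b : ℂ) {c : ℂ} (hc : ∀ k : ℕ, c * q ^ k ≠ 1) :
    ∃ K, 0 < K ∧ ∀ n, ‖phiCoeff a b c q n‖ ≤ K := by
  obtain ⟨K₁, h₁, H₁⟩ := exists_norm_qPoch_le hq a
  obtain ⟨K₂, h₂, H₂⟩ := exists_norm_qPoch_le hq b
  obtain ⟨K₃, h₃, H₃⟩ := exists_norm_inv_qPoch_le hq hc
  obtain ⟨K₄, h₄, H₄⟩ := exists_norm_inv_qPoch_le hq (mul_pow_ne_one hq hq)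
  refine ⟨K₁ * K₂ * (K₃ * K₄), by positivity, fun n => ?_⟩
  rw [phiCoeff, div_eq_mul_inv, mul_inv, norm_mul, norm_mul, norm_mul]
  gcongr
  exacts [H₁ n, H₂ n, H₃ n, H₄ n]

lemma summable_norm_mul_pow_of_le {c : ℕ → ℂ} {K : ℝ} (hc : ∀ n, ‖c n‖ ≤ K) {u : ℂ}
    (hu : ‖u‖ < 1) : Summable fun n => ‖c n * u ^ n‖ := by
  refine Summable.of_nonneg_of_le (fun n => norm_nonneg _) (fun n => ?_)
    ((summable_geometric_of_lt_one (norm_nonneg u) hu).mul_left K)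
  rw [norm_mul, norm_pow]
  gcongr
  exact hc n

lemma zero_mul_pow_ne_one (k : ℕ) : (0 : ℂ) * q ^ k ≠ 1 := by simp

lemma summable_phi (hq : ‖q‖ < 1) (a b : ℂ) {c : ℂ} (hc : ∀ k : ℕ, c * q ^ k ≠ 1) {y : ℂ}
    (hy : ‖y‖ < 1) : Summable fun n => ‖phiCoeff a b c q n * y ^ n‖ := by
  obtain ⟨K, -, hK⟩ := exists_norm_phiCoeff_le hq a b hc
  exact summable_norm_mul_pow_of_le hK hy

/-- Multiplication of a power series by a linear factor `1 - B u`. -/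
lemma one_sub_mul_tsum {c : ℕ → ℂ} {u : ℂ} (B : ℂ) (h : Summable fun n => c n * u ^ n) :
    (1 - B * u) * ∑' n, c n * u ^ n = c 0 + ∑' n, (c (n + 1) - B * c n) * u ^ (n + 1) := by
  have h1 : Summable fun n => c (n + 1) * u ^ (n + 1) := (summable_nat_add_iff 1).2 h
  have h2 : ∑' n, (c (n + 1) - B * c n) * u ^ (n + 1)
      = ∑' n, c (n + 1) * u ^ (n + 1) - B * u * ∑' n, c n * u ^ n := by
    rw [← tsum_mul_left, ← h1.tsum_sub (h.mul_left _)]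
    exact tsum_congr fun n => by ring
  rw [h2, sub_mul, one_mul]
  nth_rewrite 1 [h.tsum_eq_zero_add]
  simp
  ring

/-- A power series tends to its constant term along a sequence of arguments `u q^n`. -/
lemma tendsto_tsum_mul_pow (hq : ‖q‖ < 1) {c : ℕ → ℂ} {u : ℂ}
    (h : Summable fun n => ‖c n * u ^ n‖) :
    Tendsto (fun m : ℕ => ∑' n, c n * (u * q ^ m) ^ n) atTop (𝓝 (c 0)) := by
  have h0 : ∑' n, c n * (0 : ℂ) ^ n = c 0 := by
    rw [tsum_eq_single 0]
    · simp
    · intro n hn; simp [hn]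
  rw [← h0]
  have hqm : Tendsto (fun m : ℕ => u * q ^ m) atTop (𝓝 0) := by
    simpa using (tendsto_pow_atTop_nhds_zero_of_norm_lt_one hq).const_mul u
  refine tendsto_tsum_of_dominated_convergence h (fun n => (hqm.pow n).const_mul _)
    (Eventually.of_forall fun m n => ?_)
  rw [norm_mul, norm_mul, norm_pow, norm_pow]
  gcongr
  rw [norm_mul, norm_pow]
  exact mul_le_of_le_one_right (norm_nonneg _) (pow_le_one₀ (norm_nonneg _) hq.le)

/-- The coefficient of `u^n` in the `q`-binomial series `(Au;q)_∞ / (u;q)_∞`. -/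
def binomCoeff (A q : ℂ) (n : ℕ) : ℂ := qPoch A q n / qPoch q q n

lemma binomCoeff_succ (hq : ‖q‖ < 1) (A : ℂ) (n : ℕ) :
    binomCoeff A q (n + 1) = binomCoeff A q n * ((1 - A * q ^ n) / (1 - q ^ (n + 1))) := by
  have := one_sub_pow_succ_ne_zero hq n
  have := qPoch_self_ne_zero hq n
  rw [binomCoeff, binomCoeff, qPoch_succ, qPoch_succ, ← pow_succ']
  field_simp

lemma binomCoeff_zero (A q : ℂ) : binomCoeff A q 0 = 1 := by simp [binomCoeff, qPoch]

lemma exists_norm_binomCoeff_le (hq : ‖q‖ < 1) (A : ℂ) :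
    ∃ K, 0 < K ∧ ∀ n, ‖binomCoeff A q n‖ ≤ K := by
  simpa [phiCoeff, qPoch_zero_left, binomCoeff] using
    exists_norm_phiCoeff_le hq A 0 (c := 0) zero_mul_pow_ne_one

lemma summable_binom (hq : ‖q‖ < 1) (A : ℂ) {u : ℂ} (hu : ‖u‖ < 1) :
    Summable fun n => ‖binomCoeff A q n * u ^ n‖ := by
  obtain ⟨K, -, hK⟩ := exists_norm_binomCoeff_le hq A
  exact summable_norm_mul_pow_of_le hK hu

lemma norm_mul_pow_lt (hq : ‖q‖ < 1) {u : ℂ} (hu : ‖u‖ < 1) (n : ℕ) : ‖u * q ^ n‖ < 1 := by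
  rw [norm_mul, norm_pow]
  exact (mul_le_of_le_one_right (norm_nonneg _) (pow_le_one₀ (norm_nonneg _) hq.le)).trans_lt hu

/-- The `q`-binomial theorem. -/
theorem tsum_binom (hq : ‖q‖ < 1) (A : ℂ) {u : ℂ} (hu : ‖u‖ < 1) :
    ∑' n, binomCoeff A q n * u ^ n = qPochInf (A * u) q / qPochInf u q := by
  have step : ∀ v : ℂ, ‖v‖ < 1 → (1 - v) * ∑' n, binomCoeff A q n * v ^ n
      = (1 - A * v) * ∑' n, binomCoeff A q n * (v * q) ^ n := by
    intro v hv
    have hs := (summable_binom hq A hv).of_norm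
    have hs' : Summable fun n => (binomCoeff A q n * q ^ n) * v ^ n := by
      have := (summable_binom hq A (u := v * q) (by simpa using norm_mul_pow_lt hq hv 1)).of_norm
      refine this.congr fun n => ?_
      rw [mul_pow]; ring
    have e1 := one_sub_mul_tsum 1 hs
    have e2 := one_sub_mul_tsum A hs'
    rw [one_mul] at e1
    rw [e1]
    have : ∀ n, binomCoeff A q n * (v * q) ^ n = (binomCoeff A q n * q ^ n) * v ^ n := by
      intro n; rw [mul_pow]; ring
    simp only [this, e2, pow_zero, mul_one]
    congr 1
    refine tsum_congr fun n => ?_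
    have := one_sub_pow_succ_ne_zero hq n
    rw [binomCoeff_succ hq]
    field_simp
    ring
  have iter : ∀ m : ℕ, qPoch u q m * ∑' n, binomCoeff A q n * u ^ n
      = qPoch (A * u) q m * ∑' n, binomCoeff A q n * (u * q ^ m) ^ n := by
    intro m
    induction m with
    | zero => simp [qPoch]
    | succ m ih =>
      have := step (u * q ^ m) (norm_mul_pow_lt hq hu m)
      rw [qPoch_succ, qPoch_succ, pow_succ, ← mul_assoc u]
      linear_combination (1 - u * q ^ m) * ih + qPoch (A * u) q m * this
  have hne : qPochInf u q ≠ 0 := qPochInf_ne_zero hq (mul_pow_ne_one hq hu)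
  rw [eq_div_iff hne, mul_comm]
  have l1 := (tendsto_qPoch hq u).mul_const (∑' n, binomCoeff A q n * u ^ n)
  have l2 := (tendsto_qPoch hq (A * u)).mul (tendsto_tsum_mul_pow hq (summable_binom hq A hu))
  rw [binomCoeff_zero, mul_one] at l2
  exact tendsto_nhds_unique l1 (l2.congr fun m => (iter m).symm)

end Basic

/-! ### Everywhere convergent power series -/

/-- The power series with coefficients `c` converges absolutely on the whole plane. -/
def IsEntireSeries (c : ℕ → ℂ) : Prop := ∀ u : ℂ, Summable fun n => ‖c n * u ^ n‖

/-- The sequence of coefficients of the derived power series. -/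
def derivCoeff (c : ℕ → ℂ) (n : ℕ) : ℂ := (n + 1) * c (n + 1)

lemma IsEntireSeries.derivCoeff {c : ℕ → ℂ} (hc : IsEntireSeries c) :
    IsEntireSeries (derivCoeff c) := by
  intro u
  -- `n + 1 ≤ 2 ^ (n + 1)`, so the series is dominated by the original one at `2 (|u| + 1)`
  have h := (summable_nat_add_iff 1).2 (hc ((2 * (‖u‖ + 1) : ℝ) : ℂ))
  refine Summable.of_nonneg_of_le (fun n => norm_nonneg _) (fun n => ?_) h
  have h1 : ((n : ℝ) + 1) ≤ 2 ^ (n + 1) := by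
    exact_mod_cast (Nat.lt_two_pow_self (n := n + 1)).le
  have h2 : ‖((n : ℂ) + 1)‖ = (n : ℝ) + 1 := by
    rw [← Nat.cast_succ, Complex.norm_natCast]; simp
  have h3 : ‖u‖ ^ n ≤ (‖u‖ + 1) ^ (n + 1) :=
    (pow_le_pow_left₀ (norm_nonneg _) (by linarith) n).trans
      (pow_le_pow_right₀ (by linarith [norm_nonneg u]) (by omega))
  rw [QConfluent.derivCoeff, norm_mul, norm_mul, norm_mul, norm_pow, norm_pow, h2,
    Complex.norm_real, Real.norm_of_nonneg (by positivity), mul_pow]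
  calc ((n : ℝ) + 1) * ‖c (n + 1)‖ * ‖u‖ ^ n
      ≤ 2 ^ (n + 1) * ‖c (n + 1)‖ * (‖u‖ + 1) ^ (n + 1) := by gcongr
    _ = _ := by ring

lemma IsEntireSeries.hasDerivAt {c : ℕ → ℂ} (hc : IsEntireSeries c) (u : ℂ) :
    HasDerivAt (fun v => ∑' n, c n * v ^ n) (∑' n, QConfluent.derivCoeff c n * u ^ n) u := by
  have hR : ‖u‖ < ‖u‖ + 1 := by linarith
  set R : ℝ := ‖u‖ + 1
  have hRp : 0 < R := by positivity
  have hs : Summable fun n : ℕ => ‖(n : ℂ) * c n‖ * R ^ (n - 1) := by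
    refine (summable_nat_add_iff 1).1 ?_
    refine (hc.derivCoeff (R : ℂ)).congr fun n => ?_
    rw [QConfluent.derivCoeff, norm_mul _ ((R : ℂ) ^ n), norm_pow, Complex.norm_real,
      Real.norm_of_nonneg hRp.le]
    simp
  have key := hasDerivAt_tsum_of_isPreconnected (g := fun n v => c n * v ^ n)
    (g' := fun n v => (n : ℂ) * c n * v ^ (n - 1)) (t := Metric.ball (0 : ℂ) R) (y₀ := 0) (y := u)
    hs Metric.isOpen_ball (convex_ball _ _).isPreconnected ?_ ?_ ?_ ?_ ?_
  · have hs' : Summable fun n : ℕ => (n : ℂ) * c n * u ^ (n - 1) := by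
      refine Summable.of_norm_bounded hs fun n => ?_
      rw [norm_mul, norm_pow]
      gcongr
    have e : ∑' n : ℕ, (n : ℂ) * c n * u ^ (n - 1) = ∑' n, QConfluent.derivCoeff c n * u ^ n := by
      rw [hs'.tsum_eq_zero_add]
      simp [QConfluent.derivCoeff]
    rwa [e] at key
  · intro n v _
    have := (hasDerivAt_pow n v).const_mul (c n)
    rwa [show c n * (n * v ^ (n - 1)) = (n : ℂ) * c n * v ^ (n - 1) by ring] at this
  · intro n v hv
    rw [norm_mul, norm_pow]
    gcongr
    simpa using (mem_ball_zero_iff.1 hv).le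
  · simpa using hRp
  · exact (hc 0).of_norm
  · simpa using hR

lemma IsEntireSeries.differentiable {c : ℕ → ℂ} (hc : IsEntireSeries c) :
    Differentiable ℂ fun v => ∑' n, c n * v ^ n := fun u => (hc.hasDerivAt u).differentiableAt

/-- The ratio test: a power series is entire if the quotients of successive coefficients
are bounded by a null sequence. -/
lemma isEntireSeries_of_ratio {c : ℕ → ℂ} {r : ℕ → ℂ} (hr : Tendsto r atTop (𝓝 0))
    (h : ∀ n, c (n + 1) = r n * c n) : IsEntireSeries c := by
  intro u
  have h0 : Tendsto (fun n => ‖r n * u‖) atTop (𝓝 0) := by simpa using (hr.mul_const u).norm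
  have hr2 : ∀ᶠ n in atTop, ‖r n * u‖ ≤ 1 / 2 := h0.eventually (ge_mem_nhds (by norm_num))
  refine Summable.norm (f := fun n => c n * u ^ n)
    (summable_of_ratio_norm_eventually_le (r := 1 / 2) (by norm_num) ?_)
  filter_upwards [hr2] with n hn
  rw [h n, pow_succ]
  calc ‖r n * c n * (u ^ n * u)‖ = ‖r n * u‖ * ‖c n * u ^ n‖ := by
        rw [← norm_mul]; congr 1; ring
    _ ≤ 1 / 2 * ‖c n * u ^ n‖ := by gcongr

/-! ### Euler's expansion -/

section Euler

variable {q : ℂ}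

/-- The coefficient of `u^n` in Euler's expansion of `(u;q)_∞`; the exponent `n(n-1)/2` is taken
in `ℤ` to match the definition of `theta`. -/
def eulerCoeff (q : ℂ) (n : ℕ) : ℂ := (-1) ^ n * q ^ ((n : ℤ) * (n - 1) / 2) / qPoch q q n

lemma tri_succ (n : ℤ) : (n + 1) * (n + 1 - 1) / 2 = n * (n - 1) / 2 + n := by
  have : (n + 1) * (n + 1 - 1) = n * (n - 1) + n * 2 := by ring
  rw [this, Int.add_mul_ediv_right _ _ two_ne_zero]

lemma tri_add (m n : ℤ) :
    (m + n) * (m + n - 1) / 2 = m * (m - 1) / 2 + (m * n + n * (n - 1) / 2) := by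
  obtain ⟨k, hk⟩ := Int.even_mul_pred_self n
  have : (m + n) * (m + n - 1) = m * (m - 1) + (m * n + k) * 2 := by linear_combination hk
  rw [this, Int.add_mul_ediv_right _ _ two_ne_zero, hk, ← mul_two,
    Int.mul_ediv_cancel _ two_ne_zero]

lemma eulerCoeff_zero (q : ℂ) : eulerCoeff q 0 = 1 := by simp [eulerCoeff, qPoch]

lemma eulerCoeff_succ (hq : ‖q‖ < 1) (hq0 : q ≠ 0) (n : ℕ) :
    eulerCoeff q (n + 1) = -q ^ n / (1 - q ^ (n + 1)) * eulerCoeff q n := by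
  have := one_sub_pow_succ_ne_zero hq n
  have := qPoch_self_ne_zero hq n
  rw [eulerCoeff, eulerCoeff, qPoch_succ, ← pow_succ', Nat.cast_succ, tri_succ, zpow_add₀ hq0,
    zpow_natCast]
  field_simp
  ring

lemma isEntireSeries_eulerCoeff (hq : ‖q‖ < 1) (hq0 : q ≠ 0) :
    IsEntireSeries (eulerCoeff q) := by
  refine isEntireSeries_of_ratio (r := fun n => -q ^ n / (1 - q ^ (n + 1))) ?_
    (eulerCoeff_succ hq hq0)
  have h := tendsto_pow_atTop_nhds_zero_of_norm_lt_one hq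
  have := h.neg.div (((tendsto_add_atTop_iff_nat 1).2 h).const_sub 1) (by simp)
  rw [neg_zero, zero_div] at this
  exact this

/-- Euler's expansion of the infinite shifted factorial. -/
theorem tsum_euler (hq : ‖q‖ < 1) (hq0 : q ≠ 0) (u : ℂ) :
    ∑' n, eulerCoeff q n * u ^ n = qPochInf u q := by
  have he := isEntireSeries_eulerCoeff hq hq0
  have step : ∀ v : ℂ, ∑' n, eulerCoeff q n * v ^ n
      = (1 - v) * ∑' n, eulerCoeff q n * (v * q) ^ n := by
    intro v
    have e1 := one_sub_mul_tsum 0 (he v).of_norm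
    have hs' : Summable fun n => (eulerCoeff q n * q ^ n) * v ^ n := by
      refine (he (v * q)).of_norm.congr fun n => ?_
      rw [mul_pow]; ring
    have e2 := one_sub_mul_tsum 1 hs'
    have : ∀ n, eulerCoeff q n * (v * q) ^ n = (eulerCoeff q n * q ^ n) * v ^ n := by
      intro n; rw [mul_pow]; ring
    simp only [this]
    rw [one_mul] at e2
    rw [e2]
    simp only [zero_mul, sub_zero, one_mul] at e1
    rw [e1]
    simp only [pow_zero, mul_one]
    congr 1
    refine tsum_congr fun n => ?_
    have := one_sub_pow_succ_ne_zero hq n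
    rw [eulerCoeff_succ hq hq0]
    field_simp
    ring
  have iter : ∀ m : ℕ, ∑' n, eulerCoeff q n * u ^ n
      = qPoch u q m * ∑' n, eulerCoeff q n * (u * q ^ m) ^ n := by
    intro m
    induction m with
    | zero => simp [qPoch]
    | succ m ih => rw [ih, qPoch_succ, step (u * q ^ m), pow_succ]; ring_nf
  have l2 := (tendsto_qPoch hq u).mul (tendsto_tsum_mul_pow hq (he u))
  rw [eulerCoeff_zero, mul_one] at l2
  exact tendsto_nhds_unique tendsto_const_nhds (l2.congr fun m => (iter m).symm)

lemma differentiable_qPochInf (hq : ‖q‖ < 1) (hq0 : q ≠ 0) :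
    Differentiable ℂ fun u => qPochInf u q := by
  have := (isEntireSeries_eulerCoeff hq hq0).differentiable
  simpa only [tsum_euler hq hq0] using this

/-- `Σ t^k / (q;q)_k = 1 / (t;q)_∞`. -/
lemma tsum_pow_div_qPoch (hq : ‖q‖ < 1) {t : ℂ} (ht : ‖t‖ < 1) :
    ∑' k, t ^ k / qPoch q q k = 1 / qPochInf t q := by
  have := tsum_binom hq 0 ht
  simp only [binomCoeff, qPoch_zero_left, zero_mul] at this
  rw [show qPochInf 0 q = 1 by simp [qPochInf]] at this
  rw [← this]
  exact tsum_congr fun k => by ring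

end Euler

/-! ### The theta function -/

section Theta

variable {q : ℂ}

lemma summable_theta_nat (hq : ‖q‖ < 1) (hq0 : q ≠ 0) (x : ℂ) :
    Summable fun n : ℕ => ‖q ^ ((n : ℤ) * (n - 1) / 2) * x ^ n‖ := by
  refine isEntireSeries_of_ratio (c := fun n : ℕ => q ^ ((n : ℤ) * (n - 1) / 2))
    (tendsto_pow_atTop_nhds_zero_of_norm_lt_one hq) (fun n => ?_) x
  rw [Nat.cast_succ, tri_succ, zpow_add₀ hq0, zpow_natCast, mul_comm]

lemma tri_neg (n : ℤ) : -n * (-n - 1) / 2 = n * (n - 1) / 2 + n := by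
  rw [← tri_succ]; congr 1; ring

lemma summable_theta (hq : ‖q‖ < 1) (hq0 : q ≠ 0) {x : ℂ} (hx : x ≠ 0) :
    Summable fun n : ℤ => ‖q ^ (n * (n - 1) / 2) * x ^ n‖ := by
  refine Summable.of_nat_of_neg ?_ ?_
  · simpa using summable_theta_nat hq hq0 x
  · refine (summable_theta_nat hq hq0 (q / x)).congr fun n => ?_
    rw [tri_neg, zpow_add₀ hq0, zpow_neg, zpow_natCast, zpow_natCast, div_pow]
    congr 1
    field_simp

/-- The Laurent expansion of a product of a theta function and a power series in `1/x`; here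
`g n` stands for the `n`-th term of the power series, including the power of `1/x`. -/
theorem hasSum_theta_mul (hq : ‖q‖ < 1) (hq0 : q ≠ 0) {x : ℂ} (hx : x ≠ 0) {g : ℕ → ℂ}
    (hg : Summable fun n => ‖g n‖) :
    HasSum (fun m : ℤ => q ^ (m * (m - 1) / 2) * x ^ m *
      ∑' n : ℕ, g n * (q ^ (m * n + (n : ℤ) * (n - 1) / 2) * x ^ n))
      (theta q x * ∑' n, g n) := by
  have hf := summable_theta hq hq0 hx
  have hprod : HasSum (fun p : ℤ × ℕ => q ^ (p.1 * (p.1 - 1) / 2) * x ^ p.1 * g p.2)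
      (theta q x * ∑' n, g n) := by
    rw [theta, tsum_mul_tsum_of_summable_norm hf hg]
    exact (summable_mul_of_summable_norm hf hg).hasSum
  -- the shift `(m, n) ↦ (m + n, n)` collects equal powers of `x`
  let e : ℤ × ℕ ≃ ℤ × ℕ :=
    { toFun := fun p => (p.1 + p.2, p.2)
      invFun := fun p => (p.1 - p.2, p.2)
      left_inv := fun p => by simp
      right_inv := fun p => by simp }
  have h2 := e.hasSum_iff.2 hprod
  have h3 := h2.prod_fiberwise fun m => (h2.summable.prod_factor m).hasSum
  refine h3.congr_fun fun m => ?_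
  rw [← tsum_mul_left]
  refine tsum_congr fun n => ?_
  simp only [e, Equiv.coe_fn_mk, Function.comp_apply]
  rw [tri_add, zpow_add₀ hx, zpow_natCast]
  simp only [zpow_add₀ hq0]
  ring

lemma qPochInf_eq_zero (hq : ‖q‖ < 1) {a : ℂ} {k : ℕ} (h : a * q ^ k = 1) :
    qPochInf a q = 0 := by
  rw [qPochInf_eq_mul hq a (k + 1), qPoch_succ, h]
  simp

/-- A series over `ℤ` whose terms of negative index vanish. -/
lemma hasSum_nat_of_hasSum_int {f : ℤ → ℂ} {s : ℂ} (h : HasSum f s)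
    (hf : ∀ n : ℕ, f (-(n + 1)) = 0) : HasSum (fun n : ℕ => f n) s := by
  refine (Nat.cast_injective.hasSum_iff (f := f) fun m hm => ?_).2 h
  obtain ⟨n, rfl | rfl⟩ := m.eq_nat_or_neg
  · exact absurd ⟨n, rfl⟩ hm
  · cases n with
    | zero => exact absurd ⟨0, by simp⟩ hm
    | succ n => simpa using hf n

/-- Jacobi's triple product identity, on the part `|y| > |q|` of the plane. -/
theorem theta_neg_eq (hq : ‖q‖ < 1) (hq0 : q ≠ 0) {y : ℂ} (hy : y ≠ 0) (hqy : ‖q / y‖ < 1) :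
    theta q (-y) = qPochInf q q * qPochInf y q * qPochInf (q / y) q := by
  have hg : Summable fun n => ‖(q / y) ^ n / qPoch q q n‖ := by
    refine (summable_binom hq 0 hqy).congr fun n => ?_
    rw [binomCoeff, qPoch_zero_left]
    congr 1
    ring
  have h := hasSum_theta_mul hq hq0 (neg_ne_zero.2 hy) hg
  rw [tsum_pow_div_qPoch hq hqy] at h
  have inner : ∀ m : ℤ, ∑' n : ℕ, (q / y) ^ n / qPoch q q n *
      (q ^ (m * n + (n : ℤ) * (n - 1) / 2) * (-y) ^ n) = qPochInf (q ^ (m + 1)) q := by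
    intro m
    rw [← tsum_euler hq hq0]
    refine tsum_congr fun n => ?_
    rw [eulerCoeff, zpow_add₀ hq0, zpow_mul, zpow_natCast, zpow_add_one₀ hq0, mul_pow, neg_pow,
      div_pow]
    field_simp
  simp only [inner] at h
  have h' := hasSum_nat_of_hasSum_int h fun n => by
    rw [qPochInf_eq_zero hq (k := n), mul_zero]
    rw [← zpow_natCast, ← zpow_add₀ hq0]
    simp
  have hqq : qPochInf q q ≠ 0 := qPochInf_ne_zero hq (mul_pow_ne_one hq hq)
  have h'' : HasSum (fun n : ℕ => qPochInf q q * (eulerCoeff q n * y ^ n))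
      (theta q (-y) * (1 / qPochInf (q / y) q)) := by
    refine h'.congr_fun fun n => ?_
    have e := qPochInf_eq_mul hq q n
    rw [← pow_succ'] at e
    have := qPoch_self_ne_zero hq n
    rw [eulerCoeff, e, zpow_natCast, neg_pow y, ← Nat.cast_succ, zpow_natCast]
    field_simp
  have h3 := h''.tsum_eq
  rw [tsum_mul_left, tsum_euler hq hq0] at h3
  have hne : qPochInf (q / y) q ≠ 0 := qPochInf_ne_zero hq (mul_pow_ne_one hq hqy)
  rw [h3]
  field_simp

end Theta

/-! ### The Laurent coefficients of the connection formula -/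

section Laurent

variable {q A B : ℂ}

/-- Up to a constant, the residue of `(ABt;q)_∞ / ((At;q)_∞ (Bt;q)_∞)` at `t = 1 / (B q^n)`. -/
def kappa (A B q : ℂ) (n : ℕ) : ℂ :=
  phiCoeff (q / A) 0 (q * B / A) q n * (-B) ^ n * q ^ ((n : ℤ) * (n - 1) / 2 + n)

lemma kappa_zero (A B q : ℂ) : kappa A B q 0 = 1 := by simp [kappa, phiCoeff, qPoch]

lemma one_sub_mul_div_ne_zero (hA : A ≠ 0) (hAB : ∀ n : ℤ, A ≠ B * q ^ n) (n : ℕ) :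
    1 - q ^ (n + 1) * B / A ≠ 0 := by
  rw [sub_ne_zero, ne_comm, Ne, div_eq_one_iff_eq hA]
  intro h
  refine hAB (n + 1 : ℕ) ?_
  rw [zpow_natCast, ← h, mul_comm]

lemma mul_div_mul_pow_ne_one (hA : A ≠ 0) (hAB : ∀ n : ℤ, A ≠ B * q ^ n) (k : ℕ) :
    q * B / A * q ^ k ≠ 1 := by
  have := one_sub_mul_div_ne_zero hA hAB k
  rw [sub_ne_zero, ne_comm] at this
  rwa [show q * B / A * q ^ k = q ^ (k + 1) * B / A by ring]

lemma kappa_succ (hq : ‖q‖ < 1) (hq0 : q ≠ 0) (hA : A ≠ 0) (hAB : ∀ n : ℤ, A ≠ B * q ^ n)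
    (n : ℕ) : kappa A B q (n + 1) = (1 - q ^ (n + 1) / A) * (-B * q ^ (n + 1)) /
      ((1 - q ^ (n + 1)) * (1 - q ^ (n + 1) * B / A)) * kappa A B q n := by
  have h1 := one_sub_pow_succ_ne_zero hq n
  have h2 := one_sub_mul_div_ne_zero hA hAB n
  have h3 := qPoch_self_ne_zero hq n
  have h4 := qPoch_ne_zero (mul_div_mul_pow_ne_one hA hAB) n
  simp only [kappa, phiCoeff, qPoch_succ, qPoch_zero_left]
  rw [Nat.cast_succ, tri_succ, zpow_add₀ hq0, zpow_add_one₀ hq0,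
    show q / A * q ^ n = q ^ (n + 1) / A by ring, zpow_natCast,
    show q * B / A * q ^ n = q ^ (n + 1) * B / A by ring, ← pow_succ', zpow_add₀ hq0, zpow_natCast]
  rw [div_mul_eq_mul_div, div_mul_eq_mul_div, div_mul_eq_mul_div, div_mul_eq_mul_div,
    div_mul_eq_mul_div, mul_div_assoc', div_div, div_eq_div_iff]
  · ring
  · exact mul_ne_zero (mul_ne_zero h4 h2) (mul_ne_zero h3 h1)
  · exact mul_ne_zero (mul_ne_zero h4 h3) (mul_ne_zero h1 h2)

lemma summable_kappa (hq : ‖q‖ < 1) (hq0 : q ≠ 0) (hA : A ≠ 0)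
    (hAB : ∀ n : ℤ, A ≠ B * q ^ n) (m : ℤ) :
    Summable fun n : ℕ => ‖kappa A B q n * (B * q ^ n) ^ m‖ := by
  have h := (tendsto_add_atTop_iff_nat 1).2 (tendsto_pow_atTop_nhds_zero_of_norm_lt_one hq)
  have hr : Tendsto (fun n : ℕ => (1 - q ^ (n + 1) / A) * (-B * q ^ (n + 1)) /
      ((1 - q ^ (n + 1)) * (1 - q ^ (n + 1) * B / A)) * q ^ m) atTop (𝓝 0) := by
    have := (((h.div_const A).const_sub 1).mul (h.const_mul (-B))).div
      ((h.const_sub 1).mul (((h.mul_const B).div_const A).const_sub 1)) (by simp)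
    simpa using this.mul_const (q ^ m)
  have := isEntireSeries_of_ratio (c := fun n : ℕ => kappa A B q n * (B * q ^ n) ^ m) hr
    (fun n => by
      rw [kappa_succ hq hq0 hA hAB, pow_succ q n, ← mul_assoc B, mul_zpow (B * q ^ n)]
      ring) 1
  simpa using this

/-- The sum of the series `Σ_n κ_n (B q^n)^m`. -/
def kappaSum (A B q : ℂ) (m : ℤ) : ℂ := ∑' n : ℕ, kappa A B q n * (B * q ^ n) ^ m

lemma kappa_succ_mul (hq : ‖q‖ < 1) (hq0 : q ≠ 0) (hA : A ≠ 0)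
    (hAB : ∀ n : ℤ, A ≠ B * q ^ n) (n : ℕ) :
    kappa A B q (n + 1) * (B * q ^ (n + 1) - B) * (B * q ^ (n + 1) - A)
      = kappa A B q n * (B * q ^ (n + 1)) * (B * q ^ (n + 1) - A * B) := by
  have h1 := one_sub_pow_succ_ne_zero hq n
  have h2 := one_sub_mul_div_ne_zero hA hAB n
  have h3 : kappa A B q (n + 1) * ((1 - q ^ (n + 1)) * (1 - q ^ (n + 1) * B / A))
      = (1 - q ^ (n + 1) / A) * (-B * q ^ (n + 1)) * kappa A B q n := by
    rw [kappa_succ hq hq0 hA hAB, div_mul_eq_mul_div, div_mul_cancel₀ _ (mul_ne_zero h1 h2)]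
  have e1 : kappa A B q (n + 1) * (B * q ^ (n + 1) - B) * (B * q ^ (n + 1) - A)
      = A * B * (kappa A B q (n + 1) * ((1 - q ^ (n + 1)) * (1 - q ^ (n + 1) * B / A))) := by
    field_simp
    ring
  rw [e1, h3]
  field_simp
  ring

/-- The contiguous relation of the sums `Σ_n κ_n (B q^n)^m`. -/
lemma kappaSum_rec (hq : ‖q‖ < 1) (hq0 : q ≠ 0) (hA : A ≠ 0) (hB : B ≠ 0)
    (hAB : ∀ n : ℤ, A ≠ B * q ^ n) (m : ℤ) :
    (1 - q ^ m) * kappaSum A B q m = (A + B - A * B * q ^ (m - 1)) * kappaSum A B q (m - 1)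
      - A * B * kappaSum A B q (m - 2) := by
  obtain ⟨k, rfl⟩ : ∃ k, m = k + 1 + 1 := ⟨m - 2, by ring⟩
  rw [show k + 1 + 1 - 1 = k + 1 by ring, show k + 1 + 1 - 2 = k by ring]
  have hs := fun m => (summable_kappa hq hq0 hA hAB m).of_norm
  have hl : ∀ n : ℕ, B * q ^ n ≠ 0 := fun n => mul_ne_zero hB (pow_ne_zero _ hq0)
  have pointwise : ∀ n : ℕ, kappa A B q n * (B * q ^ n) ^ (k + 1 + 1)
      - (A + B) * (kappa A B q n * (B * q ^ n) ^ (k + 1))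
      + A * B * (kappa A B q n * (B * q ^ n) ^ k)
      = kappa A B q n * (B * q ^ n - B) * (B * q ^ n - A) * (B * q ^ n) ^ k := by
    intro n
    rw [zpow_add_one₀ (hl n), zpow_add_one₀ (hl n)]
    ring
  have lhs : kappaSum A B q (k + 1 + 1) - (A + B) * kappaSum A B q (k + 1)
        + A * B * kappaSum A B q k
      = ∑' n : ℕ, kappa A B q n * (B * q ^ n - B) * (B * q ^ n - A) * (B * q ^ n) ^ k := by
    simp only [kappaSum]
    rw [← tsum_mul_left, ← tsum_mul_left, ← (hs _).tsum_sub ((hs _).mul_left _),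
      ← ((hs _).sub ((hs _).mul_left _)).tsum_add ((hs _).mul_left _)]
    exact tsum_congr pointwise
  have rhs : q ^ (k + 1 + 1) * kappaSum A B q (k + 1 + 1)
        - A * B * q ^ (k + 1) * kappaSum A B q (k + 1)
      = ∑' n : ℕ, kappa A B q (n + 1) * (B * q ^ (n + 1) - B) * (B * q ^ (n + 1) - A) *
        (B * q ^ (n + 1)) ^ k := by
    simp only [kappaSum]
    rw [← tsum_mul_left, ← tsum_mul_left, ← ((hs _).mul_left _).tsum_sub ((hs _).mul_left _)]
    refine tsum_congr fun n => ?_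
    rw [kappa_succ_mul hq hq0 hA hAB, pow_succ, ← mul_assoc B, mul_zpow (B * q ^ n),
      zpow_add_one₀ (hl n), zpow_add_one₀ (hl n), zpow_add_one₀ hq0, zpow_add_one₀ hq0]
    ring
  have s2 : Summable fun n : ℕ =>
      kappa A B q n * (B * q ^ n - B) * (B * q ^ n - A) * (B * q ^ n) ^ k :=
    (((hs (k + 1 + 1)).sub ((hs (k + 1)).mul_left (A + B))).add ((hs k).mul_left (A * B))).congr
      pointwise
  rw [s2.tsum_eq_zero_add, ← rhs] at lhs
  simp only [pow_zero, mul_one, sub_self, mul_zero, zero_mul, zero_add] at lhs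
  linear_combination lhs

/-- The finite product `∏_{i=1}^n (1 - a q^{-i})`. -/
def downProd (a q : ℂ) (n : ℕ) : ℂ := ∏ i ∈ Finset.range n, (1 - a * (q ^ (i + 1))⁻¹)

lemma kappa_eq_downProd (hq : ‖q‖ < 1) (hq0 : q ≠ 0) (hA : A ≠ 0) (hB : B ≠ 0)
    (hAB : ∀ n : ℤ, A ≠ B * q ^ n) (n : ℕ) :
    kappa A B q n = downProd A q n / (downProd (A / B) q n * downProd 1 q n) := by
  induction n with
  | zero => simp [kappa_zero, downProd]
  | succ n ih =>
    have h1 := one_sub_pow_succ_ne_zero hq n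
    have h2 := one_sub_mul_div_ne_zero hA hAB n
    have hp : q ^ (n + 1) ≠ 0 := pow_ne_zero _ hq0
    rw [kappa_succ hq hq0 hA hAB, ih]
    simp only [downProd, Finset.prod_range_succ]
    have e1 : 1 - A * (q ^ (n + 1))⁻¹ = -A * (q ^ (n + 1))⁻¹ * (1 - q ^ (n + 1) / A) := by
      field_simp; ring
    have e2 : 1 - A / B * (q ^ (n + 1))⁻¹
        = -(A / B) * (q ^ (n + 1))⁻¹ * (1 - q ^ (n + 1) * B / A) := by
      field_simp; ring
    have e3 : 1 - 1 * (q ^ (n + 1))⁻¹ = -(q ^ (n + 1))⁻¹ * (1 - q ^ (n + 1)) := by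
      field_simp; ring
    rw [e1, e2, e3]
    field_simp

/-- The difference product over the nodes below `n`. -/
lemma prod_sub_range (hq0 : q ≠ 0) (hB : B ≠ 0) (C : ℂ) (n : ℕ) :
    ∏ k ∈ Finset.range n, (B * q ^ n - C * q ^ k) = (B * q ^ n) ^ n * downProd (C / B) q n := by
  rw [← Finset.prod_range_reflect, downProd, Finset.pow_eq_prod_const (B * q ^ n) n,
    ← Finset.prod_mul_distrib]
  refine Finset.prod_congr rfl fun i hi => ?_
  have hi := Finset.mem_range.1 hi
  obtain ⟨j, rfl⟩ : ∃ j, n = j + i + 1 := ⟨n - 1 - i, by omega⟩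
  rw [show j + i + 1 - 1 - i = j by omega, add_assoc, pow_add]
  field_simp

/-- The difference product over the nodes from `n` on. -/
lemma prod_sub_shift (hB : B ≠ 0) (C : ℂ) (n j : ℕ) :
    ∏ k ∈ Finset.range j, (B * q ^ n - C * q ^ (n + k)) = (B * q ^ n) ^ j * qPoch (C / B) q j := by
  rw [qPoch, Finset.pow_eq_prod_const (B * q ^ n) j, ← Finset.prod_mul_distrib]
  refine Finset.prod_congr rfl fun i _ => ?_
  rw [pow_add]
  field_simp

lemma prod_sub_all (hq0 : q ≠ 0) (hB : B ≠ 0) (C : ℂ) (n j : ℕ) :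
    ∏ k ∈ Finset.range (n + j), (B * q ^ n - C * q ^ k)
      = (B * q ^ n) ^ (n + j) * (downProd (C / B) q n * qPoch (C / B) q j) := by
  rw [Finset.prod_range_add, prod_sub_range hq0 hB, prod_sub_shift hB]
  ring

lemma prod_sub_erase (hq0 : q ≠ 0) (hB : B ≠ 0) (n j : ℕ) :
    ∏ k ∈ (Finset.range (n + (j + 1))).erase n, (B * q ^ n - B * q ^ k)
      = (B * q ^ n) ^ (n + j) * (downProd 1 q n * qPoch q q j) := by
  have h1 : ∏ k ∈ (Finset.range (n + (j + 1))).erase n, (B * q ^ n - B * q ^ k)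
      = ∏ k ∈ Finset.range (n + (j + 1)), if k = n then 1 else (B * q ^ n - B * q ^ k) := by
    rw [← Finset.prod_erase (Finset.range (n + (j + 1))) (a := n) (by simp)]
    refine Finset.prod_congr rfl fun k hk => ?_
    rw [if_neg (Finset.ne_of_mem_erase hk)]
  rw [h1, Finset.prod_range_add, Finset.prod_range_succ']
  have h2 : ∏ k ∈ Finset.range n, (if k = n then 1 else (B * q ^ n - B * q ^ k))
      = ∏ k ∈ Finset.range n, (B * q ^ n - B * q ^ k) :=
    Finset.prod_congr rfl fun k hk => if_neg (Finset.mem_range.1 hk).ne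
  have h3 : ∏ k ∈ Finset.range j,
        (if n + (k + 1) = n then 1 else (B * q ^ n - B * q ^ (n + (k + 1))))
      = ∏ k ∈ Finset.range j, (B * q ^ n - B * q * q ^ (n + k)) :=
    Finset.prod_congr rfl fun k _ => by rw [if_neg (by omega)]; ring
  rw [h2, h3, prod_sub_range hq0 hB, prod_sub_shift hB, div_self hB, mul_div_cancel_left₀ _ hB]
  simp
  ring

/-- The weight of the node `B q^n` in Lagrange interpolation at the nodes `B q^k`, `A q^k`,
`k < N`, evaluated on the polynomial `∏_{k<N} (X - A B q^k)` and suitably normalised. -/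
def nodeWeight (A B q : ℂ) (N n : ℕ) : ℂ :=
  kappa A B q n * (qPoch A q (N - n) / (qPoch (A / B) q (N - n) * qPoch q q (N - n - 1)))

lemma nodeWeight_eq (hq : ‖q‖ < 1) (hq0 : q ≠ 0) (hA : A ≠ 0) (hB : B ≠ 0)
    (hAB : ∀ n : ℤ, A ≠ B * q ^ n) {M n : ℕ} (hn : n < M + 1) (e : ℕ) :
    (B * q ^ n) ^ e * (∏ k ∈ Finset.range (M + 1), (B * q ^ n - A * B * q ^ k)) /
      ((∏ k ∈ (Finset.range (M + 1)).erase n, (B * q ^ n - B * q ^ k)) *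
        ∏ k ∈ Finset.range (M + 1), (B * q ^ n - A * q ^ k))
      = nodeWeight A B q (M + 1) n * (B * q ^ n) ^ ((e : ℤ) - M) := by
  obtain ⟨j, rfl⟩ : ∃ j, M = n + j := ⟨M - n, by omega⟩
  have hl : B * q ^ n ≠ 0 := mul_ne_zero hB (pow_ne_zero _ hq0)
  rw [add_assoc, prod_sub_all hq0 hB, prod_sub_all hq0 hB, prod_sub_erase hq0 hB,
    mul_div_cancel_right₀ _ hB, nodeWeight, kappa_eq_downProd hq hq0 hA hB hAB,
    show n + (j + 1) - n = j + 1 by omega, Nat.add_sub_cancel, zpow_sub₀ hl, zpow_natCast,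
    zpow_natCast]
  field_simp

open Polynomial in
/-- A finite form of the partial fraction expansion of `(ABt;q)_∞ / ((At;q)_∞ (Bt;q)_∞)`. -/
lemma sum_nodeWeight (hq : ‖q‖ < 1) (hq0 : q ≠ 0) (hA : A ≠ 0) (hB : B ≠ 0)
    (hAB : ∀ n : ℤ, A ≠ B * q ^ n) (hBA : ∀ n : ℤ, B ≠ A * q ^ n) {M e : ℕ} (he : e ≤ M) :
    ∑ n ∈ Finset.range (M + 1), nodeWeight A B q (M + 1) n * (B * q ^ n) ^ ((e : ℤ) - M) +
      ∑ n ∈ Finset.range (M + 1), nodeWeight B A q (M + 1) n * (A * q ^ n) ^ ((e : ℤ) - M)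
      = if e = M then 1 else 0 := by
  classical
  have hpow : ∀ i j : ℕ, q ^ i = q ^ j → i = j := by
    intro i j h
    have h' : ‖q‖ ^ i = ‖q‖ ^ j := by rw [← norm_pow, ← norm_pow, h]
    exact pow_right_injective₀ (norm_pos_iff.2 hq0) hq.ne h'
  have hne : ∀ i j : ℕ, A * q ^ i ≠ B * q ^ j := by
    intro i j h
    refine hAB (j - i) ?_
    rw [zpow_sub₀ hq0, zpow_natCast, zpow_natCast, mul_div_assoc', ← h]
    field_simp
  set s : Finset (ℕ ⊕ ℕ) := (Finset.range (M + 1)).disjSum (Finset.range (M + 1)) with hs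
  set v : ℕ ⊕ ℕ → ℂ := Sum.elim (fun n => B * q ^ n) (fun n => A * q ^ n) with hv
  have hinj : Set.InjOn v s := by
    rintro (i | i) - (j | j) - h
    · exact congrArg _ (hpow i j (mul_left_cancel₀ hB h))
    · exact absurd h.symm (hne j i)
    · exact absurd h (hne i j)
    · exact congrArg _ (hpow i j (mul_left_cancel₀ hA h))
  have hcard : s.card = 2 * (M + 1) := by simp [hs, two_mul]
  set R : ℂ[X] := ∏ k ∈ Finset.range (M + 1), (X - C (A * B * q ^ k)) with hR
  have hRm : R.Monic := monic_prod_of_monic _ _ fun k _ => monic_X_sub_C _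
  have hRd : R.natDegree = M + 1 := by
    rw [hR, natDegree_prod_of_monic _ _ fun k _ => monic_X_sub_C _]
    simp only [natDegree_X_sub_C]
    simp
  have hPm : (X ^ e * R).Monic := (monic_X_pow e).mul hRm
  have hPd : (X ^ e * R).natDegree = e + (M + 1) := by
    rw [(monic_X_pow e).natDegree_mul hRm, natDegree_X_pow, hRd]
  -- the sum is the coefficient of `X ^ (2 M + 1)` in `X ^ e * R`, which has degree `e + M + 1`
  have key := Lagrange.coeff_eq_sum hinj (P := X ^ e * R) (by
    rw [degree_eq_natDegree hPm.ne_zero, hPd, hcard]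
    exact_mod_cast (by omega))
  have hcoeff : (X ^ e * R).coeff (s.card - 1) = if e = M then 1 else 0 := by
    split_ifs with h
    · rw [hcard, show 2 * (M + 1) - 1 = (X ^ e * R).natDegree by rw [hPd]; omega]
      exact hPm.coeff_natDegree
    · exact coeff_eq_zero_of_natDegree_lt (by rw [hPd, hcard]; omega)
  rw [hcoeff, hs, Finset.sum_disjSum] at key
  rw [key]
  have el : ∀ n, ((Finset.range (M + 1)).disjSum (Finset.range (M + 1))).erase (Sum.inl n)
      = ((Finset.range (M + 1)).erase n).disjSum (Finset.range (M + 1)) := by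
    intro n; ext (i | i) <;> simp
  have er : ∀ n, ((Finset.range (M + 1)).disjSum (Finset.range (M + 1))).erase (Sum.inr n)
      = (Finset.range (M + 1)).disjSum ((Finset.range (M + 1)).erase n) := by
    intro n; ext (i | i) <;> simp
  congr 1
  · refine Finset.sum_congr rfl fun n hn => ?_
    rw [← nodeWeight_eq hq hq0 hA hB hAB (Finset.mem_range.1 hn), el, Finset.prod_disjSum]
    simp [hv, hR, eval_prod]
  · refine Finset.sum_congr rfl fun n hn => ?_
    have hw := nodeWeight_eq hq hq0 hB hA hBA (Finset.mem_range.1 hn) e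
    rw [mul_comm B A, mul_comm (∏ k ∈ (Finset.range (M + 1)).erase n, _)] at hw
    rw [← hw, er, Finset.prod_disjSum]
    simp [hv, hR, eval_prod]

lemma div_mul_pow_ne_one (hB : B ≠ 0) (hBA : ∀ n : ℤ, B ≠ A * q ^ n) (k : ℕ) :
    A / B * q ^ k ≠ 1 := by
  intro h
  refine hBA k ?_
  rw [zpow_natCast]
  field_simp at h
  exact h.symm

/-- The constant in front of the first term of the connection formula. -/
def connConst (A B q : ℂ) : ℂ := qPochInf A q / (qPochInf (A / B) q * qPochInf q q)

lemma tendsto_sum_nodeWeight (hq : ‖q‖ < 1) (hq0 : q ≠ 0) (hA : A ≠ 0) (hB : B ≠ 0)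
    (hAB : ∀ n : ℤ, A ≠ B * q ^ n) (hBA : ∀ n : ℤ, B ≠ A * q ^ n) (m : ℤ) :
    Tendsto (fun M : ℕ => ∑ n ∈ Finset.range (M + 1), nodeWeight A B q (M + 1) n * (B * q ^ n) ^ m)
      atTop (𝓝 (connConst A B q * kappaSum A B q m)) := by
  have hne := div_mul_pow_ne_one hB hBA
  obtain ⟨K₁, hK₁, H₁⟩ := exists_norm_qPoch_le hq A
  obtain ⟨K₂, hK₂, H₂⟩ := exists_norm_inv_qPoch_le hq hne
  obtain ⟨K₃, hK₃, H₃⟩ := exists_norm_inv_qPoch_le hq (mul_pow_ne_one hq hq)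
  have hlim : connConst A B q * kappaSum A B q m
      = ∑' n : ℕ, kappa A B q n * (B * q ^ n) ^ m * connConst A B q := by
    rw [kappaSum, mul_comm, tsum_mul_right]
  have hsum : ∀ M : ℕ, ∑ n ∈ Finset.range (M + 1), nodeWeight A B q (M + 1) n * (B * q ^ n) ^ m
      = ∑' n : ℕ, if n < M + 1 then nodeWeight A B q (M + 1) n * (B * q ^ n) ^ m else 0 := by
    intro M
    rw [tsum_eq_sum (s := Finset.range (M + 1)) fun n hn => if_neg (by simpa using hn)]
    exact Finset.sum_congr rfl fun n hn => (if_pos (Finset.mem_range.1 hn)).symm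
  simp only [hsum, hlim]
  refine tendsto_tsum_of_dominated_convergence
    ((summable_kappa hq hq0 hA hAB m).mul_right (K₁ * (K₂ * K₃))) (fun n => ?_)
    (Eventually.of_forall fun M n => ?_)
  · have t1 : Tendsto (fun M : ℕ => M + 1 - n) atTop atTop :=
      (tendsto_sub_atTop_nat n).comp (tendsto_add_atTop_nat 1)
    have t2 : Tendsto (fun M : ℕ => M + 1 - n - 1) atTop atTop :=
      (tendsto_sub_atTop_nat 1).comp t1
    have h1 := (tendsto_qPoch hq A).comp t1
    have h2 := (tendsto_qPoch hq (A / B)).comp t1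
    have h3 := (tendsto_qPoch hq q).comp t2
    have h := (h1.div (h2.mul h3) (mul_ne_zero (qPochInf_ne_zero hq hne)
      (qPochInf_ne_zero hq (mul_pow_ne_one hq hq)))).const_mul
        (kappa A B q n * (B * q ^ n) ^ m)
    refine h.congr' ?_
    filter_upwards [eventually_ge_atTop n] with M hM
    rw [if_pos (by omega), nodeWeight]
    simp only [Function.comp, Pi.div_apply]
    ring
  · split_ifs with h
    · rw [nodeWeight, mul_right_comm, norm_mul (_ * _), div_eq_mul_inv, mul_inv, norm_mul, norm_mul,
        norm_mul]
      gcongr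
      exacts [H₁ _, H₂ _, H₃ _]
    · rw [norm_zero]; positivity

/-- The Laurent coefficients of the connection formula, without the factor
`(-1)^m q^{m(m-1)/2}`. -/
def connCoeff (A B q : ℂ) (m : ℤ) : ℂ :=
  connConst A B q * kappaSum A B q m + connConst B A q * kappaSum B A q m

/-- The limit of `sum_nodeWeight` for `M → ∞`, with `e = M - j`. -/
lemma connCoeff_nonpos (hq : ‖q‖ < 1) (hq0 : q ≠ 0) (hA : A ≠ 0) (hB : B ≠ 0)
    (hAB : ∀ n : ℤ, A ≠ B * q ^ n) (hBA : ∀ n : ℤ, B ≠ A * q ^ n) (j : ℕ) :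
    connCoeff A B q (-j) = if j = 0 then 1 else 0 := by
  have h := (tendsto_sum_nodeWeight hq hq0 hA hB hAB hBA (-j)).add
    (tendsto_sum_nodeWeight hq hq0 hB hA hBA hAB (-j))
  refine tendsto_nhds_unique h (tendsto_const_nhds.congr' ?_)
  filter_upwards [eventually_ge_atTop j] with M hM
  have := sum_nodeWeight hq hq0 hA hB hAB hBA (M := M) (e := M - j) (Nat.sub_le _ _)
  rw [Nat.cast_sub hM, show (M : ℤ) - j - M = -j by ring] at this
  rw [this]
  congr 1
  exact propext (by omega)

lemma connCoeff_rec (hq : ‖q‖ < 1) (hq0 : q ≠ 0) (hA : A ≠ 0) (hB : B ≠ 0)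
    (hAB : ∀ n : ℤ, A ≠ B * q ^ n) (hBA : ∀ n : ℤ, B ≠ A * q ^ n) (m : ℤ) :
    (1 - q ^ m) * connCoeff A B q m = (A + B - A * B * q ^ (m - 1)) * connCoeff A B q (m - 1)
      - A * B * connCoeff A B q (m - 2) := by
  have h1 := kappaSum_rec hq hq0 hA hB hAB m
  have h2 := kappaSum_rec hq hq0 hB hA hBA m
  simp only [connCoeff]
  linear_combination connConst A B q * h1 + connConst B A q * h2

end Laurent

/-! ### The connection formula -/

section Connection

variable {q A B : ℂ}

/-- The power series of the numerator `(y;q)_∞ ₂φ₁(A, B; 0; q, y)`. -/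
def numerSeries (A B q : ℂ) : PowerSeries ℂ :=
  PowerSeries.mk (eulerCoeff q) * phiFormal A B 0 q

/-- The coefficient of `y^m` in the numerator `(y;q)_∞ ₂φ₁(A, B; 0; q, y)`. -/
def numerCoeff (A B q : ℂ) (m : ℕ) : ℂ := PowerSeries.coeff m (numerSeries A B q)

lemma phiCoeff_succ (hq : ‖q‖ < 1) (A B : ℂ) (n : ℕ) :
    phiCoeff A B 0 q (n + 1) * (1 - q ^ (n + 1))
      = (1 - A * q ^ n) * (1 - B * q ^ n) * phiCoeff A B 0 q n := by
  have h1 := one_sub_pow_succ_ne_zero hq n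
  have h2 := qPoch_self_ne_zero hq n
  simp only [phiCoeff, qPoch_succ, qPoch_zero_left, ← pow_succ' q n]
  field_simp
  simp

open PowerSeries in
lemma mk_eulerCoeff_eq (hq : ‖q‖ < 1) (hq0 : q ≠ 0) :
    PowerSeries.mk (eulerCoeff q) = (1 - X) * rescale q (PowerSeries.mk (eulerCoeff q)) := by
  ext n
  rw [sub_mul, one_mul]
  cases n with
  | zero =>
    rw [map_sub, coeff_zero_X_mul, coeff_rescale, coeff_mk]
    simp
  | succ n =>
    have := one_sub_pow_succ_ne_zero hq n
    rw [map_sub, coeff_succ_X_mul]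
    simp only [coeff_rescale, coeff_mk]
    rw [eulerCoeff_succ hq hq0]
    field_simp
    ring

open PowerSeries in
lemma phiFormal_eq (hq : ‖q‖ < 1) (A B : ℂ) :
    phiFormal A B 0 q - rescale q (phiFormal A B 0 q)
      = X * (phiFormal A B 0 q - C (A + B) * rescale q (phiFormal A B 0 q)
        + C (A * B) * rescale q (rescale q (phiFormal A B 0 q))) := by
  ext n
  cases n with
  | zero =>
    rw [map_sub, coeff_zero_X_mul, coeff_rescale]
    simp
  | succ n =>
    have := phiCoeff_succ hq A B n
    rw [coeff_succ_X_mul]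
    simp only [map_sub, map_add (coeff n), coeff_rescale, coeff_C_mul, phiFormal, coeff_mk]
    linear_combination this

open PowerSeries in
/-- The `q`-difference equation of the numerator. -/
lemma numerSeries_eq (hq : ‖q‖ < 1) (hq0 : q ≠ 0) (A B : ℂ) :
    numerSeries A B q = rescale q (numerSeries A B q)
      - X * (C (A + B) * rescale q (numerSeries A B q))
      + X * (C (A * B) * rescale q (rescale q (numerSeries A B q)))
      - X * (X * (C (A * B * q) * rescale q (rescale q (numerSeries A B q)))) := by
  have hE := mk_eulerCoeff_eq hq hq0
  have hΦ := phiFormal_eq hq A B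
  have hE2 := congrArg (rescale q) hE
  rw [map_mul, map_sub, map_one, rescale_X] at hE2
  simp only [numerSeries, map_mul (rescale q)]
  set E := PowerSeries.mk (eulerCoeff q)
  set Φ := phiFormal A B 0 q
  have hC : C (A * B * q) = C (A * B) * C q := map_mul _ _ _
  rw [hC]
  have e1 : E * Φ - (rescale q E * rescale q Φ
      - X * (C (A + B) * (rescale q E * rescale q Φ))
      + X * (C (A * B) * (rescale q (rescale q E) * rescale q (rescale q Φ)))
      - X * (X * (C (A * B) * C q * (rescale q (rescale q E) * rescale q (rescale q Φ)))))
      = 0 := by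
    linear_combination Φ * hE + (rescale q (rescale q Φ)) * X * C (A * B) * hE2
      + rescale q E * hΦ
  exact sub_eq_zero.1 e1

lemma numerCoeff_zero (A B q : ℂ) : numerCoeff A B q 0 = 1 := by
  simp [numerCoeff, numerSeries, phiFormal, phiCoeff, eulerCoeff, qPoch]

open PowerSeries in
lemma numerCoeff_one (hq : ‖q‖ < 1) (hq0 : q ≠ 0) (A B : ℂ) :
    (1 - q) * numerCoeff A B q 1 = -(A + B - A * B) := by
  have h := congrArg (coeff 1) (numerSeries_eq hq hq0 A B)
  have h0 := numerCoeff_zero A B q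
  simp only [map_sub (coeff 1), map_add (coeff 1)] at h
  rw [← zero_add 1, coeff_succ_X_mul, coeff_succ_X_mul, coeff_succ_X_mul, coeff_zero_X_mul] at h
  simp only [coeff_C_mul, coeff_rescale, zero_add] at h
  change numerCoeff A B q 1 = q ^ 1 * numerCoeff A B q 1
    - (A + B) * (q ^ 0 * numerCoeff A B q 0)
    + A * B * (q ^ 0 * (q ^ 0 * numerCoeff A B q 0)) - 0 at h
  rw [h0] at h
  linear_combination h

open PowerSeries in
lemma numerCoeff_rec (hq : ‖q‖ < 1) (hq0 : q ≠ 0) (A B : ℂ) (m : ℕ) :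
    (1 - q ^ (m + 2)) * numerCoeff A B q (m + 2)
      = -(q ^ (m + 1) * (A + B - A * B * q ^ (m + 1)) * numerCoeff A B q (m + 1))
        - A * B * q ^ (2 * m + 1) * numerCoeff A B q m := by
  have h := congrArg (coeff (m + 1 + 1)) (numerSeries_eq hq hq0 A B)
  simp only [map_sub (coeff (m + 1 + 1)), map_add (coeff (m + 1 + 1)), coeff_succ_X_mul,
    coeff_C_mul, coeff_rescale] at h
  change numerCoeff A B q (m + 2) = q ^ (m + 2) * numerCoeff A B q (m + 2)
    - (A + B) * (q ^ (m + 1) * numerCoeff A B q (m + 1))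
    + A * B * (q ^ (m + 1) * (q ^ (m + 1) * numerCoeff A B q (m + 1)))
    - A * B * q * (q ^ m * (q ^ m * numerCoeff A B q m)) at h
  linear_combination h

/-- The Laurent coefficients of the right-hand side of the connection formula are the Taylor
coefficients of the numerator: both satisfy the same recurrence with the same initial values. -/
lemma numerCoeff_eq (hq : ‖q‖ < 1) (hq0 : q ≠ 0) (hA : A ≠ 0) (hB : B ≠ 0)
    (hAB : ∀ n : ℤ, A ≠ B * q ^ n) (hBA : ∀ n : ℤ, B ≠ A * q ^ n) (m : ℕ) :
    numerCoeff A B q m = (-1) ^ m * q ^ ((m : ℤ) * (m - 1) / 2) * connCoeff A B q m := by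
  have c0 : connCoeff A B q 0 = 1 := by simpa using connCoeff_nonpos hq hq0 hA hB hAB hBA 0
  have c1 : connCoeff A B q (-1) = 0 := by simpa using connCoeff_nonpos hq hq0 hA hB hAB hBA 1
  induction m using Nat.twoStepInduction with
  | zero => simp [numerCoeff_zero, c0]
  | one =>
    have h1 := one_sub_pow_succ_ne_zero hq 0
    rw [zero_add, pow_one] at h1
    have e1 := numerCoeff_one hq hq0 A B
    have e2 := connCoeff_rec hq hq0 hA hB hAB hBA 1
    simp only [sub_self, zpow_one, zpow_zero, c0, show (1 : ℤ) - 2 = -1 by norm_num, c1] at e2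
    apply mul_left_cancel₀ h1
    simp only [Nat.cast_one, sub_self, mul_zero, EuclideanDomain.zero_div, zpow_zero]
    linear_combination e1 + e2
  | more m ih1 ih2 =>
    have h1 := one_sub_pow_succ_ne_zero hq (m + 1)
    have e1 := numerCoeff_rec hq hq0 A B m
    have e2 := connCoeff_rec hq hq0 hA hB hAB hBA (m + 2 : ℕ)
    have p1 : ((m + 2 : ℕ) : ℤ) - 1 = (m + 1 : ℕ) := by push_cast; ring
    have p2 : ((m + 2 : ℕ) : ℤ) - 2 = m := by push_cast; ring
    rw [p1, p2, zpow_natCast, zpow_natCast] at e2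
    rw [ih1, ih2] at e1
    have t1 : q ^ (((m + 1 : ℕ) : ℤ) * ((m + 1 : ℕ) - 1) / 2)
        = q ^ ((m : ℤ) * (m - 1) / 2) * q ^ m := by
      rw [Nat.cast_succ, tri_succ, zpow_add₀ hq0, zpow_natCast]
    have t2 : q ^ (((m + 2 : ℕ) : ℤ) * ((m + 2 : ℕ) - 1) / 2)
        = q ^ ((m : ℤ) * (m - 1) / 2) * q ^ m * q ^ (m + 1) := by
      rw [← t1, show ((m + 2 : ℕ) : ℤ) = (m + 1 : ℕ) + 1 by push_cast; ring, tri_succ,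
        zpow_add₀ hq0, zpow_natCast]
    rw [t1] at e1
    rw [t2]
    apply mul_left_cancel₀ h1
    rw [e1]
    linear_combination (-1) * (-1) ^ m * q ^ ((m : ℤ) * (m - 1) / 2) * q ^ m * q ^ (m + 1) * e2

lemma hasSum_connTerm (hq : ‖q‖ < 1) (hq0 : q ≠ 0) (hA : A ≠ 0) (hB : B ≠ 0)
    (hAB : ∀ n : ℤ, A ≠ B * q ^ n) {y : ℂ} (hy : y ≠ 0) (hqy : ‖q / y‖ < 1) :
    HasSum (fun m : ℤ => (-1) ^ m * q ^ (m * (m - 1) / 2) *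
        (connConst A B q * kappaSum A B q m) * y ^ m)
      (connConst A B q * (theta q (-(B * y)) * phi (q / A) 0 (q * B / A) q (q / y))) := by
  have hg := summable_phi hq (q / A) 0 (mul_div_mul_pow_ne_one hA hAB) hqy
  have h := (hasSum_theta_mul hq hq0 (neg_ne_zero.2 (mul_ne_zero hB hy)) hg).mul_left
    (connConst A B q)
  refine h.congr_fun fun m => ?_
  have inner : ∑' n : ℕ, phiCoeff (q / A) 0 (q * B / A) q n * (q / y) ^ n *
      (q ^ (m * n + (n : ℤ) * (n - 1) / 2) * (-(B * y)) ^ n) * B ^ m = kappaSum A B q m := by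
    refine tsum_congr fun n => ?_
    rw [kappa, mul_zpow, zpow_add₀ hq0, zpow_add₀ hq0, zpow_natCast, mul_comm m, zpow_mul,
      zpow_natCast, div_pow, neg_pow, mul_pow, neg_pow B]
    field_simp
  rw [← inner, tsum_mul_right, show (-(B * y)) ^ m = (-1) ^ m * B ^ m * y ^ m by
    rw [← mul_zpow, ← mul_zpow, neg_one_mul, neg_mul]]
  ring

/-- The Laurent expansion of the right-hand side of the connection formula; it is a power
series. -/
lemma hasSum_numerCoeff (hq : ‖q‖ < 1) (hq0 : q ≠ 0) (hA : A ≠ 0) (hB : B ≠ 0)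
    (hAB : ∀ n : ℤ, A ≠ B * q ^ n) (hBA : ∀ n : ℤ, B ≠ A * q ^ n)
    {y : ℂ} (hy : y ≠ 0) (hqy : ‖q / y‖ < 1) :
    HasSum (fun m : ℕ => numerCoeff A B q m * y ^ m)
      (connConst A B q * (theta q (-(B * y)) * phi (q / A) 0 (q * B / A) q (q / y)) +
        connConst B A q * (theta q (-(A * y)) * phi (q / B) 0 (q * A / B) q (q / y))) := by
  have h := (hasSum_connTerm hq hq0 hA hB hAB hy hqy).add
    (hasSum_connTerm hq hq0 hB hA hBA hy hqy)
  have h' := hasSum_nat_of_hasSum_int (f := fun m : ℤ => (-1) ^ m * q ^ (m * (m - 1) / 2) *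
      connCoeff A B q m * y ^ m) (h.congr_fun fun m => by rw [connCoeff]; ring) fun n => by
    have := connCoeff_nonpos hq hq0 hA hB hAB hBA (n + 1)
    rw [if_neg (Nat.succ_ne_zero n), Nat.cast_succ] at this
    rw [this]
    simp
  refine h'.congr_fun fun m => ?_
  rw [numerCoeff_eq hq hq0 hA hB hAB hBA, zpow_natCast, zpow_natCast]

lemma isEntireSeries_numerCoeff (hq : ‖q‖ < 1) (hq0 : q ≠ 0) (hA : A ≠ 0) (hB : B ≠ 0)
    (hAB : ∀ n : ℤ, A ≠ B * q ^ n) (hBA : ∀ n : ℤ, B ≠ A * q ^ n) :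
    IsEntireSeries (numerCoeff A B q) := by
  intro u
  -- the expansion converges for `|y| > |q|`, hence everywhere
  have hv : ‖((‖u‖ + 1 : ℝ) : ℂ)‖ = ‖u‖ + 1 := by
    rw [Complex.norm_real, Real.norm_of_nonneg (by positivity)]
  have hqv : ‖q / ((‖u‖ + 1 : ℝ) : ℂ)‖ < 1 := by
    rw [norm_div, hv, div_lt_one (by positivity)]
    linarith [norm_nonneg u]
  have hv0 : ((‖u‖ + 1 : ℝ) : ℂ) ≠ 0 := by
    rw [← norm_pos_iff, hv]; positivity
  have h := (hasSum_numerCoeff hq hq0 hA hB hAB hBA hv0 hqv).summable.norm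
  refine Summable.of_nonneg_of_le (fun n => norm_nonneg _) (fun n => ?_) h
  rw [norm_mul, norm_mul, norm_pow, norm_pow, hv]
  gcongr
  linarith

lemma tsum_numerCoeff (hq : ‖q‖ < 1) (hq0 : q ≠ 0) (A B : ℂ) {y : ℂ} (hy : ‖y‖ < 1) :
    ∑' m, numerCoeff A B q m * y ^ m = qPochInf y q * phi A B 0 q y := by
  rw [← tsum_euler hq hq0, phi, tsum_mul_tsum_eq_tsum_sum_antidiagonal_of_summable_norm
    (isEntireSeries_eulerCoeff hq hq0 y) (summable_phi hq A B zero_mul_pow_ne_one hy)]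
  refine tsum_congr fun m => ?_
  rw [numerCoeff, numerSeries, PowerSeries.coeff_mul, Finset.sum_mul]
  refine Finset.sum_congr rfl fun p hp => ?_
  rw [← Finset.HasAntidiagonal.mem_antidiagonal.1 hp, pow_add, PowerSeries.coeff_mk, phiFormal,
    PowerSeries.coeff_mk]
  ring

/-- An entire function which agrees with the numerator `(y;q)_∞ ₂φ₁(A, B; 0; q, y)` near `0`
is given by the right-hand side of the connection formula. -/
theorem entire_eq_connection (hq : ‖q‖ < 1) (hq0 : q ≠ 0) (hA : A ≠ 0) (hB : B ≠ 0)
    (hAB : ∀ n : ℤ, A ≠ B * q ^ n) (hBA : ∀ n : ℤ, B ≠ A * q ^ n)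
    {f : ℂ → ℂ} (hf : Differentiable ℂ f)
    (hf1 : ∀ y : ℂ, ‖y‖ < 1 → f y = qPochInf y q * phi A B 0 q y)
    {y : ℂ} (hy : y ≠ 0) (hqy : ‖q / y‖ < 1) :
    f y = connConst A B q * (theta q (-(B * y)) * phi (q / A) 0 (q * B / A) q (q / y)) +
        connConst B A q * (theta q (-(A * y)) * phi (q / B) 0 (q * A / B) q (q / y)) := by
  rw [← (hasSum_numerCoeff hq hq0 hA hB hAB hBA hy hqy).tsum_eq]
  have hg := (isEntireSeries_numerCoeff hq hq0 hA hB hAB hBA).differentiable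
  have := AnalyticOnNhd.eq_of_eventuallyEq (z₀ := 0) (fun z _ => hf.analyticAt z)
    (fun z _ => hg.analyticAt z) (by
      filter_upwards [Metric.ball_mem_nhds (0 : ℂ) one_pos] with z hz
      have hz : ‖z‖ < 1 := by simpa using hz
      rw [hf1 z hz, tsum_numerCoeff hq hq0 A B hz])
  exact congrFun this y

end Connection

/-! ### Heine's transformation with a remainder -/

section Heine

variable {q A B : ℂ}

/-- The remainder of order `N` of the `q`-binomial series. -/
def binomRem (A q : ℂ) (N : ℕ) (u : ℂ) : ℂ :=
  qPochInf (A * u) q / qPochInf u q - ∑ n ∈ Finset.range N, binomCoeff A q n * u ^ n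

lemma binomRem_eq_tsum (hq : ‖q‖ < 1) (A : ℂ) (N : ℕ) {u : ℂ} (hu : ‖u‖ < 1) :
    binomRem A q N u = ∑' n, binomCoeff A q (n + N) * u ^ (n + N) := by
  rw [binomRem, ← tsum_binom hq A hu, ← (summable_binom hq A hu).of_norm.sum_add_tsum_nat_add N]
  ring

lemma norm_binomRem_le (hq : ‖q‖ < 1) {A : ℂ} {K C : ℝ} (hC : 0 ≤ C)
    (h : ∀ n, ‖binomCoeff A q n‖ ≤ K * C ^ n) (N : ℕ) {u : ℂ} (hu : ‖u‖ < 1)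
    (hCu : C * ‖u‖ ≤ 1 / 2) : ‖binomRem A q N u‖ ≤ 2 * K * (C * ‖u‖) ^ N := by
  have hK : 0 ≤ K := by simpa using (norm_nonneg _).trans (h 0)
  have hp : 0 ≤ C * ‖u‖ := by positivity
  have hs : HasSum (fun n : ℕ => K * (C * ‖u‖) ^ N * (1 / 2) ^ n) (K * (C * ‖u‖) ^ N * 2) :=
    hasSum_geometric_two.mul_left _
  rw [binomRem_eq_tsum hq A N hu]
  refine (tsum_of_norm_bounded hs fun n => ?_).trans (le_of_eq (by ring))
  rw [norm_mul, norm_pow]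
  calc ‖binomCoeff A q (n + N)‖ * ‖u‖ ^ (n + N)
      ≤ K * C ^ (n + N) * ‖u‖ ^ (n + N) := by gcongr; exact h _
    _ = K * (C * ‖u‖) ^ N * (C * ‖u‖) ^ n := by rw [mul_pow, mul_pow]; ring
    _ ≤ K * (C * ‖u‖) ^ N * (1 / 2) ^ n := by gcongr

/-- The product of `(y;q)_∞` and the remainder at `y q^k`, written so as to be entire in `y`. -/
def heineTerm (A q : ℂ) (N k : ℕ) (y : ℂ) : ℂ :=
  qPoch y q k * qPochInf (A * (y * q ^ k)) q
    - qPochInf y q * ∑ n ∈ Finset.range N, binomCoeff A q n * (y * q ^ k) ^ n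

lemma heineTerm_eq (hq : ‖q‖ < 1) (A : ℂ) (N k : ℕ) {y : ℂ} (hy : qPochInf (y * q ^ k) q ≠ 0) :
    heineTerm A q N k y = qPochInf y q * binomRem A q N (y * q ^ k) := by
  rw [heineTerm, binomRem, mul_sub]
  congr 1
  rw [qPochInf_eq_mul hq y k]
  field_simp

lemma differentiable_heineTerm (hq : ‖q‖ < 1) (hq0 : q ≠ 0) (A : ℂ) (N k : ℕ) :
    Differentiable ℂ (heineTerm A q N k) := by
  have h1 := differentiable_qPochInf hq hq0
  have h2 : Differentiable ℂ fun y : ℂ => qPochInf (A * (y * q ^ k)) q :=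
    h1.comp (g := fun u => qPochInf u q) (f := fun y : ℂ => A * (y * q ^ k)) (by fun_prop)
  have h3 : Differentiable ℂ fun y : ℂ => qPoch y q k := by
    unfold qPoch
    fun_prop
  unfold heineTerm
  fun_prop

/-- On every disc the terms of Heine's series have a summable bound. -/
lemma exists_bound_heineTerm (hq : ‖q‖ < 1) (hq0 : q ≠ 0) (A : ℂ) {B : ℂ} {N : ℕ}
    (hBN : ‖B‖ * ‖q‖ ^ N < 1) (R : ℝ) : ∃ b : ℕ → ℝ, Summable b ∧
      ∀ k, ∀ y ∈ Metric.closedBall (0 : ℂ) R,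
        ‖B ^ k / qPoch q q k * heineTerm A q N k y‖ ≤ b k := by
  have hcomp : ∀ g : ℂ → ℂ, Differentiable ℂ g →
      ∃ M, ∀ y ∈ Metric.closedBall (0 : ℂ) R, ‖g y‖ ≤ M := fun g hg =>
    (isCompact_closedBall 0 R).exists_bound_of_continuousOn hg.continuous.continuousOn
  choose M hM using fun k => hcomp (fun y => B ^ k / qPoch q q k * heineTerm A q N k y)
    ((differentiable_heineTerm hq hq0 A N k).const_mul _)
  obtain ⟨M', hM'⟩ := hcomp _ (differentiable_qPochInf hq hq0)
  obtain ⟨K, hK, HK⟩ := exists_norm_binomCoeff_le hq A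
  obtain ⟨L, hL, HL⟩ := exists_norm_inv_qPoch_le hq (mul_pow_ne_one hq hq)
  have hlim : Tendsto (fun k : ℕ => R * ‖q‖ ^ k) atTop (𝓝 0) := by
    simpa using (tendsto_pow_atTop_nhds_zero_of_lt_one (norm_nonneg q) hq).const_mul R
  have hev : ∀ᶠ k : ℕ in atTop, R * ‖q‖ ^ k ≤ 1 / 2 := hlim.eventually (ge_mem_nhds (by norm_num))
  obtain ⟨k₀, hk₀⟩ := eventually_atTop.1 hev
  refine ⟨fun k => if k < k₀ then M k else
    L * M' * (2 * K * R ^ N) * (‖B‖ * ‖q‖ ^ N) ^ k, ?_, fun k y hy => ?_⟩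
  · refine (summable_nat_add_iff k₀).1 ?_
    simp only [Nat.not_lt.2 (Nat.le_add_left k₀ _), if_false]
    exact (summable_nat_add_iff k₀).2
      ((summable_geometric_of_lt_one (by positivity) hBN).mul_left _)
  · dsimp only
    split_ifs with hk
    · exact hM k y hy
    · have hyR : ‖y‖ ≤ R := by simpa using hy
      have hR : 0 ≤ R := (norm_nonneg _).trans hyR
      have hM0 : 0 ≤ M' := (norm_nonneg _).trans (hM' y hy)
      have hle : ‖y * q ^ k‖ ≤ R * ‖q‖ ^ k := by
        rw [norm_mul, norm_pow]; gcongr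
      have h1 : ‖y * q ^ k‖ ≤ 1 / 2 := hle.trans (hk₀ k (not_lt.1 hk))
      have h2 : ‖y * q ^ k‖ < 1 := by linarith
      have h3 := norm_binomRem_le hq (A := A) (K := K) (C := 1) zero_le_one
        (fun n => by simpa using HK n) N h2 (by simpa using h1)
      rw [one_mul] at h3
      rw [heineTerm_eq hq A N k (qPochInf_ne_zero hq (mul_pow_ne_one hq h2)), norm_mul, norm_mul,
        div_eq_mul_inv, norm_mul, norm_pow]
      calc ‖B‖ ^ k * ‖(qPoch q q k)⁻¹‖ * (‖qPochInf y q‖ * ‖binomRem A q N (y * q ^ k)‖)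
          ≤ ‖B‖ ^ k * L * (M' * (2 * K * (R * ‖q‖ ^ k) ^ N)) := by
            gcongr
            · exact HL k
            · exact hM' y hy
            · exact h3.trans (by gcongr)
        _ = _ := by rw [mul_pow, mul_pow, ← pow_mul, ← pow_mul, mul_comm k N]; ring

lemma tsum_heine_of_norm_lt_one (hq : ‖q‖ < 1) (hq0 : q ≠ 0) (A : ℂ) {B : ℂ} {N : ℕ}
    (hBN : ‖B‖ * ‖q‖ ^ N < 1) {y : ℂ} (hy : ‖y‖ < 1) :
    qPochInf B q * ∑' k, B ^ k / qPoch q q k * binomRem A q N (y * q ^ k)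
      = ∑' n, phiCoeff A B 0 q (n + N) * y ^ (n + N) := by
  obtain ⟨K, hK, HK⟩ := exists_norm_binomCoeff_le hq A
  obtain ⟨L, hL, HL⟩ := exists_norm_inv_qPoch_le hq (mul_pow_ne_one hq hq)
  have hterm : ∀ k, B ^ k / qPoch q q k * binomRem A q N (y * q ^ k)
      = ∑' n, B ^ k / qPoch q q k * (binomCoeff A q (n + N) * (y * q ^ k) ^ (n + N)) := by
    intro k
    rw [binomRem_eq_tsum hq A N (norm_mul_pow_lt hq hy k), tsum_mul_left]
  have hsum : Summable (Function.uncurry fun k n : ℕ =>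
      B ^ k / qPoch q q k * (binomCoeff A q (n + N) * (y * q ^ k) ^ (n + N))) := by
    have hb := (summable_geometric_of_lt_one (by positivity) hBN).mul_of_nonneg
      (summable_geometric_of_lt_one (norm_nonneg y) hy) (fun n => by positivity)
      (fun n => by positivity)
    refine Summable.of_norm_bounded (hb.mul_left (L * K)) fun p => ?_
    obtain ⟨k, n⟩ := p
    simp only [Function.uncurry]
    rw [norm_mul, div_eq_mul_inv, norm_mul, norm_mul, norm_pow, norm_pow, norm_mul, norm_pow]
    have hqk : ‖q‖ ^ k ≤ 1 := pow_le_one₀ (norm_nonneg _) hq.le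
    calc ‖B‖ ^ k * ‖(qPoch q q k)⁻¹‖ * (‖binomCoeff A q (n + N)‖ * (‖y‖ * ‖q‖ ^ k) ^ (n + N))
        ≤ ‖B‖ ^ k * L * (K * (‖y‖ ^ n * (‖q‖ ^ k) ^ N)) := by
          gcongr
          · exact HL k
          · exact HK _
          · rw [mul_pow, pow_add ‖y‖, pow_add (‖q‖ ^ k)]
            have h1 : ‖y‖ ^ N ≤ 1 := pow_le_one₀ (norm_nonneg _) hy.le
            have h2 : (‖q‖ ^ k) ^ n ≤ 1 := pow_le_one₀ (by positivity) hqk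
            calc ‖y‖ ^ n * ‖y‖ ^ N * ((‖q‖ ^ k) ^ n * (‖q‖ ^ k) ^ N)
                ≤ ‖y‖ ^ n * 1 * (1 * (‖q‖ ^ k) ^ N) := by gcongr
              _ = _ := by ring
      _ = _ := by rw [mul_pow, ← pow_mul, ← pow_mul, mul_comm k N]; ring
  simp only [hterm]
  rw [← hsum.tsum_comm, ← tsum_mul_left]
  refine tsum_congr fun n => ?_
  have hlt : ‖B * q ^ (n + N)‖ < 1 := by
    rw [norm_mul, norm_pow, add_comm, pow_add, ← mul_assoc]
    exact (mul_le_of_le_one_right (by positivity) (pow_le_one₀ (norm_nonneg _) hq.le)).trans_lt hBN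
  have hinner : ∀ k, B ^ k / qPoch q q k * (binomCoeff A q (n + N) * (y * q ^ k) ^ (n + N))
      = binomCoeff A q (n + N) * y ^ (n + N) * ((B * q ^ (n + N)) ^ k / qPoch q q k) := by
    intro k
    rw [mul_pow, mul_pow, ← pow_mul, ← pow_mul, mul_comm k]
    ring
  simp only [hinner]
  have hne := qPochInf_ne_zero hq (mul_pow_ne_one hq hlt)
  rw [tsum_mul_left, tsum_pow_div_qPoch hq hlt, qPochInf_eq_mul hq B (n + N), phiCoeff,
    binomCoeff, qPoch_zero_left]
  field_simp

/-- The entire continuation of the numerator `(y;q)_∞ ₂φ₁(A, B; 0; q, y)`, together with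
a `q`-integral representation of its remainder. For `N = 0` it is Heine's transformation; taking
`N` large removes the condition `|B| < 1`. -/
theorem exists_entire_heine (hq : ‖q‖ < 1) (hq0 : q ≠ 0) (A : ℂ) {B : ℂ} {N : ℕ}
    (hBN : ‖B‖ * ‖q‖ ^ N < 1) : ∃ f : ℂ → ℂ, Differentiable ℂ f ∧
      (∀ y : ℂ, ‖y‖ < 1 → f y = qPochInf y q * phi A B 0 q y) ∧
      ∀ y : ℂ, (∀ k : ℕ, y * q ^ k ≠ 1) → f y = qPochInf y q *
        (∑ n ∈ Finset.range N, phiCoeff A B 0 q n * y ^ n +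
          qPochInf B q * ∑' k, B ^ k / qPoch q q k * binomRem A q N (y * q ^ k)) := by
  have key : ∀ y : ℂ, (∀ k : ℕ, y * q ^ k ≠ 1) →
      qPochInf y q * ∑ n ∈ Finset.range N, phiCoeff A B 0 q n * y ^ n +
        qPochInf B q * ∑' k, B ^ k / qPoch q q k * heineTerm A q N k y = qPochInf y q *
        (∑ n ∈ Finset.range N, phiCoeff A B 0 q n * y ^ n +
          qPochInf B q * ∑' k, B ^ k / qPoch q q k * binomRem A q N (y * q ^ k)) := by
    intro y hy
    have : ∀ k, B ^ k / qPoch q q k * heineTerm A q N k y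
        = qPochInf y q * (B ^ k / qPoch q q k * binomRem A q N (y * q ^ k)) := by
      intro k
      rw [heineTerm_eq hq A N k (qPochInf_ne_zero hq fun j => by
        rw [mul_assoc, ← pow_add]; exact hy _)]
      ring
    simp only [this]
    rw [tsum_mul_left]
    ring
  refine ⟨fun y => qPochInf y q * ∑ n ∈ Finset.range N, phiCoeff A B 0 q n * y ^ n +
    qPochInf B q * ∑' k, B ^ k / qPoch q q k * heineTerm A q N k y, ?_, fun y hy => ?_, key⟩
  · have h1 := differentiable_qPochInf hq hq0
    have h2 : Differentiable ℂ fun y => ∑' k, B ^ k / qPoch q q k * heineTerm A q N k y := by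
      intro y
      obtain ⟨b, hb, hb'⟩ := exists_bound_heineTerm hq hq0 A hBN (‖y‖ + 1)
      have hd := Complex.differentiableOn_tsum_of_summable_norm hb
        (fun k => ((differentiable_heineTerm hq hq0 A N k).const_mul
          (B ^ k / qPoch q q k)).differentiableOn)
        (Metric.isOpen_ball (x := (0 : ℂ)) (ε := ‖y‖ + 1))
        fun k w hw => hb' k w (Metric.ball_subset_closedBall hw)
      exact hd.differentiableAt (Metric.isOpen_ball.mem_nhds (by simp))
    fun_prop
  · dsimp only
    rw [key y (mul_pow_ne_one hq hy), tsum_heine_of_norm_lt_one hq hq0 A hBN hy, phi,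
      (summable_phi hq A B zero_mul_pow_ne_one hy).of_norm.sum_add_tsum_nat_add N]

end Heine

/-! ### Powers of the base near `q = 1` -/

section Powers

lemma qPow_add {q : ℝ} (hq : 0 < q) (s t : ℂ) : qPow q (s + t) = qPow q s * qPow q t :=
  Complex.cpow_add _ _ (by exact_mod_cast hq.ne')

lemma qPow_ne_zero {q : ℝ} (hq : 0 < q) (s : ℂ) : qPow q s ≠ 0 := by
  simp [qPow, Complex.cpow_eq_zero_iff, hq.ne']

lemma qPow_zero (q : ℝ) : qPow q 0 = 1 := Complex.cpow_zero _

lemma qPow_one (q : ℝ) : qPow q 1 = q := Complex.cpow_one _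

lemma qPow_natCast (q : ℝ) (n : ℕ) : qPow q n = (q : ℂ) ^ n := Complex.cpow_natCast _ _

lemma qPow_intCast (q : ℝ) (n : ℤ) : qPow q n = (q : ℂ) ^ n := Complex.cpow_intCast _ _

lemma qPow_sub {q : ℝ} (hq : 0 < q) (s t : ℂ) : qPow q (s - t) = qPow q s / qPow q t :=
  Complex.cpow_sub _ _ (by exact_mod_cast hq.ne')

lemma div_qPow {q : ℝ} (hq : 0 < q) (s : ℂ) : (q : ℂ) / qPow q s = qPow q (1 - s) := by
  rw [qPow_sub hq, qPow_one]

lemma norm_qPow {q : ℝ} (hq : 0 < q) (s : ℂ) : ‖qPow q s‖ = q ^ s.re :=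
  Complex.norm_cpow_eq_rpow_re_of_pos hq s

lemma qPow_eq_exp {q : ℝ} (hq : 0 < q) (s : ℂ) : qPow q s = Complex.exp (Real.log q * s) := by
  rw [qPow, Complex.cpow_def_of_ne_zero (by exact_mod_cast hq.ne'), Complex.ofReal_log hq.le]

lemma norm_ofReal_lt_one {q : ℝ} (hq : 0 < q) (hq1 : q < 1) : ‖(q : ℂ)‖ < 1 := by
  rwa [Complex.norm_real, Real.norm_of_nonneg hq.le]

lemma eventually_mem_Ioo : ∀ᶠ q : ℝ in 𝓝[<] 1, 1 / 2 < q ∧ q < 1 :=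
  (eventually_nhdsWithin_of_eventually_nhds (eventually_gt_nhds (by norm_num))).and
    eventually_mem_nhdsWithin

lemma tendsto_one_sub : Tendsto (fun q : ℝ => 1 - q) (𝓝[<] 1) (𝓝 0) := by
  have : Tendsto (fun q : ℝ => 1 - q) (𝓝 1) (𝓝 (1 - 1)) := by
    exact (continuous_const.sub continuous_id).tendsto 1
  rw [sub_self] at this
  exact this.mono_left nhdsWithin_le_nhds

lemma tendsto_ofReal_one : Tendsto (fun q : ℝ => (q : ℂ)) (𝓝[<] 1) (𝓝 1) := by
  have := Complex.continuous_ofReal.tendsto 1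
  rw [Complex.ofReal_one] at this
  exact this.mono_left nhdsWithin_le_nhds

lemma tendsto_qPow (s : ℂ) : Tendsto (fun q : ℝ => qPow q s) (𝓝[<] 1) (𝓝 1) := by
  have : ContinuousAt (fun q : ℝ => (q : ℂ) ^ s) 1 :=
    Complex.continuousAt_ofReal_cpow_const 1 s (Or.inr one_ne_zero)
  have h := this.tendsto
  simp only [Complex.ofReal_one, Complex.one_cpow] at h
  exact h.mono_left nhdsWithin_le_nhds

lemma exists_norm_one_sub_qPow_sub_le (s : ℂ) : ∃ C, 0 ≤ C ∧ ∀ q : ℝ, 1 / 2 ≤ q → q < 1 →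
    ‖1 - qPow q s - s * ((1 - q : ℝ) : ℂ)‖ ≤ C * (1 - q) ^ 2 := by
  refine ⟨4 * ‖s‖ ^ 2 * Real.exp ‖s‖ + 2 * ‖s‖, by positivity, fun q hq hq1 => ?_⟩
  have hq0 : 0 < q := by linarith
  have h1 : Real.log q ≤ q - 1 := Real.log_le_sub_one_of_pos hq0
  have h2 : 1 - q⁻¹ ≤ Real.log q := Real.one_sub_inv_le_log_of_pos hq0
  have h3 : q⁻¹ ≤ 1 + (1 - q) + 2 * (1 - q) ^ 2 := by
    rw [inv_le_iff_one_le_mul₀ hq0]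
    nlinarith [mul_nonneg (sq_nonneg (1 - q)) (by linarith : (0 : ℝ) ≤ 2 * q - 1)]
  have h4 : |Real.log q| ≤ 2 * (1 - q) := by
    rw [abs_le]
    constructor <;> nlinarith
  have h5 : |Real.log q + (1 - q)| ≤ 2 * (1 - q) ^ 2 := by
    rw [abs_le]
    constructor <;> nlinarith [sq_nonneg (1 - q)]
  set w : ℂ := Real.log q * s with hw
  have hwn : ‖w‖ ≤ 2 * (1 - q) * ‖s‖ := by
    rw [hw, norm_mul, Complex.norm_real, Real.norm_eq_abs]
    gcongr
  have hws : ‖w‖ ≤ ‖s‖ := hwn.trans (by nlinarith [norm_nonneg s])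
  have h6 := Complex.norm_exp_sub_sum_le_norm_mul_exp w 2
  simp only [Finset.sum_range_succ, Finset.sum_range_zero, pow_zero, pow_one, Nat.factorial,
    Nat.cast_one, div_one, zero_add, mul_one] at h6
  have h7 : ‖w + s * ((1 - q : ℝ) : ℂ)‖ ≤ 2 * (1 - q) ^ 2 * ‖s‖ := by
    rw [hw, mul_comm s, ← add_mul, ← Complex.ofReal_add, norm_mul, Complex.norm_real,
      Real.norm_eq_abs]
    gcongr
  rw [qPow_eq_exp hq0, ← hw]
  calc ‖1 - Complex.exp w - s * ((1 - q : ℝ) : ℂ)‖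
      = ‖-(Complex.exp w - (1 + w)) - (w + s * ((1 - q : ℝ) : ℂ))‖ := by congr 1; ring
    _ ≤ ‖Complex.exp w - (1 + w)‖ + ‖w + s * ((1 - q : ℝ) : ℂ)‖ := by
        rw [← norm_neg (Complex.exp w - (1 + w))]; exact norm_sub_le _ _
    _ ≤ (2 * (1 - q) * ‖s‖) ^ 2 * Real.exp ‖s‖ + 2 * (1 - q) ^ 2 * ‖s‖ := by
        refine add_le_add (h6.trans ?_) h7
        gcongr
    _ = _ := by ring

lemma exists_norm_one_sub_qPow_le (s : ℂ) : ∃ C, 0 ≤ C ∧ ∀ q : ℝ, 1 / 2 ≤ q → q < 1 →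
    ‖1 - qPow q s‖ ≤ C * (1 - q) := by
  obtain ⟨C, hC, h⟩ := exists_norm_one_sub_qPow_sub_le s
  refine ⟨C + ‖s‖, by positivity, fun q hq hq1 => ?_⟩
  have h1 := h q hq hq1
  have h2 : ‖s * ((1 - q : ℝ) : ℂ)‖ = ‖s‖ * (1 - q) := by
    rw [norm_mul, Complex.norm_real, Real.norm_of_nonneg (by linarith)]
  have h3 : C * (1 - q) ^ 2 ≤ C * (1 - q) := by
    gcongr
    nlinarith
  calc ‖1 - qPow q s‖ = ‖(1 - qPow q s - s * ((1 - q : ℝ) : ℂ)) + s * ((1 - q : ℝ) : ℂ)‖ := by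
        congr 1; ring
    _ ≤ _ := norm_add_le _ _
    _ ≤ (C + ‖s‖) * (1 - q) := by rw [h2]; linarith

lemma tendsto_one_sub_qPow_div (s : ℂ) :
    Tendsto (fun q : ℝ => (1 - qPow q s) / ((1 - q : ℝ) : ℂ)) (𝓝[<] 1) (𝓝 s) := by
  obtain ⟨C, hC, h⟩ := exists_norm_one_sub_qPow_sub_le s
  rw [tendsto_iff_norm_sub_tendsto_zero]
  have h0 : Tendsto (fun q : ℝ => C * (1 - q)) (𝓝[<] 1) (𝓝 0) := by
    simpa using tendsto_one_sub.const_mul C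
  refine squeeze_zero' (Eventually.of_forall fun q => norm_nonneg _) ?_ h0
  filter_upwards [eventually_mem_Ioo] with q hq
  have hε : 0 < 1 - q := by linarith [hq.2]
  have hne : ((1 - q : ℝ) : ℂ) ≠ 0 := by exact_mod_cast hε.ne'
  have e : (1 - qPow q s) / ((1 - q : ℝ) : ℂ) - s
      = (1 - qPow q s - s * ((1 - q : ℝ) : ℂ)) / ((1 - q : ℝ) : ℂ) := by
    field_simp
  rw [e, norm_div, Complex.norm_real, Real.norm_of_nonneg hε.le, div_le_iff₀ hε]
  calc _ ≤ C * (1 - q) ^ 2 := h q hq.1.le hq.2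
    _ = _ := by ring

end Powers

/-! ### Quotients of infinite shifted factorials -/

section Ratio

/-- With `r = v / (1 - v)`, this is `(1 - q^s v) / (1 - v) · ((1 - v) / (1 - q v))^s`. -/
def localFactor (s : ℂ) (q : ℝ) (r : ℂ) : ℂ :=
  (1 + (1 - qPow q s) * r) * Complex.exp (-s * Complex.log (1 + ((1 - q : ℝ) : ℂ) * r))

/-- The first order terms in `1 - q` of the two factors of `localFactor` cancel. -/
lemma exists_norm_localFactor_sub_one_le (s : ℂ) : ∃ C, 0 ≤ C ∧ ∀ q : ℝ, 1 / 2 ≤ q → q < 1 →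
    ∀ r : ℂ, (1 - q) * ‖r‖ ≤ 1 / 2 →
      ‖localFactor s q r - 1‖ ≤ C * ((1 - q) ^ 2 * (‖r‖ * (1 + ‖r‖))) := by
  obtain ⟨C₂, hC₂, H₂⟩ := exists_norm_one_sub_qPow_sub_le s
  obtain ⟨C₃, hC₃, H₃⟩ := exists_norm_one_sub_qPow_le s
  set C₁ : ℝ := (3 / 2 * ‖s‖) ^ 2 * Real.exp ‖s‖ + ‖s‖ with hC₁
  have hC₁0 : 0 ≤ C₁ := by positivity
  refine ⟨C₂ + C₃ * ‖s‖ + (1 + C₃) * C₁, by positivity, fun q hq hq1 r hr => ?_⟩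
  have hε : 0 < 1 - q := by linarith
  set t : ℂ := ((1 - q : ℝ) : ℂ) * r with ht
  set η : ℂ := 1 - qPow q s with hη
  have htn : ‖t‖ = (1 - q) * ‖r‖ := by
    rw [ht, norm_mul, Complex.norm_real, Real.norm_of_nonneg hε.le]
  have ht2 : ‖t‖ ≤ 1 / 2 := htn ▸ hr
  have hlog1 : ‖Complex.log (1 + t)‖ ≤ 3 / 2 * ‖t‖ := Complex.norm_log_one_add_half_le_self ht2
  have hlog2 : ‖Complex.log (1 + t) - t‖ ≤ ‖t‖ ^ 2 := by
    refine (Complex.norm_log_one_add_sub_self_le (by linarith)).trans ?_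
    have : (1 - ‖t‖)⁻¹ ≤ 2 := by
      rw [inv_le_comm₀ (by linarith) (by norm_num)]; linarith
    nlinarith [sq_nonneg ‖t‖]
  set x : ℂ := -s * Complex.log (1 + t) with hx
  have hxn : ‖x‖ ≤ 3 / 2 * ‖s‖ * ‖t‖ := by
    rw [hx, norm_mul, norm_neg]
    calc _ ≤ ‖s‖ * (3 / 2 * ‖t‖) := by gcongr
      _ = _ := by ring
  have hxs : ‖x‖ ≤ ‖s‖ := hxn.trans (by nlinarith [norm_nonneg s])
  have hexp := Complex.norm_exp_sub_sum_le_norm_mul_exp x 2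
  simp only [Finset.sum_range_succ, Finset.sum_range_zero, pow_zero, pow_one, Nat.factorial,
    Nat.cast_one, div_one, zero_add, mul_one] at hexp
  set g : ℂ := Complex.exp x - 1 + s * t with hg
  have hgn : ‖g‖ ≤ C₁ * ‖t‖ ^ 2 := by
    have e : g = (Complex.exp x - (1 + x)) - s * (Complex.log (1 + t) - t) := by
      rw [hg, hx]; ring
    rw [e]
    calc _ ≤ ‖Complex.exp x - (1 + x)‖ + ‖s * (Complex.log (1 + t) - t)‖ := norm_sub_le _ _
      _ ≤ (3 / 2 * ‖s‖ * ‖t‖) ^ 2 * Real.exp ‖s‖ + ‖s‖ * ‖t‖ ^ 2 := by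
          refine add_le_add (hexp.trans ?_) ?_
          · gcongr
          · rw [norm_mul]; gcongr
      _ = _ := by rw [hC₁]; ring
  have e : localFactor s q r - 1
      = (η - s * ((1 - q : ℝ) : ℂ)) * r - (η * r) * (s * t) + (1 + η * r) * g := by
    rw [localFactor, ← ht, ← hx, ← hη, hg, ht]
    ring
  have hηr : ‖η * r‖ ≤ C₃ * ((1 - q) * ‖r‖) := by
    rw [norm_mul, ← mul_assoc]
    gcongr
    exact H₃ q hq hq1
  have hηr1 : ‖1 + η * r‖ ≤ 1 + C₃ := by
    refine (norm_add_le _ _).trans ?_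
    rw [norm_one]
    nlinarith
  have n1 : ‖(η - s * ((1 - q : ℝ) : ℂ)) * r‖ ≤ C₂ * (1 - q) ^ 2 * ‖r‖ := by
    rw [norm_mul]
    gcongr
    exact H₂ q hq hq1
  have n2 : ‖(η * r) * (s * t)‖ ≤ C₃ * ((1 - q) * ‖r‖) * (‖s‖ * ((1 - q) * ‖r‖)) := by
    rw [norm_mul, norm_mul s, htn]
    gcongr
  have n3 : ‖(1 + η * r) * g‖ ≤ (1 + C₃) * (C₁ * ((1 - q) * ‖r‖) ^ 2) := by
    rw [norm_mul, ← htn]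
    gcongr
  rw [e]
  calc _ ≤ ‖(η - s * ((1 - q : ℝ) : ℂ)) * r‖ + ‖(η * r) * (s * t)‖ + ‖(1 + η * r) * g‖ :=
        (norm_add_le _ _).trans (add_le_add_left (norm_sub_le _ _) _)
    _ ≤ C₂ * (1 - q) ^ 2 * ‖r‖ + C₃ * ((1 - q) * ‖r‖) * (‖s‖ * ((1 - q) * ‖r‖))
        + (1 + C₃) * (C₁ * ((1 - q) * ‖r‖) ^ 2) := by gcongr
    _ = (1 - q) ^ 2 * ‖r‖ * (C₂ + (C₃ * ‖s‖ + (1 + C₃) * C₁) * ‖r‖) := by ring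
    _ ≤ (1 - q) ^ 2 * ‖r‖ * ((C₂ + C₃ * ‖s‖ + (1 + C₃) * C₁) * (1 + ‖r‖)) := by
        gcongr
        have : 0 ≤ C₃ * ‖s‖ + (1 + C₃) * C₁ := by positivity
        nlinarith [norm_nonneg r, mul_nonneg hC₂ (norm_nonneg r)]
    _ = _ := by ring

lemma one_sub_mul_mem_slitPlane {v : ℂ} (hv : 1 - v ∈ Complex.slitPlane) {t : ℝ} (ht : 0 ≤ t)
    (ht1 : t ≤ 1) : 1 - (t : ℂ) * v ∈ Complex.slitPlane := by
  rw [Complex.mem_slitPlane_iff] at hv ⊢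
  simp only [Complex.sub_re, Complex.one_re, Complex.sub_im, Complex.one_im, Complex.re_ofReal_mul,
    Complex.im_ofReal_mul] at hv ⊢
  rcases hv with hv | hv
  · left
    rcases ht.eq_or_lt with rfl | h
    · simp
    · nlinarith [mul_pos h hv]
  · rcases ht.eq_or_lt with rfl | ht
    · left; simp
    · right
      simpa [ht.ne'] using hv

/-- The principal logarithm of a quotient of two points on a ray from `1`. -/
lemma log_div_one_sub {v : ℂ} (hv : 1 - v ∈ Complex.slitPlane) {t : ℝ} (ht : 0 < t)
    (ht1 : t ≤ 1) : Complex.log ((1 - (t : ℂ) * v) / (1 - v))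
      = Complex.log (1 - (t : ℂ) * v) - Complex.log (1 - v) := by
  have h1 := Complex.slitPlane_ne_zero hv
  have hv' := one_sub_mul_mem_slitPlane hv ht.le ht1
  have h2 := Complex.slitPlane_ne_zero hv'
  have e : (1 - (t : ℂ) * v) / (1 - v)
      = Complex.exp (Complex.log (1 - (t : ℂ) * v) - Complex.log (1 - v)) := by
    rw [Complex.exp_sub, Complex.exp_log h1, Complex.exp_log h2]
  have him : (Complex.log (1 - (t : ℂ) * v) - Complex.log (1 - v)).im
      = Complex.arg (1 - (t : ℂ) * v) - Complex.arg (1 - v) := by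
    simp [Complex.log_im]
  have hb1 := Complex.neg_pi_lt_arg (1 - v)
  have hb2 := Complex.neg_pi_lt_arg (1 - (t : ℂ) * v)
  have hb3 := Complex.arg_le_pi (1 - v)
  have hb4 := Complex.arg_le_pi (1 - (t : ℂ) * v)
  have hpi := Real.pi_pos
  have him2 : (1 - (t : ℂ) * v).im = t * (1 - v).im := by simp
  have hbounds : -Real.pi < Complex.arg (1 - (t : ℂ) * v) - Complex.arg (1 - v) ∧
      Complex.arg (1 - (t : ℂ) * v) - Complex.arg (1 - v) ≤ Real.pi := by
    rcases lt_trichotomy (1 - v).im 0 with h | h | h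
    · have a1 := Complex.arg_neg_iff.2 h
      have a2 : Complex.arg (1 - (t : ℂ) * v) < 0 :=
        Complex.arg_neg_iff.2 (by rw [him2]; exact mul_neg_of_pos_of_neg ht h)
      constructor <;> linarith
    · have a1 : Complex.arg (1 - v) = 0 := by
        rw [Complex.arg_eq_zero_iff]
        refine ⟨?_, h⟩
        rcases Complex.mem_slitPlane_iff.1 hv with h' | h'
        · exact h'.le
        · exact absurd h h'
      have a2 : Complex.arg (1 - (t : ℂ) * v) = 0 := by
        have h0 : (1 - (t : ℂ) * v).im = 0 := by rw [him2, h, mul_zero]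
        rw [Complex.arg_eq_zero_iff]
        refine ⟨?_, h0⟩
        rcases Complex.mem_slitPlane_iff.1 hv' with h' | h'
        · exact h'.le
        · exact absurd h0 h'
      rw [a1, a2]
      constructor <;> linarith
    · have a1 := Complex.arg_nonneg_iff.2 h.le
      have a2 : 0 ≤ Complex.arg (1 - (t : ℂ) * v) :=
        Complex.arg_nonneg_iff.2 (by rw [him2]; positivity)
      refine ⟨?_, by linarith⟩
      have a3 : Complex.arg (1 - v) ≠ Real.pi := fun h' =>
        (Complex.arg_eq_pi_iff.1 h').2.not_gt h
      have := lt_of_le_of_ne hb3 a3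
      linarith
  rw [e, Complex.log_exp]
  · rw [him]; exact hbounds.1
  · rw [him]; exact hbounds.2

variable {q : ℝ} {s u : ℂ}

/-- The ratio `v / (1 - v)` at `v = u q^k`. -/
def ratioVar (q : ℝ) (u : ℂ) (k : ℕ) : ℂ := u * (q : ℂ) ^ k / (1 - u * (q : ℂ) ^ k)

lemma prod_localFactor (hq : 0 < q) (hq1 : q < 1) (hu : 1 - u ∈ Complex.slitPlane) (n : ℕ) :
    ∏ k ∈ Finset.range n, localFactor s q (ratioVar q u k)
      = qPoch (qPow q s * u) q n / qPoch u q n *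
        Complex.exp (s * (Complex.log (1 - u) - Complex.log (1 - u * (q : ℂ) ^ n))) := by
  induction n with
  | zero => simp [qPoch]
  | succ n ih =>
    have hv : 1 - u * (q : ℂ) ^ n ∈ Complex.slitPlane := by
      have := one_sub_mul_mem_slitPlane hu (pow_nonneg hq.le n) (pow_le_one₀ hq.le hq1.le)
      rwa [Complex.ofReal_pow, mul_comm] at this
    have h1 := Complex.slitPlane_ne_zero hv
    have e1 : 1 + (1 - qPow q s) * ratioVar q u n
        = (1 - qPow q s * u * (q : ℂ) ^ n) / (1 - u * (q : ℂ) ^ n) := by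
      rw [ratioVar]; field_simp; ring
    have e2 : 1 + ((1 - q : ℝ) : ℂ) * ratioVar q u n
        = (1 - (q : ℂ) * (u * (q : ℂ) ^ n)) / (1 - u * (q : ℂ) ^ n) := by
      rw [ratioVar]; push_cast; field_simp; ring
    rw [Finset.prod_range_succ, ih, qPoch_succ, qPoch_succ, localFactor, e1, e2,
      log_div_one_sub hv hq hq1.le,
      show u * (q : ℂ) ^ (n + 1) = (q : ℂ) * (u * (q : ℂ) ^ n) by ring,
      mul_div_mul_comm, mul_mul_mul_comm, ← Complex.exp_add]
    congr 2
    ring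

lemma tendsto_prod_localFactor (hq : 0 < q) (hq1 : q < 1) (hu : 1 - u ∈ Complex.slitPlane) :
    Tendsto (fun n => ∏ k ∈ Finset.range n, localFactor s q (ratioVar q u k)) atTop
      (𝓝 (qPochInf (qPow q s * u) q / qPochInf u q * Complex.exp (s * Complex.log (1 - u)))) := by
  have hqn := norm_ofReal_lt_one hq hq1
  have hne : qPochInf u q ≠ 0 := qPochInf_ne_zero hqn fun k h => by
    have := one_sub_mul_mem_slitPlane hu (pow_nonneg hq.le k) (pow_le_one₀ hq.le hq1.le)
    rw [Complex.ofReal_pow, mul_comm, h, sub_self] at this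
    exact Complex.slitPlane_ne_zero this rfl
  have h1 := (tendsto_qPoch hqn (qPow q s * u)).div (tendsto_qPoch hqn u) hne
  have h2 : Tendsto (fun n : ℕ => Complex.log (1 - u * (q : ℂ) ^ n)) atTop (𝓝 0) := by
    have h3 : Tendsto (fun n : ℕ => 1 - u * (q : ℂ) ^ n) atTop (𝓝 1) := by
      simpa using ((tendsto_pow_atTop_nhds_zero_of_norm_lt_one hqn).const_mul u).const_sub 1
    have := (continuousAt_clog (by simp : (1 : ℂ) ∈ Complex.slitPlane)).tendsto.comp h3
    rwa [Complex.log_one] at this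
  have h3 := Complex.continuous_exp.continuousAt.tendsto.comp
    ((h2.const_sub (Complex.log (1 - u))).const_mul s)
  rw [sub_zero] at h3
  exact (h1.mul h3).congr fun n => (prod_localFactor hq hq1 hu n).symm

lemma norm_ratio_sub_one_le (hq : 0 < q) (hq1 : q < 1) (hu : 1 - u ∈ Complex.slitPlane) {E : ℝ}
    (hE : ∀ n, ∑ k ∈ Finset.range n, ‖localFactor s q (ratioVar q u k) - 1‖ ≤ E) :
    ‖qPochInf (qPow q s * u) q / qPochInf u q * Complex.exp (s * Complex.log (1 - u)) - 1‖
      ≤ Real.exp E - 1 := by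
  refine le_of_tendsto ((tendsto_prod_localFactor hq hq1 hu).sub_const 1).norm
    (Eventually.of_forall fun n => ?_)
  have := Finset.norm_prod_one_add_sub_one_le (Finset.range n)
    fun k => localFactor s q (ratioVar q u k) - 1
  simp only [add_sub_cancel] at this
  exact this.trans (sub_le_sub_right (Real.exp_le_exp.2 (hE n)) 1)

end Ratio

/-! ### Rays avoiding the positive axis -/

section Cone

/-- The ray through `v` keeps away from the point `1`, in proportion to the size of its points;
the constant `c` measures its angle to the positive axis. -/
def InCone (c : ℝ) (v : ℂ) : Prop := ∀ t : ℝ, 0 ≤ t → c * (1 + t * ‖v‖) ≤ ‖1 - (t : ℂ) * v‖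

lemma InCone.smul {c : ℝ} {v : ℂ} (h : InCone c v) {t : ℝ} (ht : 0 ≤ t) :
    InCone c ((t : ℂ) * v) := by
  intro s hs
  have := h (s * t) (mul_nonneg hs ht)
  rw [norm_mul, Complex.norm_real, Real.norm_of_nonneg ht, ← mul_assoc, ← mul_assoc,
    ← Complex.ofReal_mul]
  exact this

lemma InCone.mul_pow {c : ℝ} {v : ℂ} (h : InCone c v) {q : ℝ} (hq : 0 ≤ q) (k : ℕ) :
    InCone c (v * (q : ℂ) ^ k) := by
  have := h.smul (pow_nonneg hq k)
  rwa [Complex.ofReal_pow, mul_comm] at this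

lemma InCone.le_norm {c : ℝ} {v : ℂ} (h : InCone c v) : c * (1 + ‖v‖) ≤ ‖1 - v‖ := by
  simpa using h 1 zero_le_one

lemma InCone.ne_one {c : ℝ} {v : ℂ} (hc : 0 < c) (h : InCone c v) : v ≠ 1 := by
  rintro rfl
  have := h.le_norm
  rw [sub_self, norm_zero, norm_one] at this
  linarith

/-- Cones are stable under small rotations, with a loss in the constant. -/
lemma InCone.perturb {c : ℝ} {v η : ℂ} (hc : 0 < c) (hc1 : c ≤ 1) (h : InCone c v)
    (hη : ‖η - 1‖ ≤ c / 2) : InCone (c / 4) (η * v) := by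
  intro t ht
  have h1 := h t ht
  have hηn : ‖η‖ ≤ 2 := by
    calc ‖η‖ = ‖(η - 1) + 1‖ := by rw [sub_add_cancel]
      _ ≤ ‖η - 1‖ + ‖(1 : ℂ)‖ := norm_add_le _ _
      _ ≤ 2 := by rw [norm_one]; linarith
  have h2 : ‖1 - (t : ℂ) * v‖ - ‖(t : ℂ) * v * (η - 1)‖ ≤ ‖1 - (t : ℂ) * (η * v)‖ := by
    rw [show 1 - (t : ℂ) * (η * v) = (1 - (t : ℂ) * v) - (t : ℂ) * v * (η - 1) by ring]
    exact norm_sub_norm_le _ _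
  have h3 : ‖(t : ℂ) * v * (η - 1)‖ ≤ t * ‖v‖ * (c / 2) := by
    rw [norm_mul, norm_mul, Complex.norm_real, Real.norm_of_nonneg ht]
    gcongr
  have h4 : t * ‖η * v‖ ≤ 2 * (t * ‖v‖) := by
    rw [norm_mul]
    nlinarith [mul_nonneg ht (norm_nonneg v)]
  have h5 : 0 ≤ t * ‖v‖ := by positivity
  nlinarith

lemma cos_mul_le_norm_one_add (w : ℂ) :
    Real.cos (Complex.arg w / 2) * (1 + ‖w‖) ≤ ‖1 + w‖ := by
  have hpi := Complex.arg_le_pi w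
  have hpi' := Complex.neg_pi_lt_arg w
  have hc : 0 ≤ Real.cos (Complex.arg w / 2) :=
    Real.cos_nonneg_of_mem_Icc ⟨by linarith, by linarith⟩
  refine abs_le_of_sq_le_sq' ?_ (norm_nonneg _) |>.2
  have h1 : ‖1 + w‖ ^ 2 = 1 + 2 * w.re + ‖w‖ ^ 2 := by
    rw [Complex.sq_norm, Complex.sq_norm, Complex.normSq_apply, Complex.normSq_apply]
    simp
    ring
  have h2 : w.re = ‖w‖ * Real.cos (Complex.arg w) := by rw [Complex.norm_mul_cos_arg]
  have h3 : Real.cos (Complex.arg w) = 2 * Real.cos (Complex.arg w / 2) ^ 2 - 1 := by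
    rw [← Real.cos_two_mul]; congr 1; ring
  have h4 := Real.cos_sq_le_one (Complex.arg w / 2)
  rw [h1, h2, h3]
  nlinarith [mul_nonneg (sub_nonneg.2 h4) (sq_nonneg (1 - ‖w‖))]

lemma inCone_cos (z : ℂ) : InCone (Real.cos (Complex.arg (-z) / 2)) z := by
  intro t ht
  rcases ht.eq_or_lt with rfl | ht
  · simpa using Real.cos_le_one _
  · have := cos_mul_le_norm_one_add ((t : ℂ) * (-z))
    rw [Complex.arg_real_mul _ ht, norm_mul, Complex.norm_real, Real.norm_of_nonneg ht.le, norm_neg,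
      mul_neg, ← sub_eq_add_neg] at this
    exact this

lemma exists_inCone {z : ℂ} (hz : z ∈ cutPlane) : ∃ c, 0 < c ∧ c ≤ 1 ∧ InCone c z := by
  refine ⟨_, ?_, Real.cos_le_one _, inCone_cos z⟩
  have h1 := Complex.neg_pi_lt_arg (-z)
  have h2 := lt_of_le_of_ne (Complex.arg_le_pi (-z)) (Complex.slitPlane_arg_ne_pi hz)
  exact Real.cos_pos_of_mem_Ioo ⟨by linarith, by linarith⟩

lemma inCone_of_mem_sector {δ : ℝ} (hδ : 0 < δ) {z : ℂ} (hz : z ∈ sector δ) :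
    InCone (Real.sin (δ / 2)) z := by
  have h0 := abs_nonneg (Complex.arg (-z))
  have h := hz.2
  have hpi := Real.pi_pos
  have hle : Real.sin (δ / 2) ≤ Real.cos (Complex.arg (-z) / 2) := by
    rw [← Real.cos_pi_div_two_sub, ← Real.cos_abs (Complex.arg (-z) / 2)]
    refine Real.cos_le_cos_of_nonneg_of_le_pi (abs_nonneg _) (by linarith) ?_
    rw [abs_div, abs_two]
    linarith
  intro t ht
  refine le_trans ?_ (inCone_cos z t ht)
  gcongr

lemma mem_cutPlane_of_mem_sector {δ : ℝ} (hδ : 0 < δ) {z : ℂ} (hz : z ∈ sector δ) :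
    z ∈ cutPlane := by
  rw [cutPlane, Set.mem_ofPred_eq, Complex.mem_slitPlane_iff_arg]
  refine ⟨fun h => ?_, neg_ne_zero.2 hz.1⟩
  have := hz.2
  rw [h, abs_of_pos Real.pi_pos] at this
  linarith

lemma norm_div_one_sub_le {c : ℝ} {v : ℂ} (hc : 0 < c) (h : InCone c v) :
    ‖v / (1 - v)‖ ≤ c⁻¹ * (‖v‖ / (1 + ‖v‖)) := by
  have h1 := h.le_norm
  rw [norm_div]
  calc ‖v‖ / ‖1 - v‖ ≤ ‖v‖ / (c * (1 + ‖v‖)) := by gcongr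
    _ = _ := by field_simp

/-- A Riemann sum of `∫ dx / (1 + x)` at geometrically distributed points. -/
lemma sum_div_one_add_le_log {q x : ℝ} (hq : 0 < q) (hx : 0 ≤ x) (n : ℕ) :
    ∑ k ∈ Finset.range n, (1 - q) * (x * q ^ k / (1 + x * q ^ k)) ≤ Real.log (1 + x) := by
  suffices h : ∑ k ∈ Finset.range n, (1 - q) * (x * q ^ k / (1 + x * q ^ k))
      ≤ Real.log (1 + x) - Real.log (1 + x * q ^ n) by
    have : 0 ≤ Real.log (1 + x * q ^ n) :=
      Real.log_nonneg (by linarith [mul_nonneg hx (pow_nonneg hq.le n)])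
    linarith
  induction n with
  | zero => simp
  | succ n ih =>
    rw [Finset.sum_range_succ]
    have h0 : 0 ≤ x * q ^ n := by positivity
    have h1 : 0 < 1 + x * q ^ n := by positivity
    have h2 : 0 < 1 + x * q ^ (n + 1) := by positivity
    have h3 := Real.one_sub_inv_le_log_of_pos (div_pos h1 h2)
    rw [Real.log_div h1.ne' h2.ne', inv_div] at h3
    have h4 : 1 - (1 + x * q ^ (n + 1)) / (1 + x * q ^ n)
        = (1 - q) * (x * q ^ n / (1 + x * q ^ n)) := by
      field_simp; ring
    linarith

lemma norm_mul_ofReal_pow {q : ℝ} (hq : 0 ≤ q) (u : ℂ) (k : ℕ) :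
    ‖u * (q : ℂ) ^ k‖ = ‖u‖ * q ^ k := by
  rw [norm_mul, norm_pow, Complex.norm_real, Real.norm_of_nonneg hq]

lemma InCone.mem_slitPlane {c : ℝ} {v : ℂ} (hc : 0 < c) (h : InCone c v) :
    1 - v ∈ Complex.slitPlane := by
  rw [Complex.mem_slitPlane_iff]
  by_contra! hcon
  obtain ⟨h1, h2⟩ := hcon
  simp only [Complex.sub_re, Complex.one_re, Complex.sub_im, Complex.one_im] at h1 h2
  have hv : v = (v.re : ℂ) := by apply Complex.ext <;> simp; linarith
  have h3 : 1 ≤ v.re := by linarith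
  have h4 := h v.re⁻¹ (by positivity)
  have h5 : (1 : ℂ) - ((v.re⁻¹ : ℝ) : ℂ) * v = 0 := by
    rw [hv]; norm_cast; rw [inv_mul_cancel₀ (by linarith)]; simp
  rw [h5, norm_zero] at h4
  have : 0 < c * (1 + v.re⁻¹ * ‖v‖) := by positivity
  linarith

end Cone

/-! ### Quotients of shifted factorials along a ray as `q → 1` -/

section Limits

lemma tendsto_one_sub_mul_log {K : ℝ} (hK : 0 ≤ K) :
    Tendsto (fun q : ℝ => (1 - q) * Real.log (1 + K / (1 - q))) (𝓝[<] 1) (𝓝 0) := by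
  have h1 : Tendsto (fun q : ℝ => 2 * Real.sqrt ((1 - q) ^ 2 + (1 - q) * K)) (𝓝[<] 1) (𝓝 0) := by
    have := ((tendsto_one_sub.pow 2).add (tendsto_one_sub.mul_const K))
    have := (Real.continuous_sqrt.tendsto _).comp this
    simpa using this.const_mul 2
  refine squeeze_zero' ?_ ?_ h1
  · filter_upwards [eventually_mem_Ioo] with q hq
    have hε : 0 < 1 - q := by linarith [hq.2]
    exact mul_nonneg hε.le (Real.log_nonneg (by linarith [div_nonneg hK hε.le]))
  · filter_upwards [eventually_mem_Ioo] with q hq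
    have hε : 0 < 1 - q := by linarith [hq.2]
    have hp : 0 < 1 + K / (1 - q) := by positivity
    have h2 : Real.log (1 + K / (1 - q)) ≤ 2 * Real.sqrt (1 + K / (1 - q)) := by
      have h3 := Real.log_sqrt hp.le
      have h4 := Real.log_le_sub_one_of_pos (Real.sqrt_pos.2 hp)
      linarith
    calc (1 - q) * Real.log (1 + K / (1 - q))
        ≤ (1 - q) * (2 * Real.sqrt (1 + K / (1 - q))) := by gcongr
      _ = 2 * (Real.sqrt ((1 - q) ^ 2) * Real.sqrt (1 + K / (1 - q))) := by
          rw [Real.sqrt_sq hε.le]; ring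
      _ = 2 * Real.sqrt ((1 - q) ^ 2 + (1 - q) * K) := by
          rw [← Real.sqrt_mul (sq_nonneg _)]
          congr 2
          field_simp

lemma norm_xVar {q : ℝ} (hq1 : q < 1) (z : ℂ) : ‖xVar q z‖ = ‖z‖ / (1 - q) := by
  rw [xVar, norm_div, Complex.norm_real, Real.norm_of_nonneg (by linarith)]

lemma q_mul_xVar (q : ℝ) (z : ℂ) : (q : ℂ) * xVar q z = ((q / (1 - q) : ℝ) : ℂ) * z := by
  rw [xVar]; push_cast; ring

/-- A quotient of infinite shifted factorials along a ray behaves like a power. -/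
lemma tendsto_ratio_mul_exp (s : ℂ) {z : ℂ} (hz : z ∈ cutPlane) :
    Tendsto (fun q : ℝ => qPochInf (qPow q s * ((q : ℂ) * xVar q z)) q /
      qPochInf ((q : ℂ) * xVar q z) q *
        Complex.exp (s * Complex.log (1 - (q : ℂ) * xVar q z))) (𝓝[<] 1) (𝓝 1) := by
  obtain ⟨c, hc, hc1, hcone⟩ := exists_inCone hz
  obtain ⟨C, hC, H⟩ := exists_norm_localFactor_sub_one_le s
  set D : ℝ := C * (c⁻¹ * (1 + c⁻¹)) with hD
  have hD0 : 0 ≤ D := by positivity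
  have h0 : Tendsto (fun q : ℝ => Real.exp (D * ((1 - q) * Real.log (1 + ‖z‖ / (1 - q)))) - 1)
      (𝓝[<] 1) (𝓝 0) := by
    have := (Real.continuous_exp.tendsto _).comp
      ((tendsto_one_sub_mul_log (norm_nonneg z)).const_mul D)
    simpa using this.sub_const 1
  rw [tendsto_iff_norm_sub_tendsto_zero]
  refine squeeze_zero' (Eventually.of_forall fun q => norm_nonneg _) ?_ h0
  have hsmall : ∀ᶠ q : ℝ in 𝓝[<] 1, 1 - q ≤ c / 2 :=
    tendsto_one_sub.eventually (ge_mem_nhds (by positivity))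
  filter_upwards [eventually_mem_Ioo, hsmall] with q hq hqc
  have hq0 : 0 < q := by linarith [hq.1]
  have hε : 0 < 1 - q := by linarith [hq.2]
  have hcu : InCone c ((q : ℂ) * xVar q z) := by
    rw [q_mul_xVar]
    exact hcone.smul (by positivity)
  set u := (q : ℂ) * xVar q z with hu
  have hun : ‖u‖ ≤ ‖z‖ / (1 - q) := by
    rw [hu, norm_mul, norm_xVar hq.2, Complex.norm_real, Real.norm_of_nonneg hq0.le]
    exact mul_le_of_le_one_left (by positivity) hq.2.le
  refine norm_ratio_sub_one_le hq0 hq.2 (hcu.mem_slitPlane hc) fun n => ?_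
  have hterm : ∀ k, ‖localFactor s q (ratioVar q u k) - 1‖
      ≤ D * (1 - q) * ((1 - q) * (‖u‖ * q ^ k / (1 + ‖u‖ * q ^ k))) := by
    intro k
    have hr := norm_div_one_sub_le hc (hcu.mul_pow hq0.le k)
    rw [norm_mul_ofReal_pow hq0.le] at hr
    have hfrac : ‖u‖ * q ^ k / (1 + ‖u‖ * q ^ k) ≤ 1 := by
      rw [div_le_one (by positivity)]; linarith
    have hr1 : ‖ratioVar q u k‖ ≤ c⁻¹ :=
      hr.trans (mul_le_of_le_one_right (by positivity) hfrac)
    have hhalf : (1 - q) * ‖ratioVar q u k‖ ≤ 1 / 2 := by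
      calc (1 - q) * ‖ratioVar q u k‖ ≤ c / 2 * c⁻¹ := by gcongr
        _ = 1 / 2 := by field_simp
    calc _ ≤ C * ((1 - q) ^ 2 * (‖ratioVar q u k‖ * (1 + ‖ratioVar q u k‖))) :=
          H q hq.1.le hq.2 _ hhalf
      _ ≤ C * ((1 - q) ^ 2 * (c⁻¹ * (‖u‖ * q ^ k / (1 + ‖u‖ * q ^ k)) * (1 + c⁻¹))) := by
          gcongr
          exact hr
      _ = _ := by rw [hD]; ring
  calc _ ≤ ∑ k ∈ Finset.range n, D * (1 - q) * ((1 - q) * (‖u‖ * q ^ k / (1 + ‖u‖ * q ^ k))) :=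
        Finset.sum_le_sum fun k _ => hterm k
    _ ≤ D * (1 - q) * Real.log (1 + ‖u‖) := by
        rw [← Finset.mul_sum]
        gcongr
        exact sum_div_one_add_le_log hq0 (norm_nonneg u) n
    _ ≤ D * (1 - q) * Real.log (1 + ‖z‖ / (1 - q)) := by
        gcongr
    _ = _ := by ring

lemma one_sub_cpow {q : ℝ} (hq1 : q < 1) (s : ℂ) :
    ((1 - q : ℝ) : ℂ) ^ s = Complex.exp (s * Real.log (1 - q)) := by
  have : ((1 - q : ℝ) : ℂ) ≠ 0 := by exact_mod_cast (by linarith : (1 - q : ℝ) ≠ 0)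
  rw [Complex.cpow_def_of_ne_zero this, Complex.ofReal_log (by linarith), mul_comm]

/-- The factor `(1 - q)^s` turns the growth `(1 - u)^{-s}` at `u = q z / (1 - q)` into a finite
limit, as `(1 - q) (1 - u) → -z`. -/
lemma tendsto_ratio (s : ℂ) {z : ℂ} (hz : z ∈ cutPlane) :
    Tendsto (fun q : ℝ => ((1 - q : ℝ) : ℂ) ^ (-s) *
      (qPochInf (qPow q s * ((q : ℂ) * xVar q z)) q / qPochInf ((q : ℂ) * xVar q z) q))
      (𝓝[<] 1) (𝓝 ((-z) ^ (-s))) := by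
  obtain ⟨c, hc, hc1, hcone⟩ := exists_inCone hz
  have h1 : Tendsto (fun q : ℝ => ((1 - q : ℝ) : ℂ) - q * z) (𝓝[<] 1) (𝓝 (-z)) := by
    have := ((Complex.continuous_ofReal.tendsto 0).comp tendsto_one_sub).sub
      (tendsto_ofReal_one.mul_const z)
    simpa using this
  have h2 := (continuousAt_clog (x := -z) hz).tendsto.comp h1
  have h3 := (Complex.continuous_exp.tendsto _).comp (h2.const_mul (-s))
  have h4 := (tendsto_ratio_mul_exp s hz).mul h3
  rw [one_mul] at h4
  have hz0 : -z ≠ 0 := Complex.slitPlane_ne_zero hz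
  rw [Complex.cpow_def_of_ne_zero hz0, mul_comm (Complex.log _)]
  refine h4.congr' ?_
  filter_upwards [eventually_mem_Ioo] with q hq
  have hε : 0 < 1 - q := by linarith [hq.2]
  have hq0 : 0 < q := by linarith [hq.1]
  have hcu : InCone c ((q : ℂ) * xVar q z) := by
    rw [q_mul_xVar]
    exact hcone.smul (by positivity)
  have hne : 1 - (q : ℂ) * xVar q z ≠ 0 := Complex.slitPlane_ne_zero (hcu.mem_slitPlane hc)
  have e1 : ((1 - q : ℝ) : ℂ) - q * z = ((1 - q : ℝ) : ℂ) * (1 - (q : ℂ) * xVar q z) := by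
    have : ((1 - q : ℝ) : ℂ) ≠ 0 := by exact_mod_cast hε.ne'
    rw [xVar]
    field_simp
  simp only [Function.comp]
  rw [e1, Complex.log_ofReal_mul hε hne, one_sub_cpow hq.2, mul_assoc, ← Complex.exp_add, mul_comm]
  congr 2
  ring

end Limits

/-! ### Limits of coefficients and of series as `q → 1` -/

section CoefficientLimits

lemma succ_mul_pow_le {q : ℝ} (hq : 0 ≤ q) (hq1 : q ≤ 1) (n : ℕ) :
    (n + 1) * (q ^ n * (1 - q)) ≤ 1 - q ^ (n + 1) := by
  induction n with
  | zero => simp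
  | succ n ih =>
    have h0 : 0 ≤ q ^ n := pow_nonneg hq n
    have h1 : q ^ (n + 1) ≤ q ^ n := pow_le_pow_of_le_one hq hq1 (Nat.le_succ n)
    have h2 : ((n : ℝ) + 1) * (q ^ (n + 1) * (1 - q)) ≤ (n + 1) * (q ^ n * (1 - q)) := by
      have : 0 ≤ 1 - q := by linarith
      gcongr
    push_cast
    rw [pow_succ q (n + 1)]
    linarith

lemma tendsto_one_sub_pow_div (n : ℕ) :
    Tendsto (fun q : ℝ => (1 - (q : ℂ) ^ n) / ((1 - q : ℝ) : ℂ)) (𝓝[<] 1) (𝓝 n) := by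
  simpa only [qPow_natCast] using tendsto_one_sub_qPow_div n

lemma tendsto_qPoch_div (s : ℂ) (n : ℕ) :
    Tendsto (fun q : ℝ => qPoch (qPow q s) q n / ((1 - q : ℝ) : ℂ) ^ n) (𝓝[<] 1)
      (𝓝 (rising s n)) := by
  have h : Tendsto (fun q : ℝ => ∏ k ∈ Finset.range n, (1 - qPow q (s + k)) / ((1 - q : ℝ) : ℂ))
      (𝓝[<] 1) (𝓝 (rising s n)) :=
    tendsto_finsetProd _ fun k _ => tendsto_one_sub_qPow_div (s + k)
  refine h.congr' ?_
  filter_upwards [eventually_mem_Ioo] with q hq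
  have hq0 : 0 < q := by linarith [hq.1]
  rw [Finset.prod_div_distrib, Finset.prod_const, Finset.card_range, qPoch]
  congr 1
  exact Finset.prod_congr rfl fun k _ => by rw [qPow_add hq0, qPow_natCast]

lemma rising_one (n : ℕ) : rising 1 n = n.factorial := by
  rw [rising, ← Finset.prod_range_add_one_eq_factorial]
  push_cast
  exact Finset.prod_congr rfl fun k _ => add_comm _ _

lemma tendsto_qPoch_self_div (n : ℕ) :
    Tendsto (fun q : ℝ => qPoch (q : ℂ) q n / ((1 - q : ℝ) : ℂ) ^ n) (𝓝[<] 1)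
      (𝓝 (n.factorial : ℂ)) := by
  simpa only [qPow_one, rising_one] using tendsto_qPoch_div 1 n

lemma one_sub_ne_zero {q : ℝ} (hq1 : q < 1) : ((1 - q : ℝ) : ℂ) ≠ 0 := by
  exact_mod_cast (by linarith : (1 - q : ℝ) ≠ 0)

/-- Euler's series at `(1 - q) t` is dominated by the exponential series, uniformly in `q`. -/
lemma norm_eulerCoeff_mul_le {q : ℝ} (hq : 0 < q) (hq1 : q < 1) (n : ℕ) :
    ‖eulerCoeff q n * ((1 - q : ℝ) : ℂ) ^ n‖ ≤ 1 / n.factorial := by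
  have hε : 0 < 1 - q := by linarith
  induction n with
  | zero => simp [eulerCoeff_zero]
  | succ n ih =>
    have h1 := succ_mul_pow_le hq.le hq1.le n
    have h2 : 0 < 1 - q ^ (n + 1) := by
      have : q ^ (n + 1) < 1 := pow_lt_one₀ hq.le hq1 (Nat.succ_ne_zero n)
      linarith
    have h3 : ‖-(q : ℂ) ^ n / (1 - (q : ℂ) ^ (n + 1)) * ((1 - q : ℝ) : ℂ)‖ ≤ 1 / (n + 1) := by
      have e : -(q : ℂ) ^ n / (1 - (q : ℂ) ^ (n + 1)) * ((1 - q : ℝ) : ℂ)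
          = ((-(q ^ n * (1 - q) / (1 - q ^ (n + 1))) : ℝ) : ℂ) := by push_cast; ring
      rw [e, Complex.norm_real, norm_neg, Real.norm_of_nonneg (by positivity), div_le_div_iff₀ h2
        (by positivity)]
      linarith
    have e : eulerCoeff (q : ℂ) (n + 1) * ((1 - q : ℝ) : ℂ) ^ (n + 1)
        = (-(q : ℂ) ^ n / (1 - (q : ℂ) ^ (n + 1)) * ((1 - q : ℝ) : ℂ)) *
          (eulerCoeff q n * ((1 - q : ℝ) : ℂ) ^ n) := by
      rw [eulerCoeff_succ (norm_ofReal_lt_one hq hq1) (by exact_mod_cast hq.ne')]; ring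
    rw [e, norm_mul]
    calc _ ≤ 1 / ((n : ℝ) + 1) * (1 / n.factorial) := by gcongr
      _ = _ := by rw [Nat.factorial_succ]; push_cast; field_simp

lemma tendsto_eulerCoeff_mul (n : ℕ) :
    Tendsto (fun q : ℝ => eulerCoeff q n * ((1 - q : ℝ) : ℂ) ^ n) (𝓝[<] 1)
      (𝓝 ((-1) ^ n / n.factorial)) := by
  have h1 : Tendsto (fun q : ℝ => (-1 : ℂ) ^ n * (q : ℂ) ^ ((n : ℤ) * (n - 1) / 2)) (𝓝[<] 1)
      (𝓝 ((-1) ^ n)) := by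
    simpa using ((tendsto_ofReal_one.zpow₀ ((n : ℤ) * (n - 1) / 2) (Or.inl one_ne_zero))).const_mul
      ((-1 : ℂ) ^ n)
  refine (h1.div (tendsto_qPoch_self_div n) (by exact_mod_cast n.factorial_ne_zero)).congr' ?_
  filter_upwards [eventually_mem_Ioo] with q hq
  have := one_sub_ne_zero hq.2
  rw [eulerCoeff]
  simp only [Pi.div_apply]
  field_simp

/-- The limit `((1 - q) t; q)_∞ → e^{-t}`. -/
lemma tendsto_qPochInf_exp {t : ℝ → ℂ} {t₀ : ℂ} (ht : Tendsto t (𝓝[<] 1) (𝓝 t₀)) :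
    Tendsto (fun q : ℝ => qPochInf (((1 - q : ℝ) : ℂ) * t q) q) (𝓝[<] 1)
      (𝓝 (Complex.exp (-t₀))) := by
  have hexp : Complex.exp (-t₀) = ∑' n : ℕ, (-1) ^ n / (n.factorial : ℂ) * t₀ ^ n := by
    rw [Complex.exp_eq_exp_ℂ, NormedSpace.exp_eq_tsum_div]
    refine tsum_congr fun n => ?_
    rw [neg_pow]; ring
  have hT : ∀ᶠ q in 𝓝[<] 1, ‖t q‖ ≤ ‖t₀‖ + 1 :=
    ht.norm.eventually (ge_mem_nhds (by linarith))
  have h := tendsto_tsum_of_dominated_convergence (𝓕 := 𝓝[<] (1 : ℝ))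
    (f := fun (q : ℝ) (n : ℕ) => eulerCoeff q n * ((1 - q : ℝ) : ℂ) ^ n * t q ^ n)
    (g := fun n : ℕ => (-1) ^ n / (n.factorial : ℂ) * t₀ ^ n)
    (bound := fun n => (‖t₀‖ + 1) ^ n / n.factorial)
    (Real.summable_pow_div_factorial _)
    (fun n => (tendsto_eulerCoeff_mul n).mul (ht.pow n)) ?_
  · rw [hexp]
    refine h.congr' ?_
    filter_upwards [eventually_mem_Ioo] with q hq
    have hq0 : 0 < q := by linarith [hq.1]
    rw [← tsum_euler (norm_ofReal_lt_one hq0 hq.2) (by exact_mod_cast hq0.ne')]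
    exact tsum_congr fun n => by rw [mul_pow]; ring
  · filter_upwards [eventually_mem_Ioo, hT] with q hq hTq n
    have hq0 : 0 < q := by linarith [hq.1]
    rw [norm_mul, norm_pow]
    calc _ ≤ 1 / n.factorial * (‖t₀‖ + 1) ^ n := by
          gcongr
          exact norm_eulerCoeff_mul_le hq0 hq.2 n
      _ = _ := by ring

/-- Dominated convergence for series whose terms eventually decay geometrically, uniformly in
the parameter. -/
lemma tendsto_tsum_of_ratio {ι : Type*} {l : Filter ι} {f : ι → ℕ → ℂ} {g : ℕ → ℂ}
    (hlim : ∀ n, Tendsto (fun i => f i n) l (𝓝 (g n))) (k₀ : ℕ)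
    (hr : ∀ᶠ i in l, ∀ n, k₀ ≤ n → ‖f i (n + 1)‖ ≤ 1 / 2 * ‖f i n‖) :
    Tendsto (fun i => ∑' n, f i n) l (𝓝 (∑' n, g n)) := by
  have hfin : ∀ᶠ i in l, ∀ n ∈ Finset.range (k₀ + 1), ‖f i n‖ ≤ ‖g n‖ + 1 :=
    (eventually_all_finset _).2 fun n _ =>
      (hlim n).norm.eventually (ge_mem_nhds (by linarith))
  refine tendsto_tsum_of_dominated_convergence
    (bound := fun n => if n < k₀ then ‖g n‖ + 1 else (‖g k₀‖ + 1) * (1 / 2) ^ (n - k₀))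
    ?_ hlim ?_
  · refine (summable_nat_add_iff k₀).1 ?_
    simp only [Nat.not_lt.2 (Nat.le_add_left k₀ _), if_false, Nat.add_sub_cancel]
    exact (summable_geometric_of_lt_one (by norm_num) (by norm_num)).mul_left _
  · filter_upwards [hfin, hr] with i hi hri n
    split_ifs with hn
    · exact hi n (Finset.mem_range.2 (by omega))
    · obtain ⟨j, rfl⟩ := Nat.exists_eq_add_of_le (not_lt.1 hn)
      rw [Nat.add_sub_cancel_left]
      clear hn
      induction j with
      | zero => simpa using hi k₀ (Finset.mem_range.2 (by omega))
      | succ j ih =>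
        calc ‖f i (k₀ + (j + 1))‖ ≤ 1 / 2 * ‖f i (k₀ + j)‖ := hri (k₀ + j) (by omega)
          _ ≤ 1 / 2 * ((‖g k₀‖ + 1) * (1 / 2) ^ j) := by gcongr
          _ = _ := by ring

lemma norm_one_sub_qPow_add_bounds {s : ℂ} {C : ℝ} {q : ℝ} (hq : 0 < q) (hq1 : q < 1)
    (h : ‖1 - qPow q s‖ ≤ C * (1 - q)) (n : ℕ) :
    ‖1 - qPow q s * (q : ℂ) ^ n‖ ≤ (1 - q ^ n) + q ^ n * (C * (1 - q)) ∧
      (1 - q ^ n) - C * (1 - q) ≤ ‖1 - qPow q s * (q : ℂ) ^ n‖ := by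
  have hqn : q ^ n ≤ 1 := pow_le_one₀ hq.le hq1.le
  have h0 : 0 < q ^ n := pow_pos hq n
  have e : 1 - qPow q s * (q : ℂ) ^ n
      = ((1 - q ^ n : ℝ) : ℂ) + ((q ^ n : ℝ) : ℂ) * (1 - qPow q s) := by push_cast; ring
  have n1 : ‖((1 - q ^ n : ℝ) : ℂ)‖ = 1 - q ^ n := by
    rw [Complex.norm_real, Real.norm_of_nonneg (by linarith)]
  have n2 : ‖((q ^ n : ℝ) : ℂ) * (1 - qPow q s)‖ ≤ q ^ n * (C * (1 - q)) := by
    rw [norm_mul, Complex.norm_real, Real.norm_of_nonneg h0.le]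
    gcongr
  have n3 : q ^ n * (C * (1 - q)) ≤ C * (1 - q) :=
    mul_le_of_le_one_left ((norm_nonneg _).trans h) hqn
  rw [e]
  constructor
  · exact (norm_add_le _ _).trans (by rw [n1]; linarith)
  · have := norm_sub_le (((1 - q ^ n : ℝ) : ℂ) + ((q ^ n : ℝ) : ℂ) * (1 - qPow q s))
      (((q ^ n : ℝ) : ℂ) * (1 - qPow q s))
    rw [add_sub_cancel_right, n1] at this
    linarith

lemma rising_ne_zero {c : ℂ} (hc : ∀ k : ℕ, c + k ≠ 0) (n : ℕ) : rising c n ≠ 0 :=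
  Finset.prod_ne_zero_iff.2 fun k _ => hc k

/-- The confluent limit `₂φ₁(q^a, 0; q^c; q, (1 - q) y) → ₁F₁(a; c; y)`. -/
lemma tendsto_phi_oneFOne (a : ℂ) {c : ℂ} (hc : ∀ k : ℕ, c + k ≠ 0) {y : ℝ → ℂ} {y₀ : ℂ}
    (hy : Tendsto y (𝓝[<] 1) (𝓝 y₀)) :
    Tendsto (fun q : ℝ => phi (qPow q a) 0 (qPow q c) q (((1 - q : ℝ) : ℂ) * y q)) (𝓝[<] 1)
      (𝓝 (oneFOne a c y₀)) := by
  obtain ⟨C₁, hC₁, H₁⟩ := exists_norm_one_sub_qPow_le a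
  obtain ⟨C₂, hC₂, H₂⟩ := exists_norm_one_sub_qPow_le c
  -- for `n ≥ k₀` and `q` near `1` the `q`-number `(1 - q^n) / (1 - q)` is at least `M`
  set Y : ℝ := ‖y₀‖ + 1 with hY
  have hYp : 0 < Y := by positivity
  set M : ℝ := C₁ + 2 * C₂ + 8 * Y with hM
  obtain ⟨k₀, hk₀⟩ := exists_nat_ge (2 * M)
  have hpow : ∀ᶠ q : ℝ in 𝓝[<] 1, 1 / 2 ≤ q ^ k₀ := by
    have : Tendsto (fun q : ℝ => q ^ k₀) (𝓝[<] 1) (𝓝 1) := by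
      have := (continuous_pow k₀).tendsto (1 : ℝ)
      rw [one_pow] at this
      exact this.mono_left nhdsWithin_le_nhds
    exact this.eventually (le_mem_nhds (by norm_num))
  have hyY : ∀ᶠ q in 𝓝[<] 1, ‖y q‖ ≤ Y := hy.norm.eventually (ge_mem_nhds (by rw [hY]; linarith))
  refine tendsto_tsum_of_ratio (fun n => ?_) k₀ ?_
  · have h := (((tendsto_qPoch_div a n).div ((tendsto_qPoch_div c n).mul (tendsto_qPoch_self_div n))
      (mul_ne_zero (rising_ne_zero hc n) (by exact_mod_cast n.factorial_ne_zero)))).mul (hy.pow n)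
    refine h.congr' ?_
    filter_upwards [eventually_mem_Ioo] with q hq
    have := one_sub_ne_zero hq.2
    simp only [phiCoeff, qPoch_zero_left, mul_pow, Pi.div_apply]
    field_simp
  · filter_upwards [eventually_mem_Ioo, hpow, hyY] with q hq hqk hyq n hn
    have hq0 : 0 < q := by linarith [hq.1]
    have hε : 0 < 1 - q := by linarith [hq.2]
    have hbig : M * (1 - q) ≤ 1 - q ^ n := by
      have h1 : q ^ n ≤ q ^ k₀ := pow_le_pow_of_le_one hq0.le hq.2.le hn
      rcases Nat.eq_zero_or_pos k₀ with h0 | h0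
      · have hM0 : M ≤ 0 := by rw [h0] at hk₀; simp at hk₀; linarith
        have : M > 0 := by positivity
        linarith
      · obtain ⟨k, rfl⟩ : ∃ k, k₀ = k + 1 := ⟨k₀ - 1, by omega⟩
        have h2 := succ_mul_pow_le hq0.le hq.2.le k
        have h3 : q ^ (k + 1) ≤ q ^ k := pow_le_pow_of_le_one hq0.le hq.2.le (Nat.le_succ k)
        have h4 : (2 * M) * (1 / 2 * (1 - q)) ≤ ((k : ℝ) + 1) * (q ^ k * (1 - q)) := by
          have : (2 * M) ≤ (k : ℝ) + 1 := by exact_mod_cast hk₀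
          have hM0 : 0 ≤ M := by positivity
          gcongr
          linarith
        linarith
    have b1 := (norm_one_sub_qPow_add_bounds hq0 hq.2 (H₁ q hq.1.le hq.2) n).1
    have b2 := (norm_one_sub_qPow_add_bounds hq0 hq.2 (H₂ q hq.1.le hq.2) n).2
    have hqn : q ^ n ≤ 1 := pow_le_one₀ hq0.le hq.2.le
    have hqnp : 0 < q ^ n := pow_pos hq0 n
    set p : ℝ := 1 - q ^ n with hp
    have hMp : C₁ * (1 - q) + 2 * (C₂ * (1 - q)) + 8 * (Y * (1 - q)) ≤ p := by
      rw [hM] at hbig; linarith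
    have z1 : 0 ≤ C₁ * (1 - q) := by positivity
    have z2 : 0 ≤ C₂ * (1 - q) := by positivity
    have z3 : 0 < Y * (1 - q) := by positivity
    have hp0 : 0 < p := by linarith
    have b1' : ‖1 - qPow q a * (q : ℂ) ^ n‖ ≤ 2 * p := by
      have : q ^ n * (C₁ * (1 - q)) ≤ C₁ * (1 - q) := mul_le_of_le_one_left z1 hqn
      linarith
    have b2' : p / 2 ≤ ‖1 - qPow q c * (q : ℂ) ^ n‖ := by linarith
    have b3 : ‖1 - (q : ℂ) * (q : ℂ) ^ n‖ = 1 - q ^ (n + 1) := by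
      have : q ^ (n + 1) ≤ 1 := pow_le_one₀ hq0.le hq.2.le
      rw [show 1 - (q : ℂ) * (q : ℂ) ^ n = ((1 - q ^ (n + 1) : ℝ) : ℂ) by push_cast; ring,
        Complex.norm_real, Real.norm_of_nonneg (by linarith)]
    have b3' : p ≤ ‖1 - (q : ℂ) * (q : ℂ) ^ n‖ := by
      have : q ^ (n + 1) ≤ q ^ n := pow_le_pow_of_le_one hq0.le hq.2.le (Nat.le_succ n)
      rw [b3, hp]
      linarith
    have e : phiCoeff (qPow q a) 0 (qPow q c) q (n + 1) * (((1 - q : ℝ) : ℂ) * y q) ^ (n + 1)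
        = (1 - qPow q a * (q : ℂ) ^ n) /
            ((1 - qPow q c * (q : ℂ) ^ n) * (1 - (q : ℂ) * (q : ℂ) ^ n))
          * (((1 - q : ℝ) : ℂ) * y q) *
          (phiCoeff (qPow q a) 0 (qPow q c) q n * (((1 - q : ℝ) : ℂ) * y q) ^ n) := by
      simp only [phiCoeff, qPoch_succ, qPoch_zero_left, pow_succ, zero_mul, sub_zero, mul_one]
      rw [mul_mul_mul_comm, mul_div_mul_comm]
      ring
    rw [e, norm_mul]
    gcongr
    rw [norm_mul, norm_div, norm_mul, norm_mul, Complex.norm_real, Real.norm_of_nonneg hε.le]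
    calc _ ≤ 2 * p / (p / 2 * p) * ((1 - q) * Y) := by gcongr
      _ = 4 * (Y * (1 - q)) / p := by field_simp; ring
      _ ≤ 1 / 2 := by rw [div_le_iff₀ hp0]; linarith

end CoefficientLimits

/-! ### The limit of the `q`-gamma function -/

section QGamma

/-- At a pole of `Γ` both sides are `0`, as Mathlib's `Γ` vanishes there. -/
lemma tendsto_inv_GammaSeq (x : ℂ) :
    Tendsto (fun n => (Complex.GammaSeq x n)⁻¹) atTop (𝓝 (Complex.Gamma x)⁻¹) := by
  by_cases h : Complex.Gamma x = 0
  · obtain ⟨m, rfl⟩ := (Complex.Gamma_eq_zero_iff x).1 h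
    rw [h, inv_zero]
    refine tendsto_const_nhds.congr' ?_
    filter_upwards [eventually_ge_atTop m] with n hn
    have : ∏ j ∈ Finset.range (n + 1), (-(m : ℂ) + j) = 0 :=
      Finset.prod_eq_zero (Finset.mem_range.2 (by omega : m < n + 1)) (by simp)
    rw [Complex.GammaSeq, this, div_zero, inv_zero]
  · exact (Complex.GammaSeq_tendsto_Gamma x).inv₀ h

/-- The limit of `localFactor s q r` when `(1 - q) r → t`. -/
lemma tendsto_localFactor (s : ℂ) {r : ℝ → ℂ} {t : ℂ} (ht : 1 + t ∈ Complex.slitPlane)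
    (hr : Tendsto (fun q : ℝ => ((1 - q : ℝ) : ℂ) * r q) (𝓝[<] 1) (𝓝 t)) :
    Tendsto (fun q : ℝ => localFactor s q (r q)) (𝓝[<] 1)
      (𝓝 ((1 + s * t) * Complex.exp (-s * Complex.log (1 + t)))) := by
  have h1 : Tendsto (fun q : ℝ => (1 - qPow q s) * r q) (𝓝[<] 1) (𝓝 (s * t)) := by
    refine ((tendsto_one_sub_qPow_div s).mul hr).congr' ?_
    filter_upwards [eventually_mem_Ioo] with q hq
    have := one_sub_ne_zero hq.2
    field_simp
  have h2 := (continuousAt_clog ht).tendsto.comp (hr.const_add 1)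
  exact (h1.const_add 1).mul ((Complex.continuous_exp.tendsto _).comp (h2.const_mul (-s)))

/-- Euler's product for `1 / Γ(s + 2)`. -/
lemma tendsto_euler_product (s : ℂ) :
    Tendsto (fun n : ℕ => ∏ k ∈ Finset.range n, ((1 + s * (1 / (k + 2 : ℂ))) *
      Complex.exp (-s * Complex.log (1 + 1 / (k + 2 : ℂ))))) atTop
      (𝓝 ((Complex.Gamma (s + 2))⁻¹ * Complex.exp (s * Real.log 2))) := by
  rw [← tendsto_add_atTop_iff_nat 1]
  have hfin : ∀ n : ℕ, ∏ k ∈ Finset.range n, ((1 + s * (1 / (k + 2 : ℂ))) *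
      Complex.exp (-s * Complex.log (1 + 1 / (k + 2 : ℂ))))
      = (∏ k ∈ Finset.range n, (s + 2 + k)) / ((n + 1).factorial : ℂ) *
        Complex.exp (s * Real.log 2 - s * Real.log (n + 2)) := by
    intro n
    induction n with
    | zero => simp
    | succ n ih =>
      have hk : ((n : ℂ) + 2) ≠ 0 := by exact_mod_cast (by omega : n + 2 ≠ 0)
      have hlog : Complex.log (1 + 1 / (n + 2 : ℂ))
          = ((Real.log (n + 3) - Real.log (n + 2) : ℝ) : ℂ) := by
        rw [← Real.log_div (by positivity) (by positivity), Complex.ofReal_log (by positivity)]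
        congr 1
        push_cast
        field_simp
        ring
      rw [Finset.prod_range_succ, ih, hlog, Finset.prod_range_succ, Nat.factorial_succ (n + 1)]
      have e : Complex.exp (s * Real.log 2 - s * Real.log ((n + 1 : ℕ) + 2))
          = Complex.exp (s * Real.log 2 - s * Real.log (n + 2)) *
            Complex.exp (-s * ((Real.log (n + 3) - Real.log (n + 2) : ℝ) : ℂ)) := by
        rw [← Complex.exp_add]
        congr 1
        rw [show (((n + 1 : ℕ) : ℝ) + 2) = n + 3 by push_cast; ring]
        push_cast
        ring
      have hf : ((n + 1).factorial : ℂ) ≠ 0 := by exact_mod_cast (n + 1).factorial_ne_zero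
      rw [e, Nat.cast_mul, show ((n + 1 + 1 : ℕ) : ℂ) = n + 2 by push_cast; ring]
      field_simp
      ring
  have h1 : Tendsto (fun n : ℕ => (n : ℝ) / (n + 3)) atTop (𝓝 1) := by
    simpa using tendsto_natCast_div_add_atTop (𝕜 := ℝ) (3 : ℝ)
  have h2 : Tendsto (fun n : ℕ => (n : ℝ) / (n + 1) * (n / (n + 2))) atTop (𝓝 1) := by
    simpa using (tendsto_natCast_div_add_atTop (𝕜 := ℝ) (1 : ℝ)).mul
      (tendsto_natCast_div_add_atTop (𝕜 := ℝ) (2 : ℝ))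
  have h3 : Tendsto (fun n : ℕ => Complex.exp (s * Real.log ((n : ℝ) / (n + 3)))) atTop (𝓝 1) := by
    have h4 := (Real.continuousAt_log one_ne_zero).tendsto.comp h1
    rw [Real.log_one] at h4
    have h5 := (Complex.continuous_ofReal.tendsto 0).comp h4
    have h6 := (Complex.continuous_exp.tendsto _).comp (h5.const_mul s)
    simpa [Function.comp_def] using h6
  have h7 := (((tendsto_inv_GammaSeq (s + 2)).mul_const (Complex.exp (s * Real.log 2))).mul
    ((Complex.continuous_ofReal.tendsto 1).comp h2)).mul h3
  simp only [Complex.ofReal_one, mul_one] at h7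
  refine h7.congr' ?_
  filter_upwards [eventually_gt_atTop 0] with n hn
  have hn0 : (n : ℂ) ≠ 0 := by exact_mod_cast hn.ne'
  have hnr : (0 : ℝ) < n := by exact_mod_cast hn
  rw [hfin, Complex.GammaSeq, inv_div, Complex.cpow_add _ _ hn0, Complex.cpow_def_of_ne_zero hn0,
    Real.log_div hnr.ne' (by positivity), Nat.factorial_succ (n + 1), Nat.factorial_succ n]
  have e : Complex.exp (s * Real.log 2 - s * Real.log ((n + 1 : ℕ) + 2))
      = Complex.exp (s * Real.log 2) * Complex.exp (s * ((Real.log n - Real.log (n + 3) : ℝ) : ℂ))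
        / Complex.exp (Complex.log n * s) := by
    rw [← Complex.exp_add, ← Complex.exp_sub, ← Complex.natCast_log]
    congr 1
    rw [show (((n + 1 : ℕ) : ℝ) + 2) = n + 3 by push_cast; ring]
    push_cast
    ring
  rw [e]
  have hf : (n.factorial : ℂ) ≠ 0 := by exact_mod_cast n.factorial_ne_zero
  have h1 : (n : ℂ) + 1 ≠ 0 := by exact_mod_cast (by omega : n + 1 ≠ 0)
  have h2 : (n : ℂ) + 2 ≠ 0 := by exact_mod_cast (by omega : n + 2 ≠ 0)
  have h3 : (n : ℂ) + 1 + 1 ≠ 0 := by exact_mod_cast (by omega : n + 1 + 1 ≠ 0)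
  have hexp := Complex.exp_ne_zero (Complex.log n * s)
  simp only [Function.comp]
  push_cast
  rw [show ((n : ℂ) ^ (2 : ℂ)) = (n : ℂ) ^ 2 by exact_mod_cast Complex.cpow_natCast (n : ℂ) 2]
  rw [show (n : ℂ) + 1 + 1 = n + 2 by ring]
  field_simp

end QGamma

section QGammaLimit

variable {q : ℝ}

lemma ratioVar_sq (q : ℝ) (k : ℕ) :
    ratioVar q ((q : ℂ) ^ 2) k = ((q ^ (k + 2) / (1 - q ^ (k + 2)) : ℝ) : ℂ) := by
  rw [ratioVar]; push_cast; rw [← pow_add, add_comm 2 k]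

/-- A bound of the quadratic error terms in the product for the `q`-gamma function, uniform in
the base. -/
lemma sq_mul_ratio_le (hq : 0 < q) (hq1 : q < 1) (k : ℕ) :
    (1 - q) ^ 2 * (q ^ (k + 2) / (1 - q ^ (k + 2)) * (1 + q ^ (k + 2) / (1 - q ^ (k + 2))))
      ≤ 4 * (1 / ((k : ℝ) + 1) ^ 2) := by
  have hε : 0 < 1 - q := by linarith
  -- `1 - q^j ≥ 1 - q^(m+1) ≥ (m + 1) q^m (1 - q)` with `m + 1 = ⌊j/2⌋`, so that `q^j ≤ q^(2m)`
  set m := k / 2 with hm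
  have hmk : 2 * m ≤ k := Nat.mul_div_le k 2
  have hmk2 : ((k : ℝ) + 1) / 2 ≤ m + 1 := by
    have : k ≤ 2 * m + 1 := by omega
    have : (k : ℝ) ≤ 2 * m + 1 := by exact_mod_cast this
    linarith
  have h1 := succ_mul_pow_le hq.le hq1.le m
  have h2 : q ^ (k + 2) ≤ q ^ (m + 1) := pow_le_pow_of_le_one hq.le hq1.le (by omega)
  have h3 : q ^ (k + 2) ≤ (q ^ m) ^ 2 := by
    rw [← pow_mul]; exact pow_le_pow_of_le_one hq.le hq1.le (by omega)
  have hqm : 0 < q ^ m := pow_pos hq m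
  have h4 : (m + 1) * (q ^ m * (1 - q)) ≤ 1 - q ^ (k + 2) := by linarith
  have h5 : 0 < 1 - q ^ (k + 2) := lt_of_lt_of_le (by positivity) h4
  have e : (1 - q) ^ 2 * (q ^ (k + 2) / (1 - q ^ (k + 2)) * (1 + q ^ (k + 2) / (1 - q ^ (k + 2))))
      = (1 - q) ^ 2 * q ^ (k + 2) / (1 - q ^ (k + 2)) ^ 2 := by
    field_simp; ring
  rw [e]
  calc (1 - q) ^ 2 * q ^ (k + 2) / (1 - q ^ (k + 2)) ^ 2
      ≤ (1 - q) ^ 2 * (q ^ m) ^ 2 / ((m + 1) * (q ^ m * (1 - q))) ^ 2 := by gcongr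
    _ = 1 / ((m : ℝ) + 1) ^ 2 := by field_simp
    _ ≤ 1 / (((k : ℝ) + 1) / 2) ^ 2 := by gcongr
    _ = _ := by field_simp; norm_num

lemma one_sub_mul_ratioVar_le (hq : 0 < q) (hq1 : q < 1) (k : ℕ) :
    (1 - q) * ‖ratioVar q ((q : ℂ) ^ 2) k‖ ≤ 1 / 2 := by
  have h1 := succ_mul_pow_le hq.le hq1.le (k + 1)
  have h2 : q ^ (k + 2) ≤ q ^ (k + 1) := pow_le_pow_of_le_one hq.le hq1.le (by omega)
  have h3 : q ^ (k + 2) < 1 := pow_lt_one₀ hq.le hq1 (by omega)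
  have h4 : 0 < q ^ (k + 2) := pow_pos hq _
  have hε : 0 < 1 - q := by linarith
  have h5 : 0 < 1 - q ^ (k + 2) := by linarith
  rw [ratioVar_sq, Complex.norm_real, Real.norm_of_nonneg (by positivity), ← mul_div_assoc,
    div_le_div_iff₀ h5 two_pos]
  have h6 : 2 * (q ^ (k + 1) * (1 - q)) ≤ (((k + 1 : ℕ) : ℝ) + 1) * (q ^ (k + 1) * (1 - q)) := by
    have : 0 ≤ (k : ℝ) := Nat.cast_nonneg k
    gcongr
    push_cast
    linarith
  have h7 : (1 - q) * q ^ (k + 2) ≤ (1 - q) * q ^ (k + 1) := by gcongr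
  have h8 : 1 - q ^ (k + 1 + 1) = 1 - q ^ (k + 2) := rfl
  linarith

/-- The `q`-analogue of `1 / Γ`: its reciprocal is Jackson's `q`-gamma function. -/
def invQGamma (q : ℝ) (x : ℂ) : ℂ :=
  qPochInf (qPow q x) q / qPochInf q q * ((1 - q : ℝ) : ℂ) ^ (x - 1)

lemma summable_four_div_sq : Summable fun k : ℕ => 4 * (1 / ((k : ℝ) + 1) ^ 2) := by
  have := (summable_nat_add_iff 1).2 (Real.summable_one_div_nat_pow.2 (by norm_num : 1 < 2))
  simpa using this.mul_left 4

/-- The `q`-gamma function tends to the gamma function: Euler's product is the limit of the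
product of the factors `localFactor`, which are dominated by `1 + O(k^{-2})` uniformly in `q`. -/
theorem tendsto_invQGamma (x : ℂ) :
    Tendsto (fun q : ℝ => invQGamma q x) (𝓝[<] 1) (𝓝 (Complex.Gamma x)⁻¹) := by
  -- `(q^x;q)_∞ / (q^2;q)_∞` is the quotient at `u = q^2`, at which the local estimate applies
  obtain ⟨s, rfl⟩ : ∃ s, x = s + 2 := ⟨x - 2, by ring⟩
  obtain ⟨C, hC, H⟩ := exists_norm_localFactor_sub_one_le s
  have hbound : ∀ q : ℝ, 1 / 2 < q ∧ q < 1 → ∀ k,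
      ‖localFactor s q (ratioVar q ((q : ℂ) ^ 2) k) - 1‖ ≤ C * (4 * (1 / ((k : ℝ) + 1) ^ 2)) := by
    intro q hq k
    have hq0 : 0 < q := by linarith [hq.1]
    refine (H q hq.1.le hq.2 _ (one_sub_mul_ratioVar_le hq0 hq.2 k)).trans
      (mul_le_mul_of_nonneg_left ?_ hC)
    have h3 : q ^ (k + 2) < 1 := pow_lt_one₀ hq0.le hq.2 (by omega)
    have h5 : 0 < 1 - q ^ (k + 2) := by linarith
    rw [ratioVar_sq, Complex.norm_real, Real.norm_of_nonneg (by positivity)]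
    exact sq_mul_ratio_le hq0 hq.2 k
  set G : ℕ → ℂ := fun k => (1 + s * (1 / (k + 2 : ℂ))) *
      Complex.exp (-s * Complex.log (1 + 1 / (k + 2 : ℂ))) with hG
  have hpt : ∀ k : ℕ, Tendsto (fun q : ℝ => localFactor s q (ratioVar q ((q : ℂ) ^ 2) k))
      (𝓝[<] 1) (𝓝 (G k)) := by
    intro k
    refine tendsto_localFactor s ?_ ?_
    · rw [Complex.mem_slitPlane_iff]
      left
      rw [show (1 : ℂ) + 1 / (k + 2) = ((1 + 1 / (k + 2) : ℝ) : ℂ) by push_cast; ring,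
        Complex.ofReal_re]
      positivity
    · have h2 := (tendsto_ofReal_one.pow (k + 2)).div (tendsto_one_sub_pow_div (k + 2))
        (by exact_mod_cast (by omega : k + 2 ≠ 0))
      rw [one_pow] at h2
      have h3 : ((k + 2 : ℕ) : ℂ) = (k : ℂ) + 2 := by push_cast; ring
      rw [h3] at h2
      refine h2.congr' ?_
      filter_upwards [eventually_mem_Ioo] with q hq
      rw [ratioVar, ← pow_add, add_comm 2 k]
      simp only [Pi.div_apply]
      rw [div_div_eq_mul_div]
      ring
  have hsum := summable_four_div_sq.mul_left C
  have htp := tendsto_tprod_one_add_of_dominated_convergence hsum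
    (fun k => (hpt k).sub_const 1) (eventually_mem_Ioo.mono hbound)
  simp only [add_sub_cancel] at htp
  have hGprod : ∏' k, G k = (Complex.Gamma (s + 2))⁻¹ * Complex.exp (s * Real.log 2) := by
    have hGs : Summable fun k => ‖G k - 1‖ := by
      refine Summable.of_nonneg_of_le (fun _ => norm_nonneg _) (fun k => ?_) hsum
      exact le_of_tendsto ((hpt k).sub_const 1).norm
        (eventually_mem_Ioo.mono fun q hq => hbound q hq k)
    have hm := multipliable_one_add_of_summable hGs
    simp only [add_sub_cancel] at hm
    exact tendsto_nhds_unique hm.hasProd.tendsto_prod_nat (tendsto_euler_product s)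
  rw [hGprod] at htp
  have hexp : Tendsto (fun q : ℝ => Complex.exp (-s * Real.log (1 + q))) (𝓝[<] 1)
      (𝓝 (Complex.exp (-s * Real.log 2))) := by
    have h1 : Tendsto (fun q : ℝ => Real.log (1 + q)) (𝓝[<] 1) (𝓝 (Real.log 2)) := by
      have : ContinuousAt (fun q : ℝ => Real.log (1 + q)) 1 :=
        (continuousAt_const.add continuousAt_id).log (by norm_num)
      have := this.tendsto
      norm_num at this
      exact this.mono_left nhdsWithin_le_nhds
    exact (Complex.continuous_exp.tendsto _).comp
      (((Complex.continuous_ofReal.tendsto _).comp h1).const_mul (-s))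
  have hfin := htp.mul hexp
  rw [mul_assoc, ← Complex.exp_add, show s * (Real.log 2 : ℂ) + -s * Real.log 2 = 0 by ring,
    Complex.exp_zero, mul_one] at hfin
  refine hfin.congr' ?_
  filter_upwards [eventually_mem_Ioo] with q hq
  have hq0 : 0 < q := by linarith [hq.1]
  have hε : 0 < 1 - q := by linarith [hq.2]
  have hqn := norm_ofReal_lt_one hq0 hq.2
  have hq2 : q ^ 2 < 1 := pow_lt_one₀ hq0.le hq.2 two_ne_zero
  have hreal : 1 - (q : ℂ) ^ 2 = ((1 - q ^ 2 : ℝ) : ℂ) := by push_cast; ring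
  have hslit : 1 - (q : ℂ) ^ 2 ∈ Complex.slitPlane := by
    rw [hreal, Complex.mem_slitPlane_iff, Complex.ofReal_re]
    left; linarith
  have hmq := multipliable_one_add_of_summable
    (Summable.of_nonneg_of_le (fun _ => norm_nonneg _) (hbound q hq) hsum)
  simp only [add_sub_cancel] at hmq
  have hprod := tendsto_nhds_unique hmq.hasProd.tendsto_prod_nat
    (tendsto_prod_localFactor (s := s) hq0 hq.2 hslit)
  have hlog : Complex.log (1 - (q : ℂ) ^ 2) = Real.log (1 - q) + Real.log (1 + q) := by
    rw [hreal, ← Complex.ofReal_log (by linarith), ← Complex.ofReal_add, ← Real.log_mul hε.ne'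
      (by positivity)]
    congr 2; ring
  have hqq : qPochInf (q : ℂ) q = (1 - q) * qPochInf ((q : ℂ) ^ 2) q := by
    rw [qPochInf_eq_one_sub_mul hqn, pow_two]
  have hne := one_sub_ne_zero hq.2
  have hne2 : qPochInf ((q : ℂ) ^ 2) q ≠ 0 := by
    refine qPochInf_ne_zero hqn (mul_pow_ne_one hqn ?_)
    rw [norm_pow]; exact pow_lt_one₀ (norm_nonneg _) hqn two_ne_zero
  have hpow : ((1 - q : ℝ) : ℂ) ^ (s + 2 - 1)
      = Complex.exp (s * Real.log (1 - q)) * ((1 - q : ℝ) : ℂ) := by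
    rw [show s + 2 - 1 = s + 1 by ring, Complex.cpow_add _ _ hne, Complex.cpow_one,
      one_sub_cpow hq.2]
  rw [hprod, invQGamma, hqq, hpow, qPow_add hq0, hlog, mul_assoc, ← Complex.exp_add,
    show qPow q 2 = (q : ℂ) ^ 2 by exact_mod_cast qPow_natCast q 2]
  rw [show s * ((Real.log (1 - q) : ℂ) + Real.log (1 + q)) + -s * Real.log (1 + q)
    = s * Real.log (1 - q) by ring]
  push_cast at hne ⊢
  field_simp

end QGammaLimit

/-! ### The remainder of Heine's series, uniformly in `q` -/

section Remainder

/-- The quotient of shifted factorials grows at most like a power, uniformly in `q`. -/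
lemma exists_norm_ratio_le (s : ℂ) {c : ℝ} (hc : 0 < c) : ∃ M : ℕ, ∀ q : ℝ, 1 / 2 < q → q < 1 →
    ∀ u : ℂ, InCone c u →
      ‖qPochInf (qPow q s * u) q / qPochInf u q‖ ≤ (1 + ‖u‖) ^ M := by
  obtain ⟨C, hC, H⟩ := exists_norm_one_sub_qPow_le s
  obtain ⟨M, hM⟩ := exists_nat_ge (C * c⁻¹)
  refine ⟨M, fun q hq hq1 u hu => ?_⟩
  have hq0 : 0 < q := by linarith
  have hqn := norm_ofReal_lt_one hq0 hq1
  have hne : ∀ k : ℕ, u * (q : ℂ) ^ k ≠ 1 := fun k => (hu.mul_pow hq0.le k).ne_one hc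
  have hlim := ((tendsto_qPoch hqn (qPow q s * u)).div (tendsto_qPoch hqn u)
    (qPochInf_ne_zero hqn hne)).norm
  refine le_of_tendsto hlim (Eventually.of_forall fun n => ?_)
  simp only [Pi.div_apply, qPoch]
  rw [← Finset.prod_div_distrib, norm_prod]
  have hterm : ∀ k, ‖(1 - qPow q s * u * (q : ℂ) ^ k) / (1 - u * (q : ℂ) ^ k)‖
      ≤ Real.exp (C * c⁻¹ * ((1 - q) * (‖u‖ * q ^ k / (1 + ‖u‖ * q ^ k)))) := by
    intro k
    have h1 : 1 - u * (q : ℂ) ^ k ≠ 0 := sub_ne_zero.2 (hne k).symm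
    have h2 := norm_div_one_sub_le hc (hu.mul_pow hq0.le k)
    rw [norm_mul_ofReal_pow hq0.le] at h2
    have e : (1 - qPow q s * u * (q : ℂ) ^ k) / (1 - u * (q : ℂ) ^ k)
        = 1 + (1 - qPow q s) * (u * (q : ℂ) ^ k / (1 - u * (q : ℂ) ^ k)) := by
      field_simp; ring
    rw [e]
    refine (norm_add_le _ _).trans ?_
    rw [norm_one, norm_mul]
    calc 1 + ‖1 - qPow q s‖ * ‖u * (q : ℂ) ^ k / (1 - u * (q : ℂ) ^ k)‖
        ≤ 1 + C * (1 - q) * (c⁻¹ * (‖u‖ * q ^ k / (1 + ‖u‖ * q ^ k))) := by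
          gcongr
          exact H q hq.le hq1
      _ = C * c⁻¹ * ((1 - q) * (‖u‖ * q ^ k / (1 + ‖u‖ * q ^ k))) + 1 := by ring
      _ ≤ _ := Real.add_one_le_exp _
  calc _ ≤ ∏ k ∈ Finset.range n,
        Real.exp (C * c⁻¹ * ((1 - q) * (‖u‖ * q ^ k / (1 + ‖u‖ * q ^ k)))) :=
        Finset.prod_le_prod (fun _ _ => norm_nonneg _) fun k _ => hterm k
    _ = Real.exp (C * c⁻¹ * ∑ k ∈ Finset.range n, (1 - q) * (‖u‖ * q ^ k / (1 + ‖u‖ * q ^ k))) := by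
        rw [← Real.exp_sum, Finset.mul_sum]
    _ ≤ Real.exp (M * Real.log (1 + ‖u‖)) := by
        have := sum_div_one_add_le_log hq0 (norm_nonneg u) n
        have hl : 0 ≤ Real.log (1 + ‖u‖) := Real.log_nonneg (by linarith [norm_nonneg u])
        refine Real.exp_le_exp.2 ?_
        calc _ ≤ C * c⁻¹ * Real.log (1 + ‖u‖) := by gcongr
          _ ≤ _ := by gcongr
    _ = _ := by
        rw [mul_comm, Real.exp_mul, Real.exp_log (by positivity), Real.rpow_natCast]

lemma exists_norm_binomCoeff_qPow_le (s : ℂ) : ∃ C : ℝ, 1 ≤ C ∧ ∀ q : ℝ, 1 / 2 < q → q < 1 →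
    ∀ n, ‖binomCoeff (qPow q s) q n‖ ≤ C ^ n := by
  obtain ⟨C, hC, H⟩ := exists_norm_one_sub_qPow_le s
  refine ⟨1 + C, by linarith, fun q hq hq1 n => ?_⟩
  have hq0 : 0 < q := by linarith
  induction n with
  | zero => simp [binomCoeff_zero]
  | succ n ih =>
    have h1 := (norm_one_sub_qPow_add_bounds hq0 hq1 (H q hq.le hq1) n).1
    have h2 := succ_mul_pow_le hq0.le hq1.le n
    have h3 : q ^ (n + 1) ≤ q ^ n := pow_le_pow_of_le_one hq0.le hq1.le (Nat.le_succ n)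
    have h4 : 0 < q ^ n * (1 - q) := mul_pos (pow_pos hq0 n) (by linarith)
    have h5 : q ^ n * (1 - q) ≤ 1 - q ^ (n + 1) := by
      have : 0 ≤ (n : ℝ) * (q ^ n * (1 - q)) := by positivity
      linarith
    have h6 : 0 < 1 - q ^ (n + 1) := by linarith
    have h7 : ‖1 - (q : ℂ) ^ (n + 1)‖ = 1 - q ^ (n + 1) := by
      rw [show 1 - (q : ℂ) ^ (n + 1) = ((1 - q ^ (n + 1) : ℝ) : ℂ) by push_cast; ring,
        Complex.norm_real, Real.norm_of_nonneg h6.le]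
    rw [binomCoeff_succ (norm_ofReal_lt_one hq0 hq1), norm_mul, norm_div, h7, pow_succ (1 + C)]
    refine mul_le_mul ih ?_ (by positivity) (by positivity)
    rw [div_le_iff₀ h6]
    have h8 : C * (q ^ n * (1 - q)) ≤ C * (1 - q ^ (n + 1)) := by gcongr
    linarith

/-- The remainder of the `q`-binomial series is bounded uniformly in `q`: by the series itself
for small arguments, and by the growth of its sum for the others. -/
lemma exists_norm_binomRem_le (s : ℂ) {c : ℝ} (hc : 0 < c) (N : ℕ) : ∃ (D : ℝ) (M : ℕ), 0 ≤ D ∧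
    ∀ q : ℝ, 1 / 2 < q → q < 1 → ∀ u : ℂ, InCone c u →
      ‖binomRem (qPow q s) q N u‖ ≤ D * (‖u‖ ^ N * (1 + ‖u‖) ^ M) := by
  obtain ⟨M, hM⟩ := exists_norm_ratio_le s hc
  obtain ⟨C, hC1, hC⟩ := exists_norm_binomCoeff_qPow_le s
  have hC0 : 0 < C := by linarith
  refine ⟨2 * C ^ N + (1 + N) * (2 * C) ^ N, M, by positivity, fun q hq hq1 u hu => ?_⟩
  have hq0 : 0 < q := by linarith
  have hqn := norm_ofReal_lt_one hq0 hq1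
  have hone : 1 ≤ (1 + ‖u‖) ^ M := one_le_pow₀ (by linarith [norm_nonneg u])
  rcases le_or_gt (C * ‖u‖) (1 / 2) with h | h
  · have hu1 : ‖u‖ < 1 := by nlinarith [norm_nonneg u]
    have := norm_binomRem_le hqn (K := 1) hC0.le (fun n => by simpa using hC q hq hq1 n) N hu1 h
    calc _ ≤ 2 * 1 * (C * ‖u‖) ^ N := this
      _ = 2 * C ^ N * (‖u‖ ^ N * 1) := by rw [mul_pow]; ring
      _ ≤ (2 * C ^ N + (1 + N) * (2 * C) ^ N) * (‖u‖ ^ N * (1 + ‖u‖) ^ M) := by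
          gcongr
          exact le_add_of_nonneg_right (by positivity)
  · have h2 : 1 ≤ 2 * C * ‖u‖ := by linarith
    have h3 : 1 ≤ (2 * C * ‖u‖) ^ N := one_le_pow₀ h2
    have hsum : ‖∑ n ∈ Finset.range N, binomCoeff (qPow q s) q n * u ^ n‖
        ≤ N * (2 * C * ‖u‖) ^ N := by
      refine (norm_sum_le _ _).trans ?_
      calc _ ≤ ∑ n ∈ Finset.range N, (2 * C * ‖u‖) ^ N := by
            refine Finset.sum_le_sum fun n hn => ?_
            rw [norm_mul, norm_pow]
            calc _ ≤ C ^ n * ‖u‖ ^ n := by gcongr; exact hC q hq hq1 n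
              _ = 1 * (C * ‖u‖) ^ n := by rw [mul_pow]; ring
              _ ≤ 2 ^ n * (C * ‖u‖) ^ n := by
                  gcongr; exact one_le_pow₀ (by norm_num)
              _ = (2 * C * ‖u‖) ^ n := by rw [← mul_pow, mul_assoc]
              _ ≤ _ := pow_le_pow_right₀ h2 (Finset.mem_range.1 hn).le
        _ = _ := by simp
    calc _ ≤ (1 + ‖u‖) ^ M + N * (2 * C * ‖u‖) ^ N :=
          (norm_sub_le _ _).trans (add_le_add (hM q hq hq1 u hu) hsum)
      _ ≤ (2 * C * ‖u‖) ^ N * (1 + ‖u‖) ^ M + N * (2 * C * ‖u‖) ^ N * (1 + ‖u‖) ^ M := by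
          exact add_le_add (le_mul_of_one_le_left (by positivity) h3)
            (le_mul_of_one_le_right (by positivity) hone)
      _ = (1 + N) * (2 * C) ^ N * (‖u‖ ^ N * (1 + ‖u‖) ^ M) := by rw [mul_pow]; ring
      _ ≤ _ := by
          gcongr
          exact le_add_of_nonneg_left (by positivity)

/-- For real arguments Euler's series `Σ t^k / (q;q)_k` has positive terms. -/
lemma hasSum_norm_pow_div_qPoch {q t : ℝ} (hq : 0 < q) (hq1 : q < 1) (ht : 0 ≤ t) (ht1 : t < 1) :
    HasSum (fun k : ℕ => t ^ k * ‖(qPoch (q : ℂ) q k)⁻¹‖) ‖qPochInf (t : ℂ) q‖⁻¹ := by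
  have hqn := norm_ofReal_lt_one hq hq1
  have htn : ‖(t : ℂ)‖ < 1 := by rwa [Complex.norm_real, Real.norm_of_nonneg ht]
  have hpos : ∀ k, qPoch (q : ℂ) q k = ((‖qPoch (q : ℂ) q k‖ : ℝ) : ℂ) := by
    intro k
    have h1 : qPoch (q : ℂ) q k = ((∏ i ∈ Finset.range k, (1 - q * q ^ i) : ℝ) : ℂ) := by
      rw [qPoch]; push_cast; rfl
    have h2 : 0 ≤ ∏ i ∈ Finset.range k, (1 - q * q ^ i) :=
      Finset.prod_nonneg fun i _ => by
        rw [← pow_succ']; linarith [pow_le_one₀ hq.le hq1.le (n := i + 1)]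
    rw [h1, Complex.norm_real, Real.norm_of_nonneg h2]
  have hs : Summable fun k : ℕ => (t : ℂ) ^ k / qPoch (q : ℂ) q k := by
    refine (summable_binom hqn 0 htn).of_norm.congr fun n => ?_
    rw [binomCoeff, qPoch_zero_left]; ring
  have h := hs.hasSum
  rw [tsum_pow_div_qPoch hqn htn] at h
  have hterm : ∀ k, (t : ℂ) ^ k / qPoch (q : ℂ) q k
      = ((t ^ k * ‖(qPoch (q : ℂ) q k)⁻¹‖ : ℝ) : ℂ) := by
    intro k
    rw [norm_inv]
    conv_lhs => rw [hpos k]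
    push_cast
    ring
  simp only [hterm] at h
  have hre : HasSum (fun k : ℕ => t ^ k * ‖(qPoch (q : ℂ) q k)⁻¹‖)
      (1 / qPochInf (t : ℂ) q).re := by
    have := Complex.hasSum_re h
    simp only [Complex.ofReal_re] at this
    exact this
  have hval : ((1 / qPochInf (t : ℂ) q).re : ℂ) = 1 / qPochInf (t : ℂ) q :=
    ((Complex.hasSum_ofReal (f := fun k : ℕ => t ^ k * ‖(qPoch (q : ℂ) q k)⁻¹‖)).2 hre).unique h
  have hnn : 0 ≤ (1 / qPochInf (t : ℂ) q).re := hre.nonneg fun k => by positivity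
  have : (1 / qPochInf (t : ℂ) q).re = ‖qPochInf (t : ℂ) q‖⁻¹ := by
    rw [← norm_inv, ← one_div, ← hval, Complex.norm_real, Complex.ofReal_re,
      Real.norm_of_nonneg hnn]
  rwa [this] at hre

lemma qPow_ofReal {q : ℝ} (hq : 0 < q) (x : ℝ) : qPow q x = ((q ^ x : ℝ) : ℂ) := by
  rw [qPow, Complex.ofReal_cpow hq.le]

/-- The total mass of the `q`-integral in the remainder of Heine's series. -/
lemma exists_norm_qPochInf_div_le (β : ℂ) {x : ℝ} {N : ℕ} (hx : x = N + 1 - β.re) (hx0 : 0 < x) :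
    ∃ D : ℝ, 0 ≤ D ∧ ∀ᶠ q : ℝ in 𝓝[<] 1,
      ‖qPochInf (qPow q (1 - β)) q‖ * ‖qPochInf ((q ^ x : ℝ) : ℂ) q‖⁻¹ ≤ D * (1 - q) ^ N := by
  have hΓ : (Complex.Gamma x)⁻¹ ≠ 0 :=
    inv_ne_zero (Complex.Gamma_ne_zero_of_re_pos (by simpa using hx0))
  have h := ((tendsto_invQGamma (1 - β)).div (tendsto_invQGamma x) hΓ).norm
  set D := ‖(Complex.Gamma (1 - β))⁻¹ / (Complex.Gamma x)⁻¹‖ + 1 with hD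
  refine ⟨D, by positivity, ?_⟩
  filter_upwards [eventually_mem_Ioo, h.eventually (ge_mem_nhds (by linarith : _ < D))]
    with q hq hqD
  have hq0 : 0 < q := by linarith [hq.1]
  have hε : 0 < 1 - q := by linarith [hq.2]
  have hqn := norm_ofReal_lt_one hq0 hq.2
  have hqq : qPochInf (q : ℂ) q ≠ 0 := qPochInf_ne_zero hqn (mul_pow_ne_one hqn hqn)
  have n1 : ∀ s : ℂ, ‖((1 - q : ℝ) : ℂ) ^ s‖ = (1 - q) ^ s.re := fun s =>
    Complex.norm_cpow_eq_rpow_re_of_pos hε s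
  simp only [Pi.div_apply, invQGamma, qPow_ofReal hq0] at hqD
  rw [norm_div, norm_mul, norm_mul, norm_div, norm_div, n1, n1] at hqD
  have e1 : (1 - β - 1).re = -β.re := by simp
  have e2 : ((x : ℂ) - 1).re = N + -β.re := by simp [hx]; ring
  rw [e1, e2, Real.rpow_add hε, Real.rpow_natCast] at hqD
  have hp : 0 < (1 - q) ^ (-β.re) := Real.rpow_pos_of_pos hε _
  have hqq' : 0 < ‖qPochInf (q : ℂ) q‖ := norm_pos_iff.2 hqq
  rw [← div_le_iff₀ (by positivity)]
  refine le_trans (le_of_eq ?_) hqD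
  rw [mul_comm ((1 - q) ^ N)]
  field_simp

lemma eventually_inCone_qPow_mul_xVar (s : ℂ) {c : ℝ} (hc : 0 < c) (hc1 : c ≤ 1) :
    ∀ᶠ q : ℝ in 𝓝[<] 1, ∀ z : ℂ, InCone c z → InCone (c / 4) (qPow q s * xVar q z) := by
  have hη : ∀ᶠ q : ℝ in 𝓝[<] 1, ‖qPow q s - 1‖ ≤ c / 2 := by
    have := ((tendsto_qPow s).sub_const 1).norm
    rw [sub_self, norm_zero] at this
    exact this.eventually (ge_mem_nhds (by positivity))
  filter_upwards [eventually_mem_Ioo, hη] with q hq hηq z hz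
  have hxc := hz.smul (t := (1 - q)⁻¹) (inv_nonneg.2 (by linarith [hq.2]))
  rw [show (((1 - q)⁻¹ : ℝ) : ℂ) * z = xVar q z by rw [xVar]; push_cast; ring] at hxc
  exact hxc.perturb hc hc1 hηq

/-- The remainder of order `N` of Heine's series is `O(z^N)` on every sector, uniformly in `q`. -/
lemma exists_norm_heine_remainder_le (α β : ℂ) {c : ℝ} (hc : 0 < c) (hc1 : c ≤ 1) {N : ℕ}
    (hN : β.re < N + 1) : ∃ D : ℝ, 0 ≤ D ∧ ∀ᶠ q : ℝ in 𝓝[<] 1, ∀ z : ℂ, ‖z‖ ≤ 1 → InCone c z →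
      ‖qPochInf (qPow q (1 - β)) q * ∑' k : ℕ, qPow q (1 - β) ^ k / qPoch (q : ℂ) q k *
        binomRem (qPow q (1 - α)) q N (qPow q (α + β) * xVar q z * (q : ℂ) ^ k)‖ ≤ D * ‖z‖ ^ N := by
  obtain ⟨D, M, hD, hrem⟩ := exists_norm_binomRem_le (1 - α) (by positivity : 0 < c / 4) N
  obtain ⟨D₁, hD₁, H₁⟩ := exists_norm_qPochInf_div_le β (x := N + 1 - β.re) rfl (by linarith)
  obtain ⟨D₂, hD₂, H₂⟩ := exists_norm_qPochInf_div_le β (x := (N + M : ℕ) + 1 - β.re) rfl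
    (by push_cast; linarith [(Nat.cast_nonneg M : (0 : ℝ) ≤ M)])
  have hη : ∀ᶠ q : ℝ in 𝓝[<] 1, ‖qPow q (α + β) - 1‖ ≤ 1 := by
    have := ((tendsto_qPow (α + β)).sub_const 1).norm
    rw [sub_self, norm_zero] at this
    exact this.eventually (ge_mem_nhds one_pos)
  refine ⟨D * 2 ^ M * (D₁ * 2 ^ N + D₂ * 2 ^ (N + M)), by positivity, ?_⟩
  filter_upwards [eventually_mem_Ioo, H₁, H₂, hη,
    eventually_inCone_qPow_mul_xVar (α + β) hc hc1] with q hq h₁ h₂ hηq hcone z hz1 hz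
  have hq0 : 0 < q := by linarith [hq.1]
  have hε : 0 < 1 - q := by linarith [hq.2]
  have hyc := hcone z hz
  set y := qPow q (α + β) * xVar q z with hy
  have hyn : ‖y‖ ≤ 2 * ‖z‖ / (1 - q) := by
    have h2 : ‖qPow q (α + β)‖ ≤ 2 := by
      calc _ = ‖(qPow q (α + β) - 1) + 1‖ := by rw [sub_add_cancel]
        _ ≤ ‖qPow q (α + β) - 1‖ + ‖(1 : ℂ)‖ := norm_add_le _ _
        _ ≤ 2 := by rw [norm_one]; linarith
    rw [hy, norm_mul, norm_xVar hq.2, mul_div_assoc]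
    gcongr
  set b := q ^ (1 - β.re) with hb
  have hb0 : 0 < b := Real.rpow_pos_of_pos hq0 _
  have hbn : ‖qPow q (1 - β)‖ = b := by rw [norm_qPow hq0]; simp [hb]
  have hbN : ∀ j : ℕ, b * q ^ j = q ^ ((j : ℝ) + 1 - β.re) := by
    intro j
    rw [hb, ← Real.rpow_natCast, ← Real.rpow_add hq0]
    congr 1; ring
  have hlt : ∀ j : ℕ, β.re < j + 1 → q ^ ((j : ℝ) + 1 - β.re) < 1 := fun j hj =>
    Real.rpow_lt_one hq0.le hq.2 (by linarith)
  have hNM : β.re < (N + M : ℕ) + 1 := by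
    push_cast; linarith [(Nat.cast_nonneg M : (0 : ℝ) ≤ M)]
  have S₁ := hasSum_norm_pow_div_qPoch hq0 hq.2 (Real.rpow_nonneg hq0.le ((N : ℝ) + 1 - β.re))
    (hlt N hN)
  have S₂ := hasSum_norm_pow_div_qPoch hq0 hq.2
    (Real.rpow_nonneg hq0.le (((N + M : ℕ) : ℝ) + 1 - β.re)) (hlt (N + M) hNM)
  have S := ((S₁.mul_left (‖y‖ ^ N)).add (S₂.mul_left (‖y‖ ^ (N + M)))).mul_left (D * 2 ^ M)
  have hterm : ∀ k : ℕ, ‖qPow q (1 - β) ^ k / qPoch (q : ℂ) q k *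
      binomRem (qPow q (1 - α)) q N (y * (q : ℂ) ^ k)‖ ≤ D * 2 ^ M *
        (‖y‖ ^ N * ((q ^ ((N : ℝ) + 1 - β.re)) ^ k * ‖(qPoch (q : ℂ) q k)⁻¹‖) +
        ‖y‖ ^ (N + M) * ((q ^ (((N + M : ℕ) : ℝ) + 1 - β.re)) ^ k * ‖(qPoch (q : ℂ) q k)⁻¹‖)) := by
    intro k
    have h3 := hrem q hq.1 hq.2 _ (hyc.mul_pow hq0.le k)
    rw [norm_mul_ofReal_pow hq0.le] at h3
    set u := ‖y‖ * q ^ k with hu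
    have hu0 : 0 ≤ u := by positivity
    have h4 : (1 + u) ^ M ≤ 2 ^ M * (1 + u ^ M) := by
      have h5 : (1 + u) ^ M ≤ (2 * max 1 u) ^ M := by
        gcongr
        linarith [le_max_left 1 u, le_max_right 1 u]
      refine h5.trans ?_
      rw [mul_pow]
      gcongr
      rcases max_cases 1 u with ⟨h6, -⟩ | ⟨h6, -⟩ <;> rw [h6]
      · rw [one_pow]; linarith [pow_nonneg hu0 M]
      · linarith
    rw [norm_mul, div_eq_mul_inv, norm_mul, norm_pow, hbn]
    calc b ^ k * ‖(qPoch (q : ℂ) q k)⁻¹‖ * ‖binomRem (qPow q (1 - α)) q N (y * (q : ℂ) ^ k)‖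
        ≤ b ^ k * ‖(qPoch (q : ℂ) q k)⁻¹‖ * (D * (u ^ N * (2 ^ M * (1 + u ^ M)))) := by
          gcongr
          exact h3.trans (by gcongr)
      _ = _ := by
          rw [← hbN, ← hbN, hu]
          ring
  have hbound := tsum_of_norm_bounded S hterm
  rw [norm_mul]
  calc _ ≤ ‖qPochInf (qPow q (1 - β)) q‖ * (D * 2 ^ M *
        (‖y‖ ^ N * ‖qPochInf ((q ^ ((N : ℝ) + 1 - β.re) : ℝ) : ℂ) q‖⁻¹ +
        ‖y‖ ^ (N + M) * ‖qPochInf ((q ^ (((N + M : ℕ) : ℝ) + 1 - β.re) : ℝ) : ℂ) q‖⁻¹)) := by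
        gcongr
    _ = D * 2 ^ M * (‖y‖ ^ N * (‖qPochInf (qPow q (1 - β)) q‖ *
          ‖qPochInf ((q ^ ((N : ℝ) + 1 - β.re) : ℝ) : ℂ) q‖⁻¹) +
        ‖y‖ ^ (N + M) * (‖qPochInf (qPow q (1 - β)) q‖ *
          ‖qPochInf ((q ^ (((N + M : ℕ) : ℝ) + 1 - β.re) : ℝ) : ℂ) q‖⁻¹)) := by ring
    _ ≤ D * 2 ^ M * ((2 * ‖z‖ / (1 - q)) ^ N * (D₁ * (1 - q) ^ N) +
        (2 * ‖z‖ / (1 - q)) ^ (N + M) * (D₂ * (1 - q) ^ (N + M))) := by gcongr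
    _ = D * 2 ^ M * (D₁ * 2 ^ N * ‖z‖ ^ N + D₂ * 2 ^ (N + M) * (‖z‖ ^ N * ‖z‖ ^ M)) := by
        rw [div_pow, div_pow, mul_pow, mul_pow, ← pow_add]
        field_simp
    _ ≤ D * 2 ^ M * (D₁ * 2 ^ N * ‖z‖ ^ N + D₂ * 2 ^ (N + M) * (‖z‖ ^ N * 1)) := by
        gcongr
        exact pow_le_one₀ (norm_nonneg _) hz1
    _ = _ := by ring

end Remainder

/-! ### The degenerate confluent equation -/

section Kummer

lemma IsEntireSeries.hasSum_natCast_mul {c : ℕ → ℂ} (hc : IsEntireSeries c) (y : ℂ) :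
    HasSum (fun n : ℕ => n * c n * y ^ n) (y * ∑' n, QConfluent.derivCoeff c n * y ^ n) := by
  refine (hasSum_nat_add_iff' 1).1 ?_
  have h := (hc.derivCoeff y).of_norm.hasSum.mul_left y
  simp only [Finset.range_one, Finset.sum_singleton, Nat.cast_zero, zero_mul, sub_zero]
  refine h.congr_fun fun n => ?_
  rw [QConfluent.derivCoeff]
  push_cast
  ring

/-- The coefficient of `y ^ n` in `oneFOne a c y`. -/
def kummerCoeff (a c : ℂ) (n : ℕ) : ℂ := rising a n / (rising c n * (n.factorial : ℂ))

lemma kummerCoeff_succ (a c : ℂ) (n : ℕ) :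
    kummerCoeff a c (n + 1) = (a + n) / ((c + n) * (n + 1)) * kummerCoeff a c n := by
  simp only [kummerCoeff, rising, Finset.prod_range_succ, Nat.factorial_succ]
  push_cast
  rw [div_mul_div_comm]
  congr 1 <;> ring

lemma tendsto_kummer_ratio (a c : ℂ) :
    Tendsto (fun n : ℕ => (a + n) / ((c + n) * ((n : ℂ) + 1))) atTop (𝓝 0) := by
  have hinv : Tendsto (fun n : ℕ => ((n : ℂ))⁻¹) atTop (𝓝 0) := tendsto_inv_atTop_nhds_zero_nat
  have h1 : Tendsto (fun n : ℕ => (a * (n : ℂ)⁻¹ + 1) / (c * (n : ℂ)⁻¹ + 1) * ((n : ℂ) + 1)⁻¹)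
      atTop (𝓝 ((a * 0 + 1) / (c * 0 + 1) * 0)) := by
    refine (((hinv.const_mul a).add_const 1).div ((hinv.const_mul c).add_const 1) (by simp)).mul ?_
    simpa using (tendsto_add_atTop_iff_nat 1).2 hinv
  rw [mul_zero] at h1
  refine h1.congr' ?_
  filter_upwards [eventually_ne_atTop 0] with n hn
  have hn' : (n : ℂ) ≠ 0 := by exact_mod_cast hn
  rw [← mul_div_mul_right (a * (n : ℂ)⁻¹ + 1) _ hn', add_mul, add_mul, inv_mul_cancel_right₀ hn',
    inv_mul_cancel_right₀ hn', one_mul, ← div_eq_mul_inv, div_div]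

lemma isEntireSeries_kummerCoeff (a c : ℂ) : IsEntireSeries (kummerCoeff a c) :=
  isEntireSeries_of_ratio (tendsto_kummer_ratio a c) (kummerCoeff_succ a c)

/-- The first derivative of `oneFOne`. -/
def kummerDeriv (a c y : ℂ) : ℂ := ∑' n, derivCoeff (kummerCoeff a c) n * y ^ n

/-- The second derivative of `oneFOne`. -/
def kummerDeriv₂ (a c y : ℂ) : ℂ := ∑' n, derivCoeff (derivCoeff (kummerCoeff a c)) n * y ^ n

lemma hasDerivAt_oneFOne (a c y : ℂ) : HasDerivAt (oneFOne a c) (kummerDeriv a c y) y :=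
  (isEntireSeries_kummerCoeff a c).hasDerivAt y

lemma hasDerivAt_kummerDeriv (a c y : ℂ) :
    HasDerivAt (kummerDeriv a c) (kummerDeriv₂ a c y) y :=
  (isEntireSeries_kummerCoeff a c).derivCoeff.hasDerivAt y

/-- Kummer's differential equation. -/
theorem kummer_equation (a : ℂ) {c : ℂ} (hc : ∀ k : ℕ, c + k ≠ 0) (y : ℂ) :
    y * kummerDeriv₂ a c y + (c - y) * kummerDeriv a c y - a * oneFOne a c y = 0 := by
  have hE := isEntireSeries_kummerCoeff a c
  have h1 := hE.derivCoeff.hasSum_natCast_mul y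
  have h2 := (hE.derivCoeff y).of_norm.hasSum.mul_left c
  have h3 := hE.hasSum_natCast_mul y
  have h4 := (hE y).of_norm.hasSum.mul_left a
  have h := ((h1.add h2).sub h3).sub h4
  have hz : ∀ n : ℕ, n * derivCoeff (kummerCoeff a c) n * y ^ n +
      c * (derivCoeff (kummerCoeff a c) n * y ^ n) - n * kummerCoeff a c n * y ^ n -
      a * (kummerCoeff a c n * y ^ n) = 0 := by
    intro n
    have hcn := hc n
    have hn : (n : ℂ) + 1 ≠ 0 := by exact_mod_cast n.succ_ne_zero
    have : (c + n) * derivCoeff (kummerCoeff a c) n = (a + n) * kummerCoeff a c n := by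
      rw [derivCoeff, kummerCoeff_succ]
      field_simp
    linear_combination y ^ n * this
  simp only [hz] at h
  have h0 := h.unique hasSum_zero
  have e : oneFOne a c y = ∑' n, kummerCoeff a c n * y ^ n := rfl
  rw [kummerDeriv₂, kummerDeriv, e]
  linear_combination h0

lemma isOpen_cutPlane : IsOpen cutPlane := Complex.isOpen_slitPlane.preimage continuous_neg

lemma ne_zero_of_mem_cutPlane {z : ℂ} (hz : z ∈ cutPlane) : z ≠ 0 := by
  rintro rfl
  exact Complex.zero_notMem_slitPlane (by simp [cutPlane] at hz)

/-- The logarithmic derivative of `(-z) ^ (-α)` is `-α / z`. -/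
lemma hasDerivAt_neg_cpow_mul (α : ℂ) {g : ℂ → ℂ} {g' z : ℂ} (hz : z ∈ cutPlane)
    (hg : HasDerivAt g g' z) :
    HasDerivAt (fun w => (-w) ^ (-α) * g w) ((-z) ^ (-α) * (-(α / z) * g z + g')) z := by
  have hz0 := ne_zero_of_mem_cutPlane hz
  have h := (((hasDerivAt_id z).neg).cpow_const (c := -α) hz).mul hg
  refine h.congr_deriv ?_
  simp only [id, Pi.neg_apply]
  rw [Complex.cpow_sub _ _ (neg_ne_zero.2 hz0), Complex.cpow_one]
  field_simp

theorem isSolution_solInfinity {α β : ℂ} (hc : ∀ k : ℕ, α + 1 - β + k ≠ 0) :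
    IsSolution α β (solInfinity α β) := by
  set c := α + 1 - β with hcdef
  have hinv : ∀ z ∈ cutPlane, HasDerivAt (fun w : ℂ => 1 / w) (-(1 / z ^ 2)) z := by
    intro z hz
    simpa [one_div] using hasDerivAt_inv (ne_zero_of_mem_cutPlane hz)
  have hM : ∀ z ∈ cutPlane, HasDerivAt (fun w => oneFOne α c (1 / w))
      (kummerDeriv α c (1 / z) * -(1 / z ^ 2)) z := fun z hz =>
    (hasDerivAt_oneFOne α c (1 / z)).comp z (hinv z hz)
  have hM' : ∀ z ∈ cutPlane, HasDerivAt (fun w => kummerDeriv α c (1 / w))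
      (kummerDeriv₂ α c (1 / z) * -(1 / z ^ 2)) z := fun z hz =>
    (hasDerivAt_kummerDeriv α c (1 / z)).comp z (hinv z hz)
  have h1 : ∀ z ∈ cutPlane, HasDerivAt (solInfinity α β)
      ((-z) ^ (-α) * (-(α / z) * oneFOne α c (1 / z) +
        kummerDeriv α c (1 / z) * -(1 / z ^ 2))) z := fun z hz =>
    hasDerivAt_neg_cpow_mul α hz (hM z hz)
  refine ⟨fun z hz => (h1 z hz).differentiableAt.differentiableWithinAt, fun z hz => ?_⟩
  have hz0 := ne_zero_of_mem_cutPlane hz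
  have hev : deriv (solInfinity α β) =ᶠ[𝓝 z] fun w => (-w) ^ (-α) *
      (-(α * (1 / w)) * oneFOne α c (1 / w) + kummerDeriv α c (1 / w) * -((1 / w) * (1 / w))) := by
    filter_upwards [isOpen_cutPlane.mem_nhds hz] with w hw
    rw [(h1 w hw).deriv]
    congr 2 <;> ring
  have h2 := hasDerivAt_neg_cpow_mul α hz
    ((((hinv z hz).const_mul α).neg.mul (hM z hz)).add
      ((hM' z hz).mul ((hinv z hz).mul (hinv z hz)).neg))
  have h2' := (h2.congr_of_eventuallyEq hev).deriv
  rw [h2', (h1 z hz).deriv, solInfinity, ← hcdef]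
  have hk := kummer_equation α hc (1 / z)
  simp only [Pi.add_apply, Pi.mul_apply, Pi.neg_apply]
  generalize kummerDeriv₂ α c (1 / z) = M₂ at *
  generalize kummerDeriv α c (1 / z) = M₁ at *
  generalize oneFOne α c (1 / z) = M₀ at *
  field_simp at hk ⊢
  rw [hcdef] at hk
  linear_combination (-z) ^ (-α) * hk

end Kummer

section FormalSolution

lemma coeff_expDeriv (κ : ℂ) (g : LaurentSeries ℂ) (n : ℤ) :
    (expDeriv κ g).coeff n = (n + 1 + κ) * g.coeff (n + 1) - g.coeff (n + 2) := by
  rw [expDeriv, add_mul, HahnSeries.coeff_add, HahnSeries.coeff_add, HahnSeries.coeff_single_mul,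
    HahnSeries.coeff_single_mul, LaurentSeries.hasseDeriv_coeff, Nat.cast_one,
    Ring.choose_one_right,
    sub_neg_eq_add, sub_neg_eq_add, zsmul_eq_mul]
  push_cast
  ring

lemma coeff_zVar_mul (g : LaurentSeries ℂ) (n : ℤ) :
    (zVar * g).coeff n = g.coeff (n - 1) := by
  rw [zVar, HahnSeries.coeff_single_mul, one_mul]

lemma twoFZero_recurrence (a b : ℂ) (n : ℕ) :
    (n + 1) * PowerSeries.coeff (n + 1) (twoFZero a b) =
      (a + n) * (b + n) * PowerSeries.coeff n (twoFZero a b) := by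
  have hn : (n : ℂ) + 1 ≠ 0 := by exact_mod_cast n.succ_ne_zero
  have hf : (n.factorial : ℂ) ≠ 0 := by exact_mod_cast n.factorial_ne_zero
  simp only [twoFZero, PowerSeries.coeff_mk, rising, Finset.prod_range_succ, Nat.factorial_succ]
  push_cast
  field_simp

theorem isFormalSolution_twoFZero (α β : ℂ) :
    IsFormalSolution α β (1 - α - β) (twoFZero (1 - α) (1 - β)) := by
  rw [IsFormalSolution]
  ext k
  rw [HahnSeries.coeff_add, HahnSeries.coeff_add, add_mul, HahnSeries.coeff_add, one_mul, pow_two,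
    mul_assoc, mul_assoc, coeff_zVar_mul, coeff_zVar_mul, HahnSeries.C_apply, HahnSeries.C_apply,
    HahnSeries.coeff_single_zero_mul, HahnSeries.coeff_single_zero_mul, coeff_zVar_mul]
  simp only [coeff_expDeriv]
  rw [show k - 1 - 1 + 1 = k - 1 by ring, show k - 1 - 1 + 2 = k by ring,
    show k - 1 + 1 = k by ring, show k - 1 + 2 = k + 1 by ring]
  set G : LaurentSeries ℂ := HahnSeries.ofPowerSeries ℤ ℂ (twoFZero (1 - α) (1 - β))
  -- the recurrence of the coefficients, which at `k = -1` holds because of the factor `k + 1`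
  have key : ((k : ℂ) + 1) * G.coeff (k + 1) = (1 - α + k) * (1 - β + k) * G.coeff k := by
    rcases lt_or_ge k 0 with hk | hk
    · have h0 : G.coeff k = 0 := by
        simp only [G, PowerSeries.coeff_coe, if_pos hk]
      rw [h0, mul_zero]
      rcases eq_or_ne k (-1) with rfl | hk1
      · norm_num
      · have : G.coeff (k + 1) = 0 := by
          simp only [G, PowerSeries.coeff_coe, if_pos (show k + 1 < 0 by omega)]
        rw [this, mul_zero]
    · lift k to ℕ using hk
      have h1 : G.coeff ((k : ℤ) + 1) = PowerSeries.coeff (k + 1) (twoFZero (1 - α) (1 - β)) := by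
        exact_mod_cast LaurentSeries.coeff_coe_powerSeries _ (k + 1)
      have h2 : G.coeff (k : ℤ) = PowerSeries.coeff k (twoFZero (1 - α) (1 - β)) :=
        LaurentSeries.coeff_coe_powerSeries _ k
      rw [h1, h2]
      exact_mod_cast twoFZero_recurrence (1 - α) (1 - β) k
  rw [HahnSeries.coeff_zero]
  push_cast
  linear_combination -key

end FormalSolution

/-! ### The limits of the two sides of the connection formula -/

section TwoFOne

lemma exists_isTwoFOne {q : ℂ} (hq : ‖q‖ < 1) (hq0 : q ≠ 0) (a b : ℂ) :
    ∃ u : ℂ → ℂ, IsTwoFOne a b q u := by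
  obtain ⟨N, hN⟩ : ∃ N : ℕ, ‖q / b‖ * ‖q‖ ^ N < 1 := by
    have h := (tendsto_pow_atTop_nhds_zero_of_lt_one (norm_nonneg q) hq).const_mul ‖q / b‖
    rw [mul_zero] at h
    exact (h.eventually (gt_mem_nhds one_pos)).exists
  obtain ⟨g, hg, hg1, -⟩ := exists_entire_heine hq hq0 (q / a) hN
  exact ⟨fun x => g (a * b * x) / theta q (-(q * x)), fun x => g (a * b * x),
    hg.comp (differentiable_id.const_mul (a * b)), fun x hx => hg1 _ hx, fun x _ => rfl⟩

/-- The connection formula for `₂f₁`. -/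
theorem IsTwoFOne.eq_connectionRHS {a b q : ℂ} {u : ℂ → ℂ} (hu : IsTwoFOne a b q u)
    (hq : ‖q‖ < 1) (hq0 : q ≠ 0) (ha : a ≠ 0) (hb : b ≠ 0) (hab : ∀ n : ℤ, a ≠ b * q ^ n)
    {x : ℂ} (hx : x ≠ 0) (hqx : ‖q / (a * b * x)‖ < 1) : u x = connectionRHS a b q x := by
  obtain ⟨f, hf, hf1, hux⟩ := hu
  have hAB : ∀ n : ℤ, q / a ≠ q / b * q ^ n := by
    intro n h
    apply hab (-n)
    rw [zpow_neg]
    have := zpow_ne_zero n hq0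
    field_simp at h ⊢
    exact h.symm
  have hBA : ∀ n : ℤ, q / b ≠ q / a * q ^ n := by
    intro n h
    apply hab n
    field_simp at h ⊢
    exact h
  have hy : a * b * x ≠ 0 := mul_ne_zero (mul_ne_zero ha hb) hx
  have key := entire_eq_connection hq hq0 (div_ne_zero hq0 ha) (div_ne_zero hq0 hb) hAB hBA
    (f := fun y => f (y / (a * b))) (hf.comp (differentiable_id.div_const (a * b)))
    (fun y hy => by
      have e : a * b * (y / (a * b)) = y := by field_simp
      rw [hf1 _ (by rwa [e]), e]) hy hqx
  have e : a * b * x / (a * b) = x := by field_simp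
  rw [hux x hx, ← e, key, e, connectionRHS, connectionTerm, connectionTerm, connConst, connConst]
  have e1 : q / a / (q / b) = b / a := by field_simp
  have e2 : q / b / (q / a) = a / b := by field_simp
  have e3 : q / b * (a * b * x) = a * q * x := by field_simp
  have e4 : q / a * (a * b * x) = b * q * x := by field_simp
  have e5 : q / (q / a) = a := by field_simp
  have e6 : q / (q / b) = b := by field_simp
  have e7 : q * (q / b) / (q / a) = a * q / b := by field_simp
  have e8 : q * (q / a) / (q / b) = b * q / a := by field_simp
  rw [e1, e2, e3, e4, e5, e6, e7, e8, mul_comm b a]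
  ring

/-- For exponents `s` that are not integers, `q ^ s` is not an integral power of `q` once `q` is
near enough to `1`: the period `2πi / log q` of the exponential is then too long. -/
lemma eventually_qPow_ne {s : ℂ} (hs : ∀ n : ℤ, s ≠ n) :
    ∀ᶠ q : ℝ in 𝓝[<] 1, ∀ n : ℤ, qPow q s ≠ (q : ℂ) ^ n := by
  have hlog : Tendsto (fun q : ℝ => |Real.log q * s.im|) (𝓝[<] 1) (𝓝 0) := by
    have : Tendsto (fun q : ℝ => Real.log q) (𝓝[<] 1) (𝓝 0) := by
      have := (Real.continuousAt_log one_ne_zero).tendsto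
      rw [Real.log_one] at this
      exact this.mono_left nhdsWithin_le_nhds
    simpa using (this.mul_const s.im).abs
  filter_upwards [eventually_mem_Ioo, hlog.eventually (gt_mem_nhds Real.two_pi_pos)]
    with q hq hsm n h
  have hq0 : 0 < q := by linarith [hq.1]
  have h1 : qPow q (s - n) = 1 := by
    rw [qPow_sub hq0, h, qPow_intCast, div_self (zpow_ne_zero n (by exact_mod_cast hq0.ne'))]
  rw [qPow, Complex.cpow_def_of_ne_zero (by exact_mod_cast hq0.ne'), Complex.exp_eq_one_iff] at h1
  obtain ⟨m, hm⟩ := h1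
  rw [← Complex.ofReal_log hq0.le] at hm
  have him : Real.log q * s.im = m * (2 * Real.pi) := by
    have := congrArg Complex.im hm
    simpa using this
  have hm0 : m = 0 := by
    rw [him, abs_mul, abs_of_pos Real.two_pi_pos] at hsm
    have : |(m : ℝ)| < 1 := by
      by_contra! hcon
      nlinarith [Real.two_pi_pos]
    exact Int.abs_lt_one_iff.1 (by exact_mod_cast this)
  rw [hm0, Int.cast_zero, zero_mul] at hm
  rcases mul_eq_zero.1 hm with h2 | h2
  · have : Real.log q < 0 := Real.log_neg hq0 hq.2
    exact this.ne (by exact_mod_cast h2)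
  · exact hs n (sub_eq_zero.1 h2)

lemma eventually_qPow_ne_mul {α β : ℂ} (hαβ : ∀ n : ℤ, α - β ≠ n) :
    ∀ᶠ q : ℝ in 𝓝[<] 1, ∀ n : ℤ, qPow q α ≠ qPow q β * (q : ℂ) ^ n := by
  filter_upwards [eventually_mem_Ioo, eventually_qPow_ne hαβ] with q hq h n hn
  have hq0 : 0 < q := by linarith [hq.1]
  apply h n
  rw [qPow_sub hq0, hn, mul_div_cancel_left₀ _ (qPow_ne_zero hq0 β)]

/-- A quantity of order `1 - q` is small for `q` near `1`. -/
lemma eventually_norm_one_sub_mul_lt {t : ℝ → ℂ} {t₀ : ℂ} (ht : Tendsto t (𝓝[<] 1) (𝓝 t₀)) :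
    ∀ᶠ q : ℝ in 𝓝[<] 1, ‖((1 - q : ℝ) : ℂ) * t q‖ < 1 := by
  have h : Tendsto (fun q : ℝ => ((1 - q : ℝ) : ℂ)) (𝓝[<] 1) (𝓝 0) := by
    exact_mod_cast (Complex.continuous_ofReal.tendsto 0).comp tendsto_one_sub
  have h2 := (h.mul ht).norm
  rw [zero_mul, norm_zero] at h2
  exact h2.eventually (gt_mem_nhds one_pos)

lemma qPow_mul_qPow_mul_xVar {q : ℝ} (hq : 0 < q) (α β z : ℂ) :
    qPow q α * qPow q β * xVar q z = qPow q (α + β - 1) * ((q : ℂ) * xVar q z) := by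
  have hq' : (q : ℂ) ≠ 0 := by exact_mod_cast hq.ne'
  rw [qPow_sub hq, qPow_add hq, qPow_one]
  field_simp

/-- The triple product for `θ_q(-q^s q x)`, with the second factor written as a quantity of
order `1 - q`. -/
lemma theta_qPow_mul {q : ℝ} (hq : 0 < q) (hq1 : q < 1) (s : ℂ) {z : ℂ} (hz : z ≠ 0)
    (h : ‖((1 - q : ℝ) : ℂ) * (qPow q (-s) / z)‖ < 1) :
    theta q (-(qPow q s * (q * xVar q z))) = qPochInf (q : ℂ) q *
      qPochInf (qPow q s * (q * xVar q z)) q *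
      qPochInf (((1 - q : ℝ) : ℂ) * (qPow q (-s) / z)) q := by
  have hq' : (q : ℂ) ≠ 0 := by exact_mod_cast hq.ne'
  have h1 := one_sub_ne_zero hq1
  have h2 := qPow_ne_zero hq s
  have hX : xVar q z ≠ 0 := div_ne_zero hz h1
  have h3 : qPow q (-s) = (qPow q s)⁻¹ := by
    have := qPow_sub hq 0 s
    rwa [zero_sub, qPow_zero, one_div] at this
  have e : (q : ℂ) / (qPow q s * (q * xVar q z)) = ((1 - q : ℝ) : ℂ) * (qPow q (-s) / z) := by
    rw [h3, xVar]
    field_simp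
  rw [theta_neg_eq (norm_ofReal_lt_one hq hq1) hq' (mul_ne_zero h2 (mul_ne_zero hq' hX))
    (by rwa [e]), e]

lemma qPochInf_self_ne_zero {q : ℝ} (hq : 0 < q) (hq1 : q < 1) : qPochInf (q : ℂ) q ≠ 0 :=
  qPochInf_ne_zero (norm_ofReal_lt_one hq hq1)
    fun k => mul_pow_ne_one (norm_ofReal_lt_one hq hq1) (norm_ofReal_lt_one hq hq1) k

/-- By the triple product the elementary factor is a quotient of shifted factorials, which gives
the power of `-z`, divided by `((1 - q) / z;q)_∞`, which gives the exponential. -/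
theorem tendsto_wConst_mul_prefactor (α β : ℂ) {z : ℂ} (hz : z ∈ cutPlane) :
    Tendsto (fun q : ℝ =>
      wConst α β q * prefactor (qPow q α) (qPow q β) (q : ℂ) (xVar q z))
      (𝓝[<] 1) (𝓝 (expFactor α β z)) := by
  have hz0 := ne_zero_of_mem_cutPlane hz
  have h1 := tendsto_qPochInf_exp (t := fun _ => 1 / z) tendsto_const_nhds
  have h := (tendsto_ratio (α + β - 1) hz).div h1 (Complex.exp_ne_zero _)
  rw [Complex.exp_neg, div_inv_eq_mul, mul_comm,
    show -(α + β - 1) = 1 - α - β by ring] at h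
  refine h.congr' ?_
  filter_upwards [eventually_mem_Ioo,
    eventually_norm_one_sub_mul_lt (t := fun _ => 1 / z) tendsto_const_nhds] with q hq hqz
  have hq0 : 0 < q := by linarith [hq.1]
  have ht := theta_qPow_mul hq0 hq.2 0 hz0 (by rwa [neg_zero, qPow_zero])
  rw [neg_zero, qPow_zero, one_mul] at ht
  have hQ := qPochInf_self_ne_zero hq0 hq.2
  simp only [Pi.div_apply]
  rw [prefactor, ht, qPow_mul_qPow_mul_xVar hq0, wConst]
  field_simp

/-- The constant is a quotient of `q`-gamma functions, the theta quotient gives the power of `-z`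
since its two exponential factors cancel in the limit, and the series tends to `₁F₁`. -/
theorem tendsto_wConst_mul_connectionTerm {α β : ℂ} (hαβ : ∀ n : ℤ, α - β ≠ (n : ℂ)) {z : ℂ}
    (hz : z ∈ cutPlane) :
    Tendsto (fun q : ℝ =>
      wConst α β q * connectionTerm (qPow q α) (qPow q β) (q : ℂ) (xVar q z)) (𝓝[<] 1)
      (𝓝 (Complex.Gamma (β - α) / Complex.Gamma (1 - α) * solInfinity α β z)) := by
  have hz0 := ne_zero_of_mem_cutPlane hz
  have hc : ∀ k : ℕ, α + 1 - β + k ≠ 0 := fun k hk => hαβ (-(k + 1 : ℤ)) (by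
    push_cast; linear_combination hk)
  have hΓ : Complex.Gamma (β - α) ≠ 0 := Complex.Gamma_ne_zero fun m hm => hαβ m (by
    push_cast; linear_combination -hm)
  have ht₁ : Tendsto (fun q : ℝ => qPow q (-α) / z) (𝓝[<] 1) (𝓝 (1 / z)) :=
    (tendsto_qPow _).div_const z
  have ht₂ : Tendsto (fun q : ℝ => qPow q (1 - α - β) / z) (𝓝[<] 1) (𝓝 (1 / z)) :=
    (tendsto_qPow _).div_const z
  have ht₀ : Tendsto (fun _ : ℝ => 1 / z) (𝓝[<] 1) (𝓝 (1 / z)) := tendsto_const_nhds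
  have hG := (tendsto_invQGamma (1 - α)).div (tendsto_invQGamma (β - α)) (inv_ne_zero hΓ)
  have hE := (tendsto_qPochInf_exp ht₁).div (tendsto_qPochInf_exp ht₀) (Complex.exp_ne_zero _)
  have h := ((hG.mul (tendsto_ratio α hz)).mul hE).mul (tendsto_phi_oneFOne α hc ht₂)
  have hlim : (Complex.Gamma (1 - α))⁻¹ / (Complex.Gamma (β - α))⁻¹ * (-z) ^ (-α) *
      (Complex.exp (-(1 / z)) / Complex.exp (-(1 / z))) * oneFOne α (α + 1 - β) (1 / z) =
      Complex.Gamma (β - α) / Complex.Gamma (1 - α) * solInfinity α β z := by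
    rw [div_self (Complex.exp_ne_zero _), solInfinity, div_inv_eq_mul]
    ring
  rw [hlim] at h
  refine h.congr' ?_
  filter_upwards [eventually_mem_Ioo, eventually_norm_one_sub_mul_lt ht₁,
    eventually_norm_one_sub_mul_lt ht₀] with q hq hq1z hqz
  have hq0 : 0 < q := by linarith [hq.1]
  have hq' : (q : ℂ) ≠ 0 := by exact_mod_cast hq0.ne'
  have hθ₀ := theta_qPow_mul hq0 hq.2 0 hz0 (by rwa [neg_zero, qPow_zero])
  rw [neg_zero, qPow_zero, one_mul] at hθ₀
  have hθ := theta_qPow_mul hq0 hq.2 α hz0 hq1z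
  rw [← mul_assoc] at hθ
  have hQ := qPochInf_self_ne_zero hq0 hq.2
  have h1q := one_sub_ne_zero hq.2
  have ha := qPow_ne_zero hq0 α
  have hb := qPow_ne_zero hq0 β
  have e1 : (q : ℂ) / (qPow q α * qPow q β * xVar q z) =
      ((1 - q : ℝ) : ℂ) * (qPow q (1 - α - β) / z) := by
    rw [sub_sub, qPow_sub hq0, qPow_one, qPow_add hq0, xVar]
    field_simp
  have e2 : qPow q α * q / qPow q β = qPow q (α + 1 - β) := by
    rw [qPow_sub hq0, qPow_add hq0, qPow_one]
  have e3 : ((1 - q : ℝ) : ℂ) ^ (1 - α - β) * ((1 - q : ℝ) : ℂ) ^ (β - α - 1) =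
      ((1 - q : ℝ) : ℂ) ^ (1 - α - 1) * ((1 - q : ℝ) : ℂ) ^ (-α) := by
    rw [← Complex.cpow_add _ _ h1q, ← Complex.cpow_add _ _ h1q]
    congr 1
    ring
  have hw : ((1 - q : ℝ) : ℂ) ^ (β - α - 1) ≠ 0 := by
    rw [Complex.cpow_ne_zero_iff]; exact Or.inl h1q
  have e4 : ((1 - q : ℝ) : ℂ) ^ (1 - α - β) = ((1 - q : ℝ) : ℂ) ^ (1 - α - 1) *
      ((1 - q : ℝ) : ℂ) ^ (-α) / ((1 - q : ℝ) : ℂ) ^ (β - α - 1) := by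
    rw [← e3, mul_div_cancel_right₀ _ hw]
  simp only [Pi.div_apply]
  rw [connectionTerm, hθ₀, hθ, e1, e2, div_qPow hq0, ← qPow_sub hq0, wConst, e4, invQGamma,
    invQGamma, mul_assoc (qPow q α) q]
  generalize qPochInf (qPow q (β - α)) q = P
  -- if `P = 0`, both sides vanish by the convention on division by `0`
  rcases eq_or_ne P 0 with rfl | hP
  · simp
  · field_simp

theorem tendsto_wConst_mul_connectionRHS {α β : ℂ} (hαβ : ∀ n : ℤ, α - β ≠ (n : ℂ)) {z : ℂ}
    (hz : z ∈ cutPlane) :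
    Tendsto (fun q : ℝ =>
      wConst α β q * connectionRHS (qPow q α) (qPow q β) (q : ℂ) (xVar q z))
      (𝓝[<] 1) (𝓝 (limitRHS α β z)) := by
  have hβα : ∀ n : ℤ, β - α ≠ (n : ℂ) := fun n hn => hαβ (-n) (by
    push_cast; linear_combination -hn)
  have hw : ∀ q : ℝ, wConst β α q = wConst α β q := fun q => by
    rw [wConst, wConst, sub_right_comm]
  have h := (tendsto_wConst_mul_connectionTerm hαβ hz).add
    (tendsto_wConst_mul_connectionTerm hβα hz)
  simp only [hw, ← mul_add] at h
  exact h

/-- The connection formula holds at `x = z / (1 - q)` for all `q` near `1`. -/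
lemma eventually_eq_connectionRHS {α β : ℂ} (hαβ : ∀ n : ℤ, α - β ≠ (n : ℂ)) {z : ℂ}
    (hz : z ≠ 0) : ∀ᶠ q : ℝ in 𝓝[<] 1, ∀ u : ℂ → ℂ, IsTwoFOne (qPow q α) (qPow q β) q u →
      u (xVar q z) = connectionRHS (qPow q α) (qPow q β) (q : ℂ) (xVar q z) := by
  have ht : Tendsto (fun q : ℝ => qPow q (1 - α - β) / z) (𝓝[<] 1) (𝓝 (1 / z)) :=
    (tendsto_qPow _).div_const z
  filter_upwards [eventually_mem_Ioo, eventually_norm_one_sub_mul_lt ht,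
    eventually_qPow_ne_mul hαβ] with q hq hqz hab u hu
  have hq0 : 0 < q := by linarith [hq.1]
  have h1q := one_sub_ne_zero hq.2
  have ha := qPow_ne_zero hq0 α
  have hb := qPow_ne_zero hq0 β
  refine hu.eq_connectionRHS (norm_ofReal_lt_one hq0 hq.2) (by exact_mod_cast hq0.ne') ha hb hab
    (div_ne_zero hz h1q) ?_
  have e1 : (q : ℂ) / (qPow q α * qPow q β * xVar q z) =
      ((1 - q : ℝ) : ℂ) * (qPow q (1 - α - β) / z) := by
    rw [sub_sub, qPow_sub hq0, qPow_one, qPow_add hq0, xVar]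
    field_simp
  rwa [e1]

end TwoFOne

/-! ### The asymptotic expansion -/

section Expansion

theorem tendsto_coeff_rescale_phiFormal (α β : ℂ) (n : ℕ) :
    Tendsto (fun q : ℝ => PowerSeries.coeff n
        (PowerSeries.rescale (qPow q α * qPow q β / ((1 - q : ℝ) : ℂ))
          (phiFormal ((q : ℂ) / qPow q α) ((q : ℂ) / qPow q β) 0 (q : ℂ))))
      (𝓝[<] 1) (𝓝 (PowerSeries.coeff n (twoFZero (1 - α) (1 - β)))) := by
  have hab := ((tendsto_qPow α).mul (tendsto_qPow β)).pow n
  rw [mul_one, one_pow] at hab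
  have h := (((tendsto_qPoch_div (1 - α) n).mul (tendsto_qPoch_div (1 - β) n)).div
    (tendsto_qPoch_self_div n) (by exact_mod_cast n.factorial_ne_zero)).mul hab
  rw [mul_one] at h
  rw [twoFZero, PowerSeries.coeff_mk]
  refine h.congr' ?_
  filter_upwards [eventually_mem_Ioo] with q hq
  have hq0 : 0 < q := by linarith [hq.1]
  have h1q := one_sub_ne_zero hq.2
  have hQ := qPoch_self_ne_zero (norm_ofReal_lt_one hq0 hq.2) n
  simp only [Pi.div_apply]
  rw [PowerSeries.coeff_rescale, phiFormal, PowerSeries.coeff_mk, phiCoeff, div_qPow hq0,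
    div_qPow hq0, qPoch_zero_left, one_mul, div_pow]
  field_simp

lemma expFactor_ne_zero (α β : ℂ) {z : ℂ} (hz : z ≠ 0) : expFactor α β z ≠ 0 :=
  mul_ne_zero (Complex.exp_ne_zero _)
    ((Complex.cpow_ne_zero_iff).2 (Or.inl (neg_ne_zero.2 hz)))

/-- The bound for the remainder of Heine's series passes to the limit `q → 1`. -/
lemma exists_norm_remainder_le {α β : ℂ} (hαβ : ∀ n : ℤ, α - β ≠ (n : ℂ)) {c : ℝ} (hc : 0 < c)
    (hc1 : c ≤ 1) {N : ℕ} (hN : β.re < N + 1) :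
    ∃ D : ℝ, ∀ z ∈ cutPlane, ‖z‖ ≤ 1 → InCone c z →
      ‖limitRHS α β z / expFactor α β z -
        ∑ n ∈ Finset.range N, PowerSeries.coeff n (twoFZero (1 - α) (1 - β)) * z ^ n‖
        ≤ D * ‖z‖ ^ N := by
  obtain ⟨D, -, hD⟩ := exists_norm_heine_remainder_le α β hc hc1 hN
  refine ⟨D, fun z hz hz1 hzc => ?_⟩
  have hz0 := ne_zero_of_mem_cutPlane hz
  have hpre := tendsto_wConst_mul_prefactor α β hz
  have hlim := ((tendsto_wConst_mul_connectionRHS hαβ hz).div hpre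
    (expFactor_ne_zero α β hz0)).sub (tendsto_finsetSum (Finset.range N) fun n _ =>
      (tendsto_coeff_rescale_phiFormal α β n).mul_const (z ^ n))
  refine le_of_tendsto hlim.norm ?_
  filter_upwards [eventually_mem_Ioo, hD, eventually_inCone_qPow_mul_xVar (α + β) hc hc1,
    eventually_eq_connectionRHS hαβ hz0, hpre.eventually_ne (expFactor_ne_zero α β hz0)]
    with q hq hDq hcone hconn hne
  have hq0 : 0 < q := by linarith [hq.1]
  have hq' : (q : ℂ) ≠ 0 := by exact_mod_cast hq0.ne'
  have hBN : ‖(q : ℂ) / qPow q β‖ * ‖(q : ℂ)‖ ^ N < 1 := by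
    rw [div_qPow hq0, norm_qPow hq0, Complex.norm_real, Real.norm_of_nonneg hq0.le,
      ← Real.rpow_natCast, ← Real.rpow_add hq0]
    exact Real.rpow_lt_one hq0.le hq.2 (by simp; linarith)
  obtain ⟨g, hg, hg1, hg2⟩ := exists_entire_heine (norm_ofReal_lt_one hq0 hq.2) hq'
    ((q : ℂ) / qPow q α) hBN
  have hu : IsTwoFOne (qPow q α) (qPow q β) q
      fun x => g (qPow q α * qPow q β * x) / theta q (-(q * x)) :=
    ⟨_, hg.comp (differentiable_id.const_mul (qPow q α * qPow q β)), fun x hx => hg1 _ hx,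
      fun x _ => rfl⟩
  have hy : ∀ k : ℕ, qPow q α * qPow q β * xVar q z * (q : ℂ) ^ k ≠ 1 := fun k => by
    rw [← qPow_add hq0]
    exact ((hcone z hzc).mul_pow hq0.le k).ne_one (by positivity)
  have hsum : ∀ n : ℕ, PowerSeries.coeff n
      (PowerSeries.rescale (qPow q α * qPow q β / ((1 - q : ℝ) : ℂ))
        (phiFormal ((q : ℂ) / qPow q α) ((q : ℂ) / qPow q β) 0 (q : ℂ))) * z ^ n =
      phiCoeff ((q : ℂ) / qPow q α) ((q : ℂ) / qPow q β) 0 q n *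
        (qPow q α * qPow q β * xVar q z) ^ n := by
    intro n
    rw [PowerSeries.coeff_rescale, phiFormal, PowerSeries.coeff_mk, xVar, mul_div_assoc',
      mul_div_right_comm, mul_pow]
    ring
  have hb := hDq z hz1 hzc
  rw [qPow_add hq0, ← div_qPow hq0, ← div_qPow hq0] at hb
  simp only [Pi.div_apply, hsum]
  rw [← hconn _ hu, hg2 _ hy, mul_div_mul_left _ _ (left_ne_zero_of_mul hne), mul_div_right_comm,
    ← prefactor, mul_div_cancel_left₀ _ (right_ne_zero_of_mul hne), add_sub_cancel_left]
  exact hb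

/-- Expansions of high order contain those of low order. -/
lemma hasAsymptoticExpansion_of_le {h : ℂ → ℂ} {S : Set ℂ} {g : PowerSeries ℂ} (M : ℕ)
    (H : ∀ N, M ≤ N → (fun z => h z - ∑ n ∈ Finset.range N, PowerSeries.coeff n g * z ^ n)
      =O[𝓝[S] 0] fun z => z ^ N) : HasAsymptoticExpansion h S g := by
  have step : ∀ N, ((fun z => h z - ∑ n ∈ Finset.range (N + 1), PowerSeries.coeff n g * z ^ n)
      =O[𝓝[S] 0] fun z => z ^ (N + 1)) →
      (fun z => h z - ∑ n ∈ Finset.range N, PowerSeries.coeff n g * z ^ n)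
        =O[𝓝[S] 0] fun z => z ^ N := by
    intro N hN
    have h1 : (fun z : ℂ => z ^ (N + 1)) =O[𝓝[S] 0] fun z => z ^ N :=
      (isLittleO_pow_pow (Nat.lt_succ_self N)).isBigO.mono nhdsWithin_le_nhds
    refine ((hN.trans h1).add (isBigO_const_mul_self (PowerSeries.coeff N g) _ _)).congr_left ?_
    intro z
    rw [Finset.sum_range_succ]
    ring
  intro N
  rcases le_total M N with hMN | hMN
  · exact H N hMN
  · exact Nat.decreasingInduction (motive := fun k _ =>
      (fun z => h z - ∑ n ∈ Finset.range k, PowerSeries.coeff n g * z ^ n)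
        =O[𝓝[S] 0] fun z => z ^ k) (fun k _ => step k) (H M le_rfl) hMN

theorem hasAsymptoticExpansion_limitRHS {α β : ℂ} (hαβ : ∀ n : ℤ, α - β ≠ (n : ℂ)) {δ : ℝ}
    (hδ : 0 < δ) :
    HasAsymptoticExpansion (fun z => limitRHS α β z / expFactor α β z) (sector δ)
      (twoFZero (1 - α) (1 - β)) := by
  rcases lt_or_ge Real.pi δ with hπ | hπ
  · -- the sector is empty
    have : sector δ = ∅ := Set.eq_empty_of_forall_notMem fun z hz => by
      linarith [hz.2, abs_nonneg (Complex.arg (-z))]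
    intro N
    refine IsBigO.of_bound 1 ?_
    rw [this, nhdsWithin_empty]
    exact eventually_bot
  have hc : 0 < Real.sin (δ / 2) :=
    Real.sin_pos_of_pos_of_lt_pi (by linarith) (by linarith [Real.pi_pos])
  obtain ⟨M, hM⟩ := exists_nat_gt β.re
  refine hasAsymptoticExpansion_of_le M fun N hN => ?_
  obtain ⟨D, hD⟩ := exists_norm_remainder_le hαβ hc (Real.sin_le_one _) (N := N) (by
    have : (M : ℝ) ≤ N := by exact_mod_cast hN
    linarith)
  refine IsBigO.of_bound D ?_
  have hball : ∀ᶠ z in 𝓝[sector δ] (0 : ℂ), ‖z‖ ≤ 1 :=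
    nhdsWithin_le_nhds ((continuous_norm.tendsto' (0 : ℂ) 0 norm_zero).eventually
      (ge_mem_nhds one_pos))
  filter_upwards [self_mem_nhdsWithin, hball] with z hz hz1
  rw [norm_pow]
  exact hD z (mem_cutPlane_of_mem_sector hδ hz) hz1 (inCone_of_mem_sector hδ hz)

end Expansion

end

end QConfluent

open QConfluent in
theorem mainTheorem3 (α β : ℂ) (hαβ : ∀ n : ℤ, α - β ≠ (n : ℂ)) :
    -- the right-hand side of the connection formula, multiplied by `w`, converges
    (∀ z ∈ cutPlane,
      Tendsto
        (fun q : ℝ => wConst α β q * connectionRHS (qPow q α) (qPow q β) (q : ℂ) (xVar q z))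
        (𝓝[<] 1) (𝓝 (limitRHS α β z))) ∧
    -- the function `₂f₁` exists, and `w · ₂f₁` converges to the same limit
    (∀ q ∈ Set.Ioo (0 : ℝ) 1, ∃ u : ℂ → ℂ, IsTwoFOne (qPow q α) (qPow q β) (q : ℂ) u) ∧
    (∀ u : ℝ → ℂ → ℂ,
      (∀ q ∈ Set.Ioo (0 : ℝ) 1, IsTwoFOne (qPow q α) (qPow q β) (q : ℂ) (u q)) →
      ∀ z ∈ cutPlane,
        Tendsto (fun q : ℝ => wConst α β q * u q (xVar q z)) (𝓝[<] 1)
          (𝓝 (limitRHS α β z))) ∧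
    -- formal limit of the left-hand side: its elementary factor converges, and its power
    -- series in `z` converges coefficient by coefficient
    (∀ z ∈ cutPlane,
      Tendsto
        (fun q : ℝ => wConst α β q * prefactor (qPow q α) (qPow q β) (q : ℂ) (xVar q z))
        (𝓝[<] 1) (𝓝 (expFactor α β z))) ∧
    (∀ n : ℕ,
      Tendsto
        (fun q : ℝ => PowerSeries.coeff n
          (PowerSeries.rescale (qPow q α * qPow q β / ((1 - q : ℝ) : ℂ))
            (phiFormal ((q : ℂ) / qPow q α) ((q : ℂ) / qPow q β) 0 (q : ℂ))))
        (𝓝[<] 1) (𝓝 (PowerSeries.coeff n (twoFZero (1 - α) (1 - β))))) ∧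
    -- the resulting asymptotic formula as `z → 0`
    (∀ δ : ℝ, 0 < δ →
      HasAsymptoticExpansion (fun z => limitRHS α β z / expFactor α β z) (sector δ)
        (twoFZero (1 - α) (1 - β))) ∧
    -- both sides solve the degenerate confluent equation
    IsFormalSolution α β (1 - α - β) (twoFZero (1 - α) (1 - β)) ∧
    IsSolution α β (solInfinity α β) ∧
    IsSolution α β (solInfinity β α) := by
  refine ⟨fun z hz => tendsto_wConst_mul_connectionRHS hαβ hz, fun q hq => ?_, fun u hu z hz => ?_,
    fun z hz => tendsto_wConst_mul_prefactor α β hz, tendsto_coeff_rescale_phiFormal α β,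
    fun δ hδ => hasAsymptoticExpansion_limitRHS hαβ hδ, isFormalSolution_twoFZero α β,
    isSolution_solInfinity fun k hk => ?_, ?_⟩
  · exact exists_isTwoFOne (norm_ofReal_lt_one hq.1 hq.2) (by exact_mod_cast hq.1.ne') _ _
  · refine (tendsto_wConst_mul_connectionRHS hαβ hz).congr' ?_
    filter_upwards [eventually_mem_Ioo,
      eventually_eq_connectionRHS hαβ (ne_zero_of_mem_cutPlane hz)] with q hq h
    rw [h (u q) (hu q ⟨by linarith [hq.1], hq.2⟩)]
  · exact hαβ (-(k + 1 : ℤ)) (by push_cast; linear_combination hk)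
  · -- the equation is symmetric in `α` and `β`
    have h : IsSolution β α (solInfinity β α) := isSolution_solInfinity fun k hk =>
      hαβ (k + 1 : ℤ) (by push_cast; linear_combination -hk)
    rwa [IsSolution, add_comm β α, mul_comm β α] at h
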